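/- **Setting.** Let $\mathcal G=(\mathrm V,\mathrm E)$ be a connected metric graph with finitely many edges: each bounded edge $e$ is identified with $I_e=[0,\ell_e]$, $0<\ell_e<\infty$, each unbounded edge with $I_e=[0,+\infty)$. Assume that the compact core $\mathcal K$ (the subgraph of all bounded edges; $\mathcal K=\mathcal G$ if $\mathcal G$ is compact) is non-empty. Let $p>2$, $A\in L^2_{\rm loc}(\mathcal G,\mathbb R)$, and $V\in L^1_{\rm loc}(\mathcal G,\mathbb R)$ with $V\ge 1$. Put $D_Au=\frac1i u'-Au$, $$H^1_A(\mathcal G,\mathbb C)=\Big\{u\in C(\mathcal G,\mathbb C): D_Au\in L^2(\mathcal G,\mathbb C),\ \int_{\mathcal G}V|u|^2\,dx<\infty\Big\},\qquad \|u\|^2=\int_{\mathcal G}\big(|D_Au|^2+V|u|^2\big)\,dx,$$ $(u,v)_2=\operatorname{Re}\int_{\mathcal G}u\bar v\,dx$, $\|u\|_2^2=(u,u)_2$, and $$E(u,\mathcal G)=\frac12\|u\|^2-\frac1p\int_{\mathcal K}|u|^p\,dx,\qquad H_\mu(\mathcal G)=\Big\{u\in H^1_A(\mathcal G,\mathbb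 C):\int_{\mathcal G}|u|^2\,dx=\mu\Big\},\qquad \lambda_1=\inf_{u\in H^1_A(\mathcal G,\mathbb C)\setminus\{0\}}\frac{\|u\|^2}{\|u\|_2^2}.$$ A critical point of $E(\cdot,\mathcal G)$ constrained on $H_\mu(\mathcal G)$ with Lagrange multiplier $\lambda\in\mathbb R$ is a $u\in H_\mu(\mathcal G)$ with $E'(u,\mathcal G)=\lambda\,(u,\cdot)_2$ on $H^1_A(\mathcal G,\mathbb C)$. Let $D_A^2+V$ denote the self-adjoint operator in $L^2(\mathcal G,\mathbb C)$ associated with the quadratic form $\int_{\mathcal G}(D_Au\,\overline{D_Av}+Vu\bar v)\,dx$ with domain $H^1_A(\mathcal G,\mathbb C)$. Consider the conditions: * **(G)** $\lambda_1$ is achieved by some $\varphi_1\in H^1_A(\mathcal G,\mathbb C)\setminus\{0\}$ with $\varphi_1|_{\mathcal K}\not\equiv0$. * **(G$_m$)** There is $m\in\{1,2,\dots\}\cup\{+\infty\}$ such that $D_A^2+V$ has an increasing sequence of $m$ distinct eigenvalues, all strictly below $\inf\sigma_{\rm ess}(D_A^2+V)$ (with $\inf\emptyset=+\infty$). **Theorem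 1.3.** Assume that (G) or (G$_m$) holds. Then there exists $\mu_0>0$ such that for every $0<\mu\le\mu_0$, $E(\cdot,\mathcal G)$ has a critical point $u\in H^1_A(\mathcal G,\mathbb C)$ constrained on $H_\mu(\mathcal G)$ with Lagrange multiplier $\lambda\in[0,\lambda_1]$ (and $\lambda\in[0,\lambda_1)$ if (G) holds). Moreover, if $2<p<6$, then for every $\mu>0$, $E(\cdot,\mathcal G)$ has a critical point $u\in H^1_A(\mathcal G,\mathbb C)$ constrained on $H_\mu(\mathcal G)$ with Lagrange multiplier $\lambda\in(-\infty,\lambda_1]$ (and $\lambda\in(-\infty,\lambda_1)$ if (G) holds). -/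

import Mathlib

open MeasureTheory
open scoped ContDiff

noncomputable section

/-- A metric graph with vertex set `N`, bounded edges `B` and unbounded edges (half-lines) `H`.
Loops and multiple edges are allowed. A bounded edge `b` is identified with `[0, len b]`, its
point `0` being glued to the vertex `init (inl b)` and its point `len b` to `term b`; a half-line
`h` is identified with `[0, ∞)`, its point `0` being glued to `init (inr h)`.
The bounded edges form the compact core; the graph is compact iff `H` is empty. -/
structure MetricGraph (N B H : Type*) where
  len : B → ℝ
  len_pos : ∀ b, 0 < len b
  init : B ⊕ H → N
  term : B → N

/-- `g` is the weak derivative of `f` on the interval `s`. -/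
def HasWeakDerivOn (s : Set ℝ) (f g : ℝ → ℂ) : Prop :=
  LocallyIntegrableOn f s ∧ LocallyIntegrableOn g s ∧
    ∀ φ : ℝ → ℝ, ContDiff ℝ ∞ φ → HasCompactSupport φ → tsupport φ ⊆ interior s →
      ∫ x in s, deriv φ x • f x = -∫ x in s, φ x • g x

open Classical in
/-- The weak derivative of `f` on `s` (unique almost everywhere), and `0` if there is none. -/
def weakDerivOn (s : Set ℝ) (f : ℝ → ℂ) : ℝ → ℂ :=
  if h : ∃ g, HasWeakDerivOn s f g then h.choose else 0

namespace MetricGraph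

variable {N B H : Type*} (G : MetricGraph N B H)

/-- Any two vertices are joined by a path of (bounded) edges. -/
def IsConnected : Prop :=
  (SimpleGraph.fromRel fun v w : N => ∃ b, G.init (Sum.inl b) = v ∧ G.term b = w).Connected

/-- The interval identified with the edge `e`. -/
def I : B ⊕ H → Set ℝ
  | Sum.inl b => Set.Icc 0 (G.len b)
  | Sum.inr _ => Set.Ici 0

/-- `A ∈ L²_loc(G, ℝ)`: square integrable on every bounded subset of the graph. -/
def MemL2Loc (A : B ⊕ H → ℝ → ℝ) : Prop :=
  ∀ e, ∀ R : ℝ, MemLp (A e) 2 (volume.restrict (G.I e ∩ Set.Icc 0 R))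

/-- `V ∈ L¹_loc(G, ℝ)`: integrable on every bounded subset of the graph. -/
def MemL1Loc (V : B ⊕ H → ℝ → ℝ) : Prop :=
  ∀ e, ∀ R : ℝ, IntegrableOn (V e) (G.I e ∩ Set.Icc 0 R)

/-- `f ∈ L²(G, ℂ)`; only the values of `f e` on `I e` matter. -/
def MemL2 (f : B ⊕ H → ℝ → ℂ) : Prop :=
  ∀ e, MemLp (f e) 2 (volume.restrict (G.I e))

/-- Continuous functions on `G`: families of continuous functions on the edges whose values at
the endpoints that are glued together agree. So that equality of functions on `G` is equality of
families, each `u e` is required to vanish outside `I e`. -/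
def IsContinuous (u : B ⊕ H → ℝ → ℂ) : Prop :=
  (∀ e, ∀ x ∉ G.I e, u e x = 0) ∧ (∀ e, ContinuousOn (u e) (G.I e)) ∧
    ∃ val : N → ℂ, (∀ e, u e 0 = val (G.init e)) ∧
      ∀ b, u (Sum.inl b) (G.len b) = val (G.term b)

/-- The magnetic derivative `D_A u = (1/i) u' - A u`. -/
def DA (A : B ⊕ H → ℝ → ℝ) (u : B ⊕ H → ℝ → ℂ) (e : B ⊕ H) (x : ℝ) : ℂ :=
  (1 / Complex.I) * weakDerivOn (G.I e) (u e) x - (A e x : ℂ) * u e x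

/-- The magnetic Sobolev space `H¹_A(G, ℂ)`. -/
def H1A (A V : B ⊕ H → ℝ → ℝ) : Set (B ⊕ H → ℝ → ℂ) :=
  {u | G.IsContinuous u ∧ (∀ e, ∃ g, HasWeakDerivOn (G.I e) (u e) g) ∧ G.MemL2 (G.DA A u) ∧
    ∀ e, IntegrableOn (fun x => V e x * ‖u e x‖ ^ 2) (G.I e)}

variable [Fintype B] [Fintype H]

/-- The complex `L²(G, ℂ)` inner product `∫_G u v̄`. -/
def innerL2 (u v : B ⊕ H → ℝ → ℂ) : ℂ :=
  ∑ e, ∫ x in G.I e, u e x * star (v e x)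

/-- The mass `‖u‖₂² = ∫_G |u|²`. -/
def mass (u : B ⊕ H → ℝ → ℂ) : ℝ :=
  ∑ e, ∫ x in G.I e, ‖u e x‖ ^ 2

/-- The sesquilinear form `∫_G (D_A u \overline{D_A v} + V u v̄)`. -/
def form (A V : B ⊕ H → ℝ → ℝ) (u v : B ⊕ H → ℝ → ℂ) : ℂ :=
  ∑ e, ∫ x in G.I e,
    (G.DA A u e x * star (G.DA A v e x) + (V e x : ℂ) * (u e x * star (v e x)))

/-- `‖u‖² = ∫_G (|D_A u|² + V |u|²)`. -/
def normSq (A V : B ⊕ H → ℝ → ℝ) (u : B ⊕ H → ℝ → ℂ) : ℝ :=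
  ∑ e, ∫ x in G.I e, (‖G.DA A u e x‖ ^ 2 + V e x * ‖u e x‖ ^ 2)

/-- The norm of `H¹_A(G, ℂ)`. -/
def norm (A V : B ⊕ H → ℝ → ℝ) (u : B ⊕ H → ℝ → ℂ) : ℝ :=
  √(G.normSq A V u)

/-- `Ψ(u, G) = (1/p) ∫_K |u|^p`, where `K` is the compact core (`K = G` if `G` is compact). -/
def Psi (p : ℝ) (u : B ⊕ H → ℝ → ℂ) : ℝ :=
  (1 / p) * ∑ b : B, ∫ x in G.I (Sum.inl b), ‖u (Sum.inl b) x‖ ^ p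

/-- The energy `E(u, G) = ‖u‖² / 2 - Ψ(u, G)`. -/
def energy (A V : B ⊕ H → ℝ → ℝ) (p : ℝ) (u : B ⊕ H → ℝ → ℂ) : ℝ :=
  (1 / 2) * G.normSq A V u - G.Psi p u

/-- The sphere `H_μ(G)` of functions of `H¹_A(G, ℂ)` with mass `μ`. -/
def sphere (A V : B ⊕ H → ℝ → ℝ) (μ : ℝ) : Set (B ⊕ H → ℝ → ℂ) :=
  {u | u ∈ G.H1A A V ∧ G.mass u = μ}

/-- `L` is the Fréchet derivative at `u` of the functional `F` on `H¹_A(G, ℂ)` (viewed as a real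
normed space). -/
def HasFrechetDeriv (A V : B ⊕ H → ℝ → ℝ) (F L : (B ⊕ H → ℝ → ℂ) → ℝ)
    (u : B ⊕ H → ℝ → ℂ) : Prop :=
  ∀ ε > 0, ∃ δ > 0, ∀ v ∈ G.H1A A V, G.norm A V v < δ →
    |F (u + v) - F u - L v| ≤ ε * G.norm A V v

/-- `u` is a critical point of the energy constrained on `H_μ(G)` with Lagrange multiplier `lam`:
`u ∈ H_μ(G)` and `E'(u) = lam (u, ·)₂`, where `(u, v)₂ = Re ∫_G u v̄`. -/
def IsConstrainedCriticalPoint (A V : B ⊕ H → ℝ → ℝ) (p μ : ℝ) (u : B ⊕ H → ℝ → ℂ)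
    (lam : ℝ) : Prop :=
  u ∈ G.sphere A V μ ∧
    G.HasFrechetDeriv A V (G.energy A V p) (fun v => lam * (G.innerL2 u v).re) u

/-- `λ₁`, the infimum of the Rayleigh quotient over `H¹_A(G, ℂ) \ {0}`. -/
def lambda1 (A V : B ⊕ H → ℝ → ℝ) : ℝ :=
  sInf {r | ∃ u ∈ G.H1A A V, u ≠ 0 ∧ r = G.normSq A V u / G.mass u}

/-- Condition (G): `λ₁` is achieved by a function that is not identically zero on the compact
core. -/
def CondG (A V : B ⊕ H → ℝ → ℝ) : Prop :=
  ∃ φ ∈ G.H1A A V, φ ≠ 0 ∧ G.normSq A V φ / G.mass φ = G.lambda1 A V ∧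
    ∃ b : B, ∃ x ∈ G.I (Sum.inl b), φ (Sum.inl b) x ≠ 0

/-- `T u = f`, where `T = D_A² + V` is the self-adjoint operator in `L²(G, ℂ)` associated with the
quadratic form: `u ∈ H¹_A(G, ℂ)`, `f ∈ L²(G, ℂ)` and `Q(u, v) = (f, v)₂` for all
`v ∈ H¹_A(G, ℂ)`. -/
def OpEq (A V : B ⊕ H → ℝ → ℝ) (u f : B ⊕ H → ℝ → ℂ) : Prop :=
  u ∈ G.H1A A V ∧ G.MemL2 f ∧ ∀ v ∈ G.H1A A V, G.form A V u v = G.innerL2 f v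

/-- `lam` is in the resolvent set of `T`: `T - lam` is a bijection of the domain of `T` onto
`L²(G, ℂ)` with bounded inverse. -/
def InResolventSet (A V : B ⊕ H → ℝ → ℝ) (lam : ℝ) : Prop :=
  (∀ u, G.OpEq A V u ((lam : ℂ) • u) → u = 0) ∧
    ∃ C : ℝ, ∀ f, G.MemL2 f → ∃ u, G.OpEq A V u (f + (lam : ℂ) • u) ∧ G.mass u ≤ C * G.mass f

/-- The spectrum of `T`, which is real since `T` is self-adjoint. -/
def spec (A V : B ⊕ H → ℝ → ℝ) : Set ℝ :=
  {lam | ¬ G.InResolventSet A V lam}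

/-- The eigenfunctions of `T` for `lam`, together with `0`. -/
def eigenfunctions (A V : B ⊕ H → ℝ → ℝ) (lam : ℝ) : Set (B ⊕ H → ℝ → ℂ) :=
  {u | G.OpEq A V u ((lam : ℂ) • u)}

/-- `lam` is an eigenvalue of `T`. -/
def IsEigenvalue (A V : B ⊕ H → ℝ → ℝ) (lam : ℝ) : Prop :=
  ∃ u ∈ G.eigenfunctions A V lam, u ≠ 0

/-- The discrete spectrum of `T`: the isolated points of the spectrum that are eigenvalues of
finite multiplicity. -/
def discSpec (A V : B ⊕ H → ℝ → ℝ) : Set ℝ :=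
  {lam | lam ∈ G.spec A V ∧ (∃ ε > 0, ∀ t ∈ G.spec A V, |t - lam| < ε → t = lam) ∧
    G.IsEigenvalue A V lam ∧
    FiniteDimensional ℂ (Submodule.span ℂ (G.eigenfunctions A V lam))}

/-- The essential spectrum of `T`. -/
def essSpec (A V : B ⊕ H → ℝ → ℝ) : Set ℝ :=
  G.spec A V \ G.discSpec A V

/-- The infimum of the essential spectrum, which is `+∞` if the essential spectrum is empty. -/
def infEssSpec (A V : B ⊕ H → ℝ → ℝ) : EReal :=
  sInf ((fun t : ℝ => (t : EReal)) '' G.essSpec A V)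

/-- Condition (G_m), for `1 ≤ m ≤ ∞`: there is an increasing sequence of `m` eigenvalues below the
essential spectrum (indexed here by `0 ≤ j < m`). -/
def CondGm (A V : B ⊕ H → ℝ → ℝ) (m : ℕ∞) : Prop :=
  1 ≤ m ∧ ∃ ev : ℕ → ℝ, (∀ i j : ℕ, i < j → (j : ℕ∞) < m → ev i < ev j) ∧
    ∀ j : ℕ, (j : ℕ∞) < m → G.IsEigenvalue A V (ev j) ∧ (ev j : EReal) < G.infEssSpec A V

end MetricGraph

end

/-! Suppose (G) holds. The energy is minimised over the functions of mass `μ` in a ball of radius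
`R` of `H¹_A`. The normalised ground state has energy `λ₁μ/2 - Ψ`, and `Ψ > 0` because it does not
vanish on the core, so the infimum `c` lies strictly below `λ₁μ/2`.

Along a minimising ultrafilter with weak limit `u` of mass `m ≤ μ`, the nonlinear term passes to the
limit: it lives on the compact core, where bounded sets of `H¹_A` are uniformly Hölder. The escaping
mass costs at least `λ₁(μ - m)/2`, so `E(u) + λ₁(μ - m)/2 ≤ c`, whence `E(u) < λ₁m/2` and `u ≠ 0`.
If `m < μ`, scaling `u` up to mass `μ` by `t > 1` gives `c ≤ E(tu) ≤ t²E(u) < E(u) + λ₁(μ - m)/2 ≤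
c`, a contradiction; the middle inequality holds because `Ψ` is superquadratic. This is
`exists_minimizer_on_sphere`. It needs `tu` to stay strictly inside the ball, which also makes the
minimiser an interior point, so that the Lagrange rule `fderiv_eq_of_min_on_sphere` applies. Testing
with `u` itself gives `λμ = ‖u‖² - pΨ(u) ≤ 2E(u) < λ₁μ`.

The ball condition is where the two regimes differ. In a small fixed ball `pΨ ≤ ‖u‖²/2`, so the
condition holds for small `μ`, and it also yields `λ ≥ 0`. For `p < 6` the Gagliardo-Nirenberg bound
makes `Ψ` grow slower than `‖u‖²` at bounded mass, so any `μ` is allowed if `R` is large.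

Suppose instead that (G) fails and (G_m) holds. The bottom `λ₁` of the form always lies in the
spectrum (`lambda1_mem_spec`) and here lies below the essential spectrum, so it is an eigenvalue.
Its eigenfunctions achieve `λ₁`, hence vanish on the core, and every multiple of them is critical
with multiplier `λ₁`. -/

open Filter Topology

/-! ### Abstract minimisation and multiplier rule in Hilbert space -/

/-- Bounded ultrafilters on a Hilbert space converge weakly. -/
theorem Ultrafilter.exists_weak_limit {X : Type*} [NormedAddCommGroup X] [InnerProductSpace ℝ X]
    [CompleteSpace X] (F : Ultrafilter X) (R : ℝ) (hF : ∀ᶠ x in (F : Filter X), ‖x‖ ≤ R) :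
    ∃ u : X, ∀ v, Tendsto (fun x => inner ℝ x v) F (𝓝 (inner ℝ u v)) := by
  -- Under the Riesz identification, Banach-Alaoglu applies: the ultrafilter is carried to one on a
  -- weak-* compact ball.
  let D : X → WeakDual ℝ X := fun x => StrongDual.toWeakDual (InnerProductSpace.toDual ℝ X x)
  have hc := WeakDual.isCompact_closedBall (𝕜 := ℝ) (E := X) 0 R
  have hle : ((F.map D : Ultrafilter _) : Filter (WeakDual ℝ X)) ≤
      𝓟 (WeakDual.toStrongDual ⁻¹' Metric.closedBall 0 R) := by
    rw [le_principal_iff, Ultrafilter.mem_coe, Ultrafilter.mem_map]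
    filter_upwards [hF] with x hx
    simpa [D] using hx
  obtain ⟨l, -, hl⟩ := hc.ultrafilter_le_nhds _ hle
  refine ⟨(InnerProductSpace.toDual ℝ X).symm (WeakDual.toStrongDual l), fun v => ?_⟩
  have h2 : Tendsto D F (𝓝 l) := hl
  have h3 := (WeakDual.eval_continuous (𝕜 := ℝ) v).continuousAt.tendsto.comp h2
  rw [InnerProductSpace.toDual_symm_apply]
  exact h3

/-- Minimisation of `‖u‖² / 2 - Ψ u` on a sphere `‖J u‖² = μ` intersected with a ball, for a weakly
continuous superquadratic `Ψ`, below the level `lam μ / 2`. -/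
theorem exists_minimizer_on_sphere {X Y : Type*} [NormedAddCommGroup X] [InnerProductSpace ℝ X]
    [CompleteSpace X] [NormedAddCommGroup Y] [InnerProductSpace ℝ Y] [CompleteSpace Y]
    (J : X →L[ℝ] Y) (Ψ : X → ℝ) {p lam R μ M : ℝ} (hJ : ∀ u, J u = 0 → u = 0)
    (hlam : ∀ u, lam * ‖J u‖ ^ 2 ≤ ‖u‖ ^ 2) (hΨ0 : ∀ u, 0 ≤ Ψ u) (hp : 2 ≤ p)
    (hΨh : ∀ t : ℝ, 0 ≤ t → ∀ u, Ψ (t • u) = t ^ p * Ψ u)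
    (hΨM : ∀ u, ‖u‖ ≤ R → Ψ u ≤ M)
    (hΨw : ∀ (F : Ultrafilter X) (u : X), (∀ᶠ x in (F : Filter X), ‖x‖ ≤ R) →
      (∀ v, Tendsto (fun x => inner ℝ x v) F (𝓝 (inner ℝ u v))) → Tendsto Ψ F (𝓝 (Ψ u)))
    (hμ : 0 < μ) (hR0 : 0 ≤ R)
    (hR : ∀ u, 0 < ‖J u‖ ^ 2 → ‖J u‖ ^ 2 ≤ μ → ‖u‖ ≤ R →
      1 / 2 * ‖u‖ ^ 2 - Ψ u ≤ lam / 2 * ‖J u‖ ^ 2 → ‖u‖ ^ 2 * μ < R ^ 2 * ‖J u‖ ^ 2)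
    (hw : ∃ w, ‖J w‖ ^ 2 = μ ∧ ‖w‖ ≤ R ∧ 1 / 2 * ‖w‖ ^ 2 - Ψ w < lam / 2 * μ) :
    ∃ u, ‖J u‖ ^ 2 = μ ∧ ‖u‖ < R ∧ 1 / 2 * ‖u‖ ^ 2 - Ψ u < lam / 2 * μ ∧
      ∀ v, ‖J v‖ ^ 2 = μ → ‖v‖ ≤ R → 1 / 2 * ‖u‖ ^ 2 - Ψ u ≤ 1 / 2 * ‖v‖ ^ 2 - Ψ v := by
  set E : X → ℝ := fun u => 1 / 2 * ‖u‖ ^ 2 - Ψ u with hE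
  set S : Set X := {v | ‖J v‖ ^ 2 = μ ∧ ‖v‖ ≤ R} with hS
  set c := sInf (E '' S) with hc
  obtain ⟨w, hwμ, hwR, hwE⟩ := hw
  have hbdd : BddBelow (E '' S) := by
    refine ⟨-M, ?_⟩
    rintro _ ⟨v, hv, rfl⟩
    have := hΨM v hv.2
    simp only [hE]
    nlinarith [sq_nonneg ‖v‖]
  have hne : (E '' S).Nonempty := ⟨E w, w, ⟨hwμ, hwR⟩, rfl⟩
  have hcle : ∀ v, ‖J v‖ ^ 2 = μ → ‖v‖ ≤ R → c ≤ E v := fun v h1 h2 =>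
    csInf_le hbdd ⟨v, ⟨h1, h2⟩, rfl⟩
  have hcw : c < lam / 2 * μ := (hcle w hwμ hwR).trans_lt hwE
  have hmem := csInf_mem_closure hne hbdd
  -- An ultrafilter finer than this filter plays the role of a minimising sequence; no subsequence
  -- has to be extracted afterwards.
  have hNB : (comap E (𝓝 c) ⊓ 𝓟 S).NeBot := by
    rw [← Filter.map_neBot_iff E, inf_comm, Filter.push_pull, Filter.map_principal, inf_comm]
    exact mem_closure_iff_clusterPt.1 hmem
  set F := Ultrafilter.of (comap E (𝓝 c) ⊓ 𝓟 S) with hFdef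
  have hFle : (F : Filter X) ≤ comap E (𝓝 c) ⊓ 𝓟 S := Ultrafilter.of_le _
  have hFE : Tendsto E F (𝓝 c) := tendsto_iff_comap.2 (hFle.trans inf_le_left)
  have hFS : ∀ᶠ x in (F : Filter X), x ∈ S := le_principal_iff.1 (hFle.trans inf_le_right)
  have hFR : ∀ᶠ x in (F : Filter X), ‖x‖ ≤ R := hFS.mono fun x hx => hx.2
  obtain ⟨u, hu⟩ := F.exists_weak_limit R hFR
  have hΨ := hΨw F u hFR hu
  have hN : Tendsto (fun x => ‖x‖ ^ 2) (F : Filter X) (𝓝 (2 * (c + Ψ u))) := by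
    refine ((hFE.add hΨ).const_mul 2).congr fun x => ?_
    simp only [hE]; ring
  have hNR : 2 * (c + Ψ u) ≤ R ^ 2 := le_of_tendsto hN (hFR.mono fun x hx => by gcongr)
  -- Weak convergence splits both the squared norm and the mass into the part of `u` and the part of
  -- the escaping remainder `x - u`.
  have hsub : Tendsto (fun x => ‖x - u‖ ^ 2) (F : Filter X) (𝓝 (2 * (c + Ψ u) - ‖u‖ ^ 2)) := by
    have h := (hN.sub ((hu u).const_mul 2)).add_const (‖u‖ ^ 2)
    rw [real_inner_self_eq_norm_sq] at h
    convert h using 2 with x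
    · rw [norm_sub_sq_real]
    · ring
  have hJin : Tendsto (fun x => inner ℝ (J x) (J u)) F (𝓝 (‖J u‖ ^ 2)) := by
    have h := hu ((ContinuousLinearMap.adjoint J) (J u))
    simp only [ContinuousLinearMap.adjoint_inner_right, real_inner_self_eq_norm_sq] at h
    exact h
  have hJsub : Tendsto (fun x => ‖J (x - u)‖ ^ 2) F (𝓝 (μ - ‖J u‖ ^ 2)) := by
    have h := ((hJin.const_mul (-2)).const_add μ).add_const (‖J u‖ ^ 2)
    have h' : Tendsto (fun x => ‖J (x - u)‖ ^ 2) F (𝓝 (μ + -2 * ‖J u‖ ^ 2 + ‖J u‖ ^ 2)) := by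
      refine h.congr' (hFS.mono fun x hx => ?_)
      simp only [map_sub]
      rw [norm_sub_sq_real, hx.1]; ring
    convert h' using 2
    ring
  have h1 : ‖u‖ ^ 2 ≤ 2 * (c + Ψ u) := by
    have := ge_of_tendsto' hsub (fun x => sq_nonneg _)
    linarith
  have h2 : ‖J u‖ ^ 2 ≤ μ := by
    have := ge_of_tendsto' hJsub (fun x => sq_nonneg _)
    linarith
  -- The spectral bound for the remainder: lost mass costs at least `lam` per unit.
  have h3 : lam * (μ - ‖J u‖ ^ 2) ≤ 2 * (c + Ψ u) - ‖u‖ ^ 2 :=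
    le_of_tendsto_of_tendsto' (hJsub.const_mul lam) hsub fun x => hlam _
  have huR : ‖u‖ ≤ R := abs_le_of_sq_le_sq' (h1.trans hNR) hR0 |>.2
  have hEu : E u < lam / 2 * ‖J u‖ ^ 2 := by simp only [hE]; nlinarith
  have hpos : 0 < ‖J u‖ ^ 2 := by
    rcases (sq_nonneg ‖J u‖).lt_or_eq with h | h
    · exact h
    · have hu0 : u = 0 := hJ u (by simpa using h.symm)
      have h0 : Ψ (0 : X) = 0 := by
        have := hΨh 0 le_rfl 0
        rwa [Real.zero_rpow (by linarith), zero_mul, smul_zero] at this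
      simp [hE, hu0, h0] at hEu
  -- `hR` says precisely that `u`, rescaled to mass `μ`, lies strictly inside the ball and is
  -- therefore an admissible competitor.
  have hs := hR u hpos h2 huR hEu.le
  set t := √(μ / ‖J u‖ ^ 2) with ht
  have ht2 : t ^ 2 = μ / ‖J u‖ ^ 2 := Real.sq_sqrt (by positivity)
  have ht1 : 1 ≤ t := by
    rw [ht, Real.one_le_sqrt, one_le_div hpos]; exact h2
  have hJt : ‖J (t • u)‖ ^ 2 = μ := by
    rw [map_smul, norm_smul, mul_pow, Real.norm_eq_abs, sq_abs, ht2, div_mul_cancel₀ _ hpos.ne']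
  have htR : ‖t • u‖ < R := by
    refine lt_of_pow_lt_pow_left₀ 2 hR0 ?_
    rw [norm_smul, mul_pow, Real.norm_eq_abs, sq_abs, ht2, div_mul_eq_mul_div, div_lt_iff₀ hpos]
    linarith
  have hEt : E (t • u) ≤ t ^ 2 * E u := by
    have : t ^ 2 ≤ t ^ p := by
      rw [← Real.rpow_natCast]; exact Real.rpow_le_rpow_of_exponent_le ht1 (by simpa using hp)
    simp only [hE]
    rw [hΨh t (by linarith), norm_smul, mul_pow, Real.norm_eq_abs, sq_abs]
    nlinarith [hΨ0 u]
  have hct := (hcle _ hJt htR.le).trans hEt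
  have hcu : E u + lam / 2 * (μ - ‖J u‖ ^ 2) ≤ c := by simp only [hE]; linarith
  have hμu : ‖J u‖ ^ 2 = μ := by
    -- For `t > 1` the scaling gain `(t² - 1) E u` is strictly below `lam / 2` times the lost mass,
    -- which contradicts `hct` and `hcu` together.
    by_contra hne
    have hlt : ‖J u‖ ^ 2 < μ := lt_of_le_of_ne h2 hne
    have h5 : (t ^ 2 - 1) * E u < (t ^ 2 - 1) * (lam / 2 * ‖J u‖ ^ 2) := by
      refine mul_lt_mul_of_pos_left hEu ?_
      rw [ht2, sub_pos, one_lt_div hpos]; exact hlt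
    have h6 : (t ^ 2 - 1) * (lam / 2 * ‖J u‖ ^ 2) = lam / 2 * (μ - ‖J u‖ ^ 2) := by
      rw [ht2, sub_mul, mul_left_comm, div_mul_cancel₀ _ hpos.ne']; ring
    linarith
  refine ⟨u, hμu, ?_, by rw [← hμu]; exact hEu, fun v hv hvR => ?_⟩
  · have : t = 1 := by rw [ht, hμu, div_self hμ.ne', Real.sqrt_one]
    simpa [this] using htR
  · have := hcle v hv hvR
    change E u ≤ E v
    rw [hμu, sub_self, mul_zero, add_zero] at hcu
    linarith

/-- The Lagrange multiplier rule at a constrained minimum on a sphere `‖J u‖² = μ`. -/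
theorem fderiv_eq_of_min_on_sphere {X Y : Type*} [NormedAddCommGroup X] [InnerProductSpace ℝ X]
    [NormedAddCommGroup Y] [InnerProductSpace ℝ Y] (J : X →L[ℝ] Y) {E : X → ℝ} {E' : X →L[ℝ] ℝ}
    {u : X} {R μ : ℝ} (hμ : 0 < μ) (hu : ‖J u‖ ^ 2 = μ) (huR : ‖u‖ < R) (hE : HasFDerivAt E E' u)
    (hmin : ∀ v, ‖J v‖ ^ 2 = μ → ‖v‖ ≤ R → E u ≤ E v) (v : X) :
    E' v = E' u / μ * inner ℝ (J u) (J v) := by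
  have hJu : ‖J u‖ ≠ 0 := by intro h; rw [h] at hu; simp at hu; linarith
  have hJu0 : J u ≠ 0 := norm_ne_zero_iff.1 hJu
  have hsμ : ‖J u‖ = √μ := by rw [← hu, Real.sqrt_sq (norm_nonneg _)]
  let q : ℝ → ℝ := fun t => ‖J (u + t • v)‖ ^ 2
  have hline : HasDerivAt (fun t : ℝ => u + t • v) v 0 := by
    simpa using ((hasDerivAt_id (0 : ℝ)).smul_const v).const_add u
  have hq : HasDerivAt q (2 * inner ℝ (J u) (J v)) 0 := by
    have h := (J.hasFDerivAt.comp_hasDerivAt (0 : ℝ) hline).norm_sq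
    simpa [q] using h
  have hq0 : q 0 = μ := by simp [q, hu]
  -- The factor that projects the line `u + t v` radially back to the sphere. The resulting curve
  -- `γ` stays in the ball for small `t` because `‖u‖ < R`.
  let s : ℝ → ℝ := fun t => √(μ / q t)
  have hs0 : s 0 = 1 := by simp [s, hq0, hμ.ne']
  have hs : HasDerivAt s (-(inner ℝ (J u) (J v)) / μ) 0 := by
    have h := ((hasDerivAt_const (0 : ℝ) μ).div hq (by rw [hq0]; exact hμ.ne')).sqrt
      (by simp [hq0, hμ.ne'])
    refine HasDerivAt.congr_deriv (f := s) h ?_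
    change (0 * q 0 - μ * (2 * inner ℝ (J u) (J v))) / q 0 ^ 2 / (2 * √(μ / q 0)) = _
    rw [hq0, div_self hμ.ne', Real.sqrt_one]
    field_simp
    ring
  let γ : ℝ → X := fun t => s t • (u + t • v)
  have hγ0 : γ 0 = u := by simp [γ, hs0]
  have hγ : HasDerivAt γ (v + (-(inner ℝ (J u) (J v)) / μ) • u) 0 := by
    have h := hs.smul hline
    simp only [hs0, zero_smul, add_zero, one_smul] at h
    exact h
  have hEγ : HasDerivAt (E ∘ γ) (E' (v + (-(inner ℝ (J u) (J v)) / μ) • u)) 0 := by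
    rw [← hγ0] at hE
    exact hE.comp_hasDerivAt 0 hγ
  have hloc : IsLocalMin (E ∘ γ) 0 := by
    have h1 : ∀ᶠ t in 𝓝 (0 : ℝ), ‖γ t‖ < R := by
      refine hγ.continuousAt.norm.eventually_lt_const ?_
      simpa only [hγ0] using huR
    have h2 : ∀ᶠ t in 𝓝 (0 : ℝ), 0 < q t := by
      refine hq.continuousAt.eventually_const_lt ?_
      rwa [hq0]
    filter_upwards [h1, h2] with t ht1 ht2
    simp only [Function.comp, hγ0]
    refine hmin _ ?_ ht1.le
    simp only [γ, map_smul, norm_smul, mul_pow, Real.norm_eq_abs, sq_abs]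
    change s t ^ 2 * q t = μ
    simp only [s]
    rw [Real.sq_sqrt (by positivity)]
    field_simp
  have h0 := hloc.hasDerivAt_eq_zero hEγ
  rw [map_add, map_smul, smul_eq_mul] at h0
  have : E' v = -(-(inner ℝ (J u) (J v)) / μ * E' u) := by linarith
  rw [this]; ring

/-! ### Weak derivatives on an interval and the fundamental theorem of calculus -/

theorem LocallyIntegrableOn.integrable_contDiff_smul {s : Set ℝ} (hs : IsClosed s) {f : ℝ → ℂ}
    (hf : LocallyIntegrableOn f s) {φ : ℝ → ℝ} (hφ : Continuous φ) (hc : HasCompactSupport φ) :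
    Integrable (fun x => φ x • f x) (volume.restrict s) :=
  ((locallyIntegrableOn_iff_locallyIntegrable_restrict hs).1
    hf).integrable_smul_left_of_hasCompactSupport hφ hc

/-- Test functions only see the interior; the boundary of a convex set is null, so nothing is lost
almost everywhere. -/
theorem ae_restrict_mem_interior {s : Set ℝ} (hs : Convex ℝ s) :
    ∀ᵐ x ∂(volume.restrict s), x ∈ interior s := by
  have h0 : volume (frontier s) = 0 := hs.addHaar_frontier volume
  have h1 : ∀ᵐ x ∂(volume : Measure ℝ), x ∉ frontier s := measure_eq_zero_iff_ae_notMem.1 h0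
  have h2 : MeasurableSet s := hs.ordConnected.measurableSet
  filter_upwards [ae_restrict_of_ae h1, ae_restrict_mem h2] with x hx hxs
  by_contra h
  exact hx ⟨subset_closure hxs, h⟩

namespace HasWeakDerivOn

variable {s : Set ℝ} {f f₁ f₂ g g₁ g₂ : ℝ → ℂ}

/-- The fundamental lemma of the calculus of variations on the interior. It makes the choice hidden
in `weakDerivOn` harmless: any weak derivative may be used for computing. -/
theorem ae_eq (hs : Convex ℝ s) (hcl : IsClosed s) (h₁ : HasWeakDerivOn s f g₁)
    (h₂ : HasWeakDerivOn s f g₂) : g₁ =ᵐ[volume.restrict s] g₂ := by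
  have hl : LocallyIntegrableOn (g₁ - g₂) s := h₁.2.1.sub h₂.2.1
  have h := isOpen_interior.ae_eq_zero_of_integral_contDiff_smul_eq_zero (μ := volume)
    (hl.mono_set interior_subset) (fun φ hφ hc hsupp => by
      have hzero : ∀ x ∉ s, φ x • (g₁ - g₂) x = 0 := fun x hx => by
        have : φ x = 0 := by
          by_contra h0
          exact hx (interior_subset (hsupp (subset_tsupport _ h0)))
        simp [this]
      rw [← setIntegral_eq_integral_of_forall_compl_eq_zero hzero]
      have e1 := h₁.2.2 φ hφ hc hsupp
      have e2 := h₂.2.2 φ hφ hc hsupp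
      have i1 := LocallyIntegrableOn.integrable_contDiff_smul hcl h₁.2.1 hφ.continuous hc
      have i2 := LocallyIntegrableOn.integrable_contDiff_smul hcl h₂.2.1 hφ.continuous hc
      simp only [Pi.sub_apply, smul_sub]
      rw [integral_sub i1 i2, sub_eq_zero]
      rw [e1] at e2
      exact neg_injective e2)
  filter_upwards [ae_restrict_of_ae h, ae_restrict_mem_interior hs] with x hx hxs
  exact sub_eq_zero.1 (hx hxs)

theorem add (hcl : IsClosed s) (h₁ : HasWeakDerivOn s f₁ g₁) (h₂ : HasWeakDerivOn s f₂ g₂) :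
    HasWeakDerivOn s (f₁ + f₂) (g₁ + g₂) := by
  refine ⟨h₁.1.add h₂.1, h₁.2.1.add h₂.2.1, fun φ hφ hc hsupp => ?_⟩
  have i1 := LocallyIntegrableOn.integrable_contDiff_smul hcl h₁.2.1 hφ.continuous hc
  have i2 := LocallyIntegrableOn.integrable_contDiff_smul hcl h₂.2.1 hφ.continuous hc
  have hφ' : Continuous (deriv φ) := hφ.continuous_deriv (by simp)
  have j1 := LocallyIntegrableOn.integrable_contDiff_smul hcl h₁.1 hφ' hc.deriv
  have j2 := LocallyIntegrableOn.integrable_contDiff_smul hcl h₂.1 hφ' hc.deriv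
  simp only [Pi.add_apply, smul_add]
  rw [integral_add i1 i2, integral_add j1 j2, h₁.2.2 φ hφ hc hsupp, h₂.2.2 φ hφ hc hsupp]
  ring

theorem const_smul (h : HasWeakDerivOn s f g) (c : ℂ) : HasWeakDerivOn s (c • f) (c • g) := by
  refine ⟨h.1.smul c, h.2.1.smul c, fun φ hφ hc hsupp => ?_⟩
  simp only [Pi.smul_apply, smul_comm _ c]
  rw [integral_smul, integral_smul, h.2.2 φ hφ hc hsupp, smul_neg]

end HasWeakDerivOn

theorem hasWeakDerivOn_weakDerivOn {s : Set ℝ} {f : ℝ → ℂ} (h : ∃ g, HasWeakDerivOn s f g) :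
    HasWeakDerivOn s f (weakDerivOn s f) := by
  rw [weakDerivOn, dif_pos h]
  exact h.choose_spec

/-- Extension by zero gives a primitive that is defined and continuous on the whole line. -/
theorem LocallyIntegrableOn.indicator_intervalIntegrable {s : Set ℝ} (hcl : IsClosed s)
    {g : ℝ → ℂ} (hg : LocallyIntegrableOn g s) (a b : ℝ) :
    IntervalIntegrable (s.indicator g) volume a b := by
  rw [intervalIntegrable_iff']
  rw [IntegrableOn, integrable_indicator_iff hcl.measurableSet, IntegrableOn,
    Measure.restrict_restrict hcl.measurableSet]
  exact hg.integrableOn_compact_subset Set.inter_subset_left (isCompact_uIcc.inter_left hcl)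

/-- The derivative of the smooth step has integral one over `[0, 1]`, so its rescalings form an
approximate identity; being one-sided, it only needs `f` to the right of `x`. -/
theorem tendsto_integral_deriv_smoothTransition {f : ℝ → ℂ} {x δ : ℝ} (hδ : 0 < δ)
    (hf : ContinuousOn f (Set.Icc x (x + δ))) :
    Tendsto (fun n : ℕ => ∫ τ in (0 : ℝ)..1, deriv Real.smoothTransition τ •
      f (x + (1 / ((n : ℝ) + 1)) * τ)) atTop (𝓝 (f x)) := by
  have hσ : ContDiff ℝ ∞ Real.smoothTransition := Real.smoothTransition.contDiff
  have hσ' : Continuous (deriv Real.smoothTransition) := hσ.continuous_deriv (by simp)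
  have h1 : ∫ τ in (0 : ℝ)..1, deriv Real.smoothTransition τ • f x = f x := by
    rw [intervalIntegral.integral_smul_const, intervalIntegral.integral_deriv_eq_sub
      (fun y _ => (hσ.differentiable (by simp)) y) (hσ'.intervalIntegrable _ _)]
    simp
  rw [← h1]
  obtain ⟨M, hM⟩ := isCompact_Icc.exists_bound_of_continuousOn hf
  have hn0 : Tendsto (fun n : ℕ => 1 / ((n : ℝ) + 1)) atTop (𝓝 0) :=
    tendsto_one_div_add_atTop_nhds_zero_nat
  have hmaps : ∀ᶠ n : ℕ in atTop, ∀ τ ∈ Set.Icc (0 : ℝ) 1,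
      x + (1 / ((n : ℝ) + 1)) * τ ∈ Set.Icc x (x + δ) := by
    filter_upwards [hn0.eventually_lt_const hδ] with n hn τ hτ
    have h0 : 0 < 1 / ((n : ℝ) + 1) := by positivity
    constructor <;> nlinarith [hτ.1, hτ.2]
  refine intervalIntegral.tendsto_integral_filter_of_dominated_convergence
    (fun τ => ‖deriv Real.smoothTransition τ‖ * M) ?_ ?_ ?_ ?_
  · filter_upwards [hmaps] with n hn
    refine ContinuousOn.aestronglyMeasurable ?_ measurableSet_uIoc
    refine hσ'.continuousOn.smul (hf.comp (by fun_prop) fun τ hτ => hn τ ?_)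
    rw [Set.uIoc_of_le zero_le_one] at hτ
    exact ⟨hτ.1.le, hτ.2⟩
  · filter_upwards [hmaps] with n hn
    refine Eventually.of_forall fun τ hτ => ?_
    rw [Set.uIoc_of_le zero_le_one] at hτ
    rw [norm_smul]
    exact mul_le_mul_of_nonneg_left (hM _ (hn τ ⟨hτ.1.le, hτ.2⟩)) (norm_nonneg _)
  · exact (hσ'.norm.mul continuous_const).intervalIntegrable _ _
  · refine Eventually.of_forall fun τ hτ => ?_
    rw [Set.uIoc_of_le zero_le_one] at hτ
    refine Tendsto.const_smul ?_ _
    have hfx : ContinuousWithinAt f (Set.Icc x (x + δ)) x := hf x ⟨le_rfl, by linarith⟩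
    refine hfx.tendsto.comp (tendsto_nhdsWithin_iff.2 ⟨?_, ?_⟩)
    · simpa using (hn0.mul_const τ).const_add x
    · filter_upwards [hmaps] with n hn
      exact hn τ ⟨hτ.1.le, hτ.2⟩

theorem deriv_smoothTransition_eq_zero {τ : ℝ} (h : τ ∉ Set.Icc (0 : ℝ) 1) :
    deriv Real.smoothTransition τ = 0 := by
  rw [Set.mem_Icc, not_and_or, not_le, not_le] at h
  rcases h with h | h
  · have : Real.smoothTransition =ᶠ[𝓝 τ] fun _ => 0 := by
      filter_upwards [gt_mem_nhds h] with y hy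
      exact Real.smoothTransition.zero_of_nonpos hy.le
    rw [this.deriv_eq]; simp
  · have : Real.smoothTransition =ᶠ[𝓝 τ] fun _ => 1 := by
      filter_upwards [lt_mem_nhds h] with y hy
      exact Real.smoothTransition.one_of_one_le hy.le
    rw [this.deriv_eq]; simp

/-- The substitution `t = x + τ / (n + 1)`, after discarding the region where the rescaled step is
constant. -/
theorem setIntegral_deriv_smoothTransition_smul {s : Set ℝ} {f : ℝ → ℂ}
    (x : ℝ) (n : ℕ) (hx : Set.Icc x (x + 1 / ((n : ℝ) + 1)) ⊆ s) :
    ∫ t in s, (((n : ℝ) + 1) * deriv Real.smoothTransition ((n + 1) * (t - x))) • f t =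
      ∫ τ in (0 : ℝ)..1, deriv Real.smoothTransition τ • f (x + (1 / ((n : ℝ) + 1)) * τ) := by
  have hn : (0 : ℝ) < n + 1 := by positivity
  set F : ℝ → ℂ := fun t => (((n : ℝ) + 1) * deriv Real.smoothTransition ((n + 1) * (t - x))) • f t
  have hzero : ∀ t ∉ Set.Icc x (x + 1 / ((n : ℝ) + 1)), F t = 0 := by
    intro t ht
    have : deriv Real.smoothTransition ((n + 1) * (t - x)) = 0 := by
      refine deriv_smoothTransition_eq_zero fun h => ht ⟨?_, ?_⟩
      · have := nonneg_of_mul_nonneg_right h.1 hn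
        linarith
      · have := h.2
        rw [← le_div_iff₀' hn] at this
        linarith
    simp [F, this]
  rw [setIntegral_eq_integral_of_forall_compl_eq_zero fun t ht => hzero t fun h => ht (hx h),
    ← setIntegral_eq_integral_of_forall_compl_eq_zero hzero, integral_Icc_eq_integral_Ioc,
    ← intervalIntegral.integral_of_le (by have : 0 < 1 / ((n : ℝ) + 1) := by positivity
                                          linarith)]
  have h := intervalIntegral.smul_integral_comp_add_mul (a := 0) (b := 1) F (1 / ((n : ℝ) + 1)) x
  simp only [mul_zero, add_zero, mul_one] at h
  rw [← h, ← intervalIntegral.integral_smul]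
  refine intervalIntegral.integral_congr fun τ _ => ?_
  simp only [F]
  rw [smul_smul]
  congr 1
  rw [show ((n : ℝ) + 1) * (x + 1 / ((n : ℝ) + 1) * τ - x) = τ by field_simp; ring]
  field_simp

/-- The weak formulation is tested with smooth plateaus converging to the indicator of `(x, y]`.
Their derivatives concentrate at `x` and `y` with opposite signs, which produces `f x - f y`. -/
theorem HasWeakDerivOn.sub_eq_integral_of_lt {s : Set ℝ} {f g : ℝ → ℂ} (hs : Convex ℝ s)
    (hcl : IsClosed s) (h : HasWeakDerivOn s f g) (hf : ContinuousOn f s) {x y : ℝ}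
    (hx : x ∈ interior s) (hy : y ∈ interior s) (hxy : x < y) :
    f y - f x = ∫ t in x..y, g t := by
  obtain ⟨δ, hδ, hyδ⟩ : ∃ δ > 0, Set.Icc y (y + δ) ⊆ interior s := by
    obtain ⟨ε, hε, hb⟩ := Metric.isOpen_iff.1 isOpen_interior y hy
    refine ⟨ε / 2, by positivity, fun t ht => hb ?_⟩
    rw [Metric.mem_ball, Real.dist_eq, abs_lt]
    constructor <;> linarith [ht.1, ht.2]
  have hoc : Set.OrdConnected (interior s) := hs.interior.ordConnected
  have hIcc : Set.Icc x (y + δ) ⊆ interior s := by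
    refine hoc.out hx (hyδ ⟨by linarith, le_rfl⟩)
  have hσ : ContDiff ℝ ∞ Real.smoothTransition := Real.smoothTransition.contDiff
  have hn0 : Tendsto (fun n : ℕ => 1 / ((n : ℝ) + 1)) atTop (𝓝 0) :=
    tendsto_one_div_add_atTop_nhds_zero_nat
  -- The plateau rises just to the right of `x` and falls just to the right of `y`; the room `δ`
  -- beyond `y` keeps its support in the interior for large `n`.
  let ψ : ℕ → ℝ → ℝ := fun n t => Real.smoothTransition ((n + 1) * (t - x)) -
    Real.smoothTransition ((n + 1) * (t - y))
  have hψs : ∀ n, ContDiff ℝ ∞ (ψ n) := fun n =>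
    (hσ.comp (by fun_prop)).sub (hσ.comp (by fun_prop))
  have hψd : ∀ n t, deriv (ψ n) t =
      ((n : ℝ) + 1) * deriv Real.smoothTransition ((n + 1) * (t - x)) -
      ((n : ℝ) + 1) * deriv Real.smoothTransition ((n + 1) * (t - y)) := by
    intro n t
    have hd : ∀ z : ℝ, HasDerivAt (fun t : ℝ => Real.smoothTransition ((n + 1) * (t - z)))
        (((n : ℝ) + 1) * deriv Real.smoothTransition ((n + 1) * (t - z))) t := by
      intro z
      have h1 : HasDerivAt (fun t : ℝ => ((n : ℝ) + 1) * (t - z)) ((n : ℝ) + 1) t := by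
        simpa using ((hasDerivAt_id t).sub_const z).const_mul ((n : ℝ) + 1)
      have h2 := ((hσ.differentiable (by simp)) (((n : ℝ) + 1) * (t - z))).hasDerivAt
      rw [mul_comm]
      exact h2.comp t h1
    exact ((hd x).sub (hd y)).deriv
  have hψz : ∀ (n : ℕ) (t : ℝ), 1 / ((n : ℝ) + 1) < δ → t ∉ Set.Icc x (y + δ) → ψ n t = 0 := by
    intro n t hn ht
    have hn' : (0 : ℝ) < n + 1 := by positivity
    rw [Set.mem_Icc, not_and_or, not_le, not_le] at ht
    rcases ht with ht | ht
    · simp only [ψ]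
      rw [Real.smoothTransition.zero_of_nonpos, Real.smoothTransition.zero_of_nonpos, sub_zero] <;>
      nlinarith
    · rw [div_lt_iff₀ hn'] at hn
      simp only [ψ]
      rw [Real.smoothTransition.one_of_one_le, Real.smoothTransition.one_of_one_le, sub_self] <;>
      nlinarith
  have hev : ∀ᶠ n : ℕ in atTop, 1 / ((n : ℝ) + 1) < δ := hn0.eventually_lt_const hδ
  have hsub : ∀ n : ℕ, 1 / ((n : ℝ) + 1) < δ → tsupport (ψ n) ⊆ Set.Icc x (y + δ) := by
    intro n hn
    refine closure_minimal (fun t ht => ?_) isClosed_Icc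
    by_contra h0
    exact ht (hψz n t hn h0)
  have hcs : ∀ n : ℕ, 1 / ((n : ℝ) + 1) < δ → HasCompactSupport (ψ n) := fun n hn =>
    isCompact_Icc.of_isClosed_subset (isClosed_tsupport _) (hsub n hn)
  have key : ∀ᶠ n : ℕ in atTop,
      (∫ τ in (0 : ℝ)..1, deriv Real.smoothTransition τ • f (x + (1 / ((n : ℝ) + 1)) * τ)) -
      (∫ τ in (0 : ℝ)..1, deriv Real.smoothTransition τ • f (y + (1 / ((n : ℝ) + 1)) * τ)) =
      -∫ t in s, ψ n t • g t := by
    filter_upwards [hev] with n hn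
    rw [← h.2.2 (ψ n) (hψs n) (hcs n hn) ((hsub n hn).trans hIcc)]
    have hx' : Set.Icc x (x + 1 / ((n : ℝ) + 1)) ⊆ Set.Icc x (y + δ) :=
      Set.Icc_subset_Icc le_rfl (by linarith)
    have hy' : Set.Icc y (y + 1 / ((n : ℝ) + 1)) ⊆ Set.Icc x (y + δ) :=
      Set.Icc_subset_Icc hxy.le (by linarith)
    rw [← setIntegral_deriv_smoothTransition_smul x n (hx'.trans (hIcc.trans interior_subset)),
      ← setIntegral_deriv_smoothTransition_smul y n (hy'.trans (hIcc.trans interior_subset)),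
      ← integral_sub]
    · refine integral_congr_ae (Eventually.of_forall fun t => ?_)
      simp only [hψd, sub_smul]
    all_goals
      refine LocallyIntegrableOn.integrable_contDiff_smul hcl h.1 ?_ ?_
      · have := hσ.continuous_deriv (by simp)
        fun_prop
    · refine HasCompactSupport.intro (isCompact_Icc (a := x) (b := x + 1 / ((n : ℝ) + 1))) ?_
      intro t ht
      rw [deriv_smoothTransition_eq_zero, mul_zero]
      refine fun h => ht ⟨?_, ?_⟩
      · have := nonneg_of_mul_nonneg_right h.1 (show (0 : ℝ) < n + 1 by positivity)
        linarith
      · have := h.2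
        rw [← le_div_iff₀' (show (0 : ℝ) < n + 1 by positivity)] at this
        linarith
    · refine HasCompactSupport.intro (isCompact_Icc (a := y) (b := y + 1 / ((n : ℝ) + 1))) ?_
      intro t ht
      rw [deriv_smoothTransition_eq_zero, mul_zero]
      refine fun h => ht ⟨?_, ?_⟩
      · have := nonneg_of_mul_nonneg_right h.1 (show (0 : ℝ) < n + 1 by positivity)
        linarith
      · have := h.2
        rw [← le_div_iff₀' (show (0 : ℝ) < n + 1 by positivity)] at this
        linarith
  have hgint : IntegrableOn g (Set.Icc x (y + δ)) :=
    h.2.1.integrableOn_compact_subset (hIcc.trans interior_subset) isCompact_Icc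
  have hlim1 := (tendsto_integral_deriv_smoothTransition (f := f) (x := x) (δ := δ) hδ
    (hf.mono ((Set.Icc_subset_Icc le_rfl (by linarith)).trans (hIcc.trans interior_subset)))).sub
    (tendsto_integral_deriv_smoothTransition (f := f) (x := y) (δ := δ) hδ
    (hf.mono (hyδ.trans interior_subset)))
  have hlim2 : Tendsto (fun n => ∫ t in s, ψ n t • g t) atTop (𝓝 (∫ t in x..y, g t)) := by
    have e : ∫ t in x..y, g t = ∫ t in Set.Icc x (y + δ), (Set.Ioc x y).indicator g t := by
      rw [intervalIntegral.integral_of_le hxy.le, setIntegral_indicator measurableSet_Ioc]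
      congr 2
      ext t; simp only [Set.mem_Ioc, Set.mem_inter_iff, Set.mem_Icc]
      constructor
      · intro ht; exact ⟨⟨ht.1.le, by linarith [ht.2]⟩, ht⟩
      · exact fun ht => ht.2
    rw [e]
    have e2 : ∀ᶠ n in atTop, ∫ t in Set.Icc x (y + δ), ψ n t • g t = ∫ t in s, ψ n t • g t := by
      filter_upwards [hev] with n hn
      have hz : ∀ t ∉ Set.Icc x (y + δ), ψ n t • g t = 0 := fun t ht => by
        rw [hψz n t hn ht, zero_smul]
      rw [setIntegral_eq_integral_of_forall_compl_eq_zero hz,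
        setIntegral_eq_integral_of_forall_compl_eq_zero fun t ht =>
          hz t fun h => ht (interior_subset (hIcc h))]
    refine Tendsto.congr' e2 ?_
    refine tendsto_integral_of_dominated_convergence (fun t => ‖g t‖) ?_ hgint.norm ?_ ?_
    · exact fun n => (hψs n).continuous.aestronglyMeasurable.smul hgint.aestronglyMeasurable
    · refine fun n => Eventually.of_forall fun t => ?_
      rw [norm_smul]
      refine mul_le_of_le_one_left (norm_nonneg _) ?_
      rw [Real.norm_eq_abs, abs_le]
      have h1 := Real.smoothTransition.nonneg (((n : ℝ) + 1) * (t - x))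
      have h2 := Real.smoothTransition.le_one (((n : ℝ) + 1) * (t - x))
      have h3 := Real.smoothTransition.nonneg (((n : ℝ) + 1) * (t - y))
      have h4 := Real.smoothTransition.le_one (((n : ℝ) + 1) * (t - y))
      constructor <;> simp only [ψ] <;> linarith
    · refine Eventually.of_forall fun t => ?_
      have hup : ∀ z : ℝ, z < t → ∀ᶠ n : ℕ in atTop,
          Real.smoothTransition (((n : ℝ) + 1) * (t - z)) = 1 := by
        intro z hz
        filter_upwards [hn0.eventually_lt_const (sub_pos.2 hz)] with n hn
        rw [div_lt_iff₀ (by positivity)] at hn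
        exact Real.smoothTransition.one_of_one_le (by linarith)
      have hdown : ∀ z : ℝ, t ≤ z → ∀ n : ℕ,
          Real.smoothTransition (((n : ℝ) + 1) * (t - z)) = 0 := by
        intro z hz n
        exact Real.smoothTransition.zero_of_nonpos
          (mul_nonpos_of_nonneg_of_nonpos (by positivity) (by linarith))
      by_cases ht1 : t ≤ x
      · have : (Set.Ioc x y).indicator g t = 0 := Set.indicator_of_notMem (fun h => by
          exact absurd h.1 (not_lt.2 ht1)) _
        rw [this]
        refine tendsto_const_nhds.congr fun n => ?_
        simp only [ψ]
        rw [hdown x ht1, hdown y (by linarith), sub_zero, zero_smul]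
      · push Not at ht1
        by_cases ht2 : t ≤ y
        · rw [Set.indicator_of_mem (show t ∈ Set.Ioc x y from ⟨ht1, ht2⟩)]
          refine tendsto_const_nhds.congr' ?_
          filter_upwards [hup x ht1] with n hn
          simp only [ψ]
          rw [hn, hdown y ht2, sub_zero, one_smul]
        · push Not at ht2
          rw [Set.indicator_of_notMem (fun h : t ∈ Set.Ioc x y => absurd h.2 (not_le.2 ht2))]
          refine tendsto_const_nhds.congr' ?_
          filter_upwards [hup x ht1, hup y ht2] with n hn hn'
          simp only [ψ]
          rw [hn, hn', sub_self, zero_smul]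
  have hfin := tendsto_nhds_unique (hlim1.congr' key) hlim2.neg
  rw [← neg_sub, hfin, neg_neg]

/-- The fundamental theorem of calculus for continuous functions with a weak derivative. -/
theorem HasWeakDerivOn.sub_eq_integral {s : Set ℝ} {f g : ℝ → ℂ} (hs : Convex ℝ s)
    (hcl : IsClosed s) (hne : (interior s).Nonempty) (h : HasWeakDerivOn s f g)
    (hf : ContinuousOn f s) {x y : ℝ} (hx : x ∈ s) (hy : y ∈ s) :
    f y - f x = ∫ t in x..y, g t := by
  obtain ⟨a, ha⟩ := hne
  have hint := fun a b => LocallyIntegrableOn.indicator_intervalIntegrable hcl h.2.1 a b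
  have hoc : Set.OrdConnected s := hs.ordConnected
  have hind : ∀ x ∈ s, ∀ y ∈ s, ∫ t in x..y, s.indicator g t = ∫ t in x..y, g t := by
    intro x hx y hy
    refine intervalIntegral.integral_congr fun t ht => ?_
    exact Set.indicator_of_mem (hoc.uIcc_subset hx hy ht) g
  have hcl' : s ⊆ closure (interior s) := by
    rw [hs.closure_interior_eq_closure_of_nonempty_interior ⟨a, ha⟩]
    exact subset_closure
  -- Both sides are continuous on `s` and agree on the dense interior, which brings in the endpoints
  -- of `s`.
  have key : Set.EqOn f (fun y => f a + ∫ t in a..y, s.indicator g t) s := by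
    refine Set.EqOn.of_subset_closure (s := interior s) ?_ hf ?_ interior_subset hcl'
    · intro y hy
      simp only
      rw [hind a (interior_subset ha) y (interior_subset hy)]
      rcases lt_trichotomy a y with hay | hay | hay
      · rw [← h.sub_eq_integral_of_lt hs hcl hf ha hy hay]; ring
      · simp [hay]
      · rw [intervalIntegral.integral_symm, ← h.sub_eq_integral_of_lt hs hcl hf hy ha hay]; ring
    · exact (continuous_const.add (intervalIntegral.continuous_primitive hint a)).continuousOn
  rw [key hx, key hy, ← hind x hx y hy, ← intervalIntegral.integral_interval_sub_left (hint a y)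
    (hint a x)]
  ring

/-! ### L² inequalities and pointwise bounds on an interval -/

section L2

variable {α : Type*} [MeasurableSpace α] {ν : Measure α}

theorem MeasureTheory.MemLp.integrable_norm_sq {f : α → ℂ} (hf : MemLp f 2 ν) :
    Integrable (fun x => ‖f x‖ ^ 2) ν := hf.norm.integrable_sq

theorem MeasureTheory.MemLp.integrable_norm_mul_norm {f g : α → ℂ} (hf : MemLp f 2 ν)
    (hg : MemLp g 2 ν) : Integrable (fun x => ‖f x‖ * ‖g x‖) ν := hf.norm.integrable_mul hg.norm

theorem MeasureTheory.MemLp.integrable_mul_star {f g : α → ℂ} (hf : MemLp f 2 ν)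
    (hg : MemLp g 2 ν) : Integrable (fun x => f x * star (g x)) ν := by
  exact hf.integrable_mul hg.star

theorem integral_norm_mul_norm_le {f g : α → ℂ} (hf : MemLp f 2 ν) (hg : MemLp g 2 ν) :
    ∫ x, ‖f x‖ * ‖g x‖ ∂ν ≤ √(∫ x, ‖f x‖ ^ 2 ∂ν) * √(∫ x, ‖g x‖ ^ 2 ∂ν) := by
  have h := integral_mul_le_Lp_mul_Lq_of_nonneg (μ := ν) (p := 2) (q := 2)
    (Real.HolderConjugate.two_two) (f := fun x => ‖f x‖) (g := fun x => ‖g x‖)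
    (Eventually.of_forall fun x => norm_nonneg _) (Eventually.of_forall fun x => norm_nonneg _)
    (by simpa using hf.norm) (by simpa using hg.norm)
  simpa [Real.sqrt_eq_rpow] using h

theorem norm_add_real_smul_sq (z w : ℂ) (t : ℝ) :
    ‖z + (t : ℂ) * w‖ ^ 2 = ‖z‖ ^ 2 + 2 * t * (z * star w).re + t ^ 2 * ‖w‖ ^ 2 := by
  rw [← Complex.normSq_eq_norm_sq, ← Complex.normSq_eq_norm_sq, ← Complex.normSq_eq_norm_sq]
  simp [Complex.normSq_apply]
  ring

theorem integral_norm_add_real_smul_sq {f g : α → ℂ} (hf : MemLp f 2 ν) (hg : MemLp g 2 ν)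
    (t : ℝ) : ∫ x, ‖f x + (t : ℂ) * g x‖ ^ 2 ∂ν =
      ∫ x, ‖f x‖ ^ 2 ∂ν + 2 * t * (∫ x, f x * star (g x) ∂ν).re + t ^ 2 * ∫ x, ‖g x‖ ^ 2 ∂ν := by
  simp only [norm_add_real_smul_sq]
  have hre : (∫ x, f x * star (g x) ∂ν).re = ∫ x, (f x * star (g x)).re ∂ν :=
    (integral_re (hf.integrable_mul_star hg)).symm
  have hi : Integrable (fun x => (f x * star (g x)).re) ν := (hf.integrable_mul_star hg).re
  have h1 : Integrable (fun x => ‖f x‖ ^ 2 + 2 * t * (f x * star (g x)).re) ν :=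
    hf.integrable_norm_sq.add (hi.const_mul _)
  rw [hre, integral_add h1 (hg.integrable_norm_sq.const_mul _),
    integral_add hf.integrable_norm_sq (hi.const_mul _), integral_const_mul, integral_const_mul]

end L2

/-- A primitive of a merely integrable function is absolutely continuous, which is enough for the
product rule in integrated form. -/
theorem sq_sub_sq_eq_integral {F G : ℝ → ℝ} {a b : ℝ} (hab : a ≤ b)
    (hG : IntervalIntegrable G volume a b)
    (hF : ∀ t ∈ Set.Icc a b, F t = F a + ∫ τ in a..t, G τ) :
    F b ^ 2 - F a ^ 2 = ∫ t in a..b, 2 * (F t * G t) := by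
  set Φ : ℝ → ℝ := fun t => F a + ∫ τ in a..t, G τ with hΦ
  have hac : AbsolutelyContinuousOnInterval Φ a b := by
    have hc : AbsolutelyContinuousOnInterval (fun _ : ℝ => F a) a b :=
      (LipschitzWith.const' (K := 0) (F a)).lipschitzOnWith.absolutelyContinuousOnInterval
    exact hc.add (hG.absolutelyContinuousOnInterval_intervalIntegral Set.left_mem_uIcc)
  have h := hac.integral_deriv_mul_eq_sub hac
  have ha : Φ a = F a := by simp [hΦ]
  have hb : Φ b = F b := (hF b ⟨hab, le_rfl⟩).symm
  rw [ha, hb] at h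
  rw [sq, sq, ← h]
  refine intervalIntegral.integral_congr_ae ?_
  filter_upwards [hG.ae_hasDerivAt_integral] with t ht hmem
  have ht' : t ∈ Set.uIcc a b := Set.uIoc_subset_uIcc hmem
  have hd : HasDerivAt Φ (G t) t := (ht ht' a Set.left_mem_uIcc).const_add (F a)
  rw [hd.deriv, hF t (by rwa [Set.uIcc_of_le hab] at ht')]
  simp only [hΦ]; ring

theorem norm_sq_sub_norm_sq_eq_integral {f g : ℝ → ℂ} {a b : ℝ} (hab : a ≤ b)
    (hg : IntervalIntegrable g volume a b)
    (hf : ∀ t ∈ Set.Icc a b, f t - f a = ∫ τ in a..t, g τ)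
    (hfc : ContinuousOn f (Set.Icc a b)) :
    ‖f b‖ ^ 2 - ‖f a‖ ^ 2 = ∫ t in a..b, 2 * (star (f t) * g t).re := by
  have hsub : ∀ t ∈ Set.Icc a b, IntervalIntegrable g volume a t := fun t ht =>
    hg.mono_set (by rw [Set.uIcc_of_le hab, Set.uIcc_of_le ht.1]; exact Set.Icc_subset_Icc le_rfl ht.2)
  have hgre : IntervalIntegrable (fun t => (g t).re) volume a b := ⟨hg.1.re, hg.2.re⟩
  have hgim : IntervalIntegrable (fun t => (g t).im) volume a b := ⟨hg.1.im, hg.2.im⟩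
  have h1 := sq_sub_sq_eq_integral (F := fun t => (f t).re) hab hgre (fun t ht => by
    have := Complex.reCLM.intervalIntegral_comp_comm (hsub t ht)
    simp only [Complex.reCLM_apply] at this
    rw [this, ← hf t ht]; simp)
  have h2 := sq_sub_sq_eq_integral (F := fun t => (f t).im) hab hgim (fun t ht => by
    have := Complex.imCLM.intervalIntegral_comp_comm (hsub t ht)
    simp only [Complex.imCLM_apply] at this
    rw [this, ← hf t ht]; simp)
  have hre : ContinuousOn (fun t => (f t).re) (Set.uIcc a b) := by
    rw [Set.uIcc_of_le hab]; exact Complex.continuous_re.comp_continuousOn hfc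
  have him : ContinuousOn (fun t => (f t).im) (Set.uIcc a b) := by
    rw [Set.uIcc_of_le hab]; exact Complex.continuous_im.comp_continuousOn hfc
  have e : (fun t => 2 * (star (f t) * g t).re) = fun t =>
      2 * ((f t).re * (g t).re) + 2 * ((f t).im * (g t).im) := by
    ext t; simp; ring
  rw [e, intervalIntegral.integral_add ((hgre.continuousOn_mul hre).const_mul 2)
    ((hgim.continuousOn_mul him).const_mul 2), ← h1, ← h2,
    ← Complex.normSq_eq_norm_sq, ← Complex.normSq_eq_norm_sq]
  simp only [Complex.normSq_apply]
  ring

/-- A pointwise bound of Gagliardo-Nirenberg type, in terms of the magnetic derivative. -/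
theorem norm_sq_le_of_magnetic {f g D : ℝ → ℂ} {A : ℝ → ℝ} {c d : ℝ} (hcd : c < d)
    (hfc : ContinuousOn f (Set.Icc c d))
    (hf : ∀ x ∈ Set.Icc c d, ∀ y ∈ Set.Icc c d, f y - f x = ∫ t in x..y, g t)
    (hg : IntegrableOn g (Set.Icc c d)) (hD : MemLp D 2 (volume.restrict (Set.Icc c d)))
    (hgD : ∀ᵐ t ∂(volume.restrict (Set.Icc c d)), g t = Complex.I * (D t + A t * f t))
    {x : ℝ} (hx : x ∈ Set.Icc c d) :
    ‖f x‖ ^ 2 ≤ (d - c)⁻¹ * (∫ t in Set.Icc c d, ‖f t‖ ^ 2) +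
      2 * (√(∫ t in Set.Icc c d, ‖f t‖ ^ 2) * √(∫ t in Set.Icc c d, ‖D t‖ ^ 2)) := by
  have hfL : MemLp f 2 (volume.restrict (Set.Icc c d)) := by
    obtain ⟨M, hM⟩ := isCompact_Icc.exists_bound_of_continuousOn hfc
    exact MemLp.of_bound (hfc.aestronglyMeasurable measurableSet_Icc) M
      ((ae_restrict_mem measurableSet_Icc).mono hM)
  have hint := hfL.integrable_norm_mul_norm hD
  set K := ∫ t in Set.Icc c d, ‖f t‖ * ‖D t‖ with hK
  have hgint : ∀ a ∈ Set.Icc c d, ∀ b ∈ Set.Icc c d, IntervalIntegrable g volume a b :=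
    fun a ha b hb => (hg.mono_set (Set.ordConnected_Icc.uIcc_subset ha hb)).intervalIntegrable
  have key : ∀ a ∈ Set.Icc c d, ∀ b ∈ Set.Icc c d, a ≤ b → |‖f b‖ ^ 2 - ‖f a‖ ^ 2| ≤ 2 * K := by
    intro a ha b hb hab
    have hss : Set.Icc a b ⊆ Set.Icc c d := Set.Icc_subset_Icc ha.1 hb.2
    rw [norm_sq_sub_norm_sq_eq_integral hab (hgint a ha b hb)
      (fun t ht => hf a ha t (hss ht)) (hfc.mono hss), intervalIntegral.integral_of_le hab,
      ← Real.norm_eq_abs]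
    refine (norm_integral_le_integral_norm _).trans ?_
    rw [← integral_const_mul 2, ← integral_Icc_eq_integral_Ioc]
    have hint2 := (hint.const_mul 2)
    calc _ ≤ ∫ t in Set.Icc a b, 2 * (‖f t‖ * ‖D t‖) := by
          refine integral_mono_of_nonneg (Eventually.of_forall fun t => norm_nonneg _)
            (IntegrableOn.mono_set hint2 hss) ?_
          filter_upwards [ae_restrict_of_ae_restrict_of_subset hss hgD] with t ht
          rw [ht]
          -- The magnetic potential contributes `i A |f|²`, which is purely imaginary and disappears
          -- from the derivative of `|f|²`. Hence no bound on `A` enters the estimate.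
          have : star (f t) * (Complex.I * (D t + A t * f t)) =
              Complex.I * (star (f t) * D t) + ((A t * ‖f t‖ ^ 2 : ℝ) : ℂ) * Complex.I := by
            have h := Complex.conj_mul' (f t)
            push_cast
            rw [← h, Complex.star_def]; ring
          rw [this, norm_mul, Real.norm_ofNat, Real.norm_eq_abs, Complex.add_re,
            Complex.re_ofReal_mul, Complex.I_re, mul_zero, add_zero]
          gcongr
          refine (Complex.abs_re_le_norm _).trans ?_
          simp
      _ ≤ _ := setIntegral_mono_set hint2
          (Eventually.of_forall fun t => by positivity) hss.eventuallyLE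
  have key2 : ∀ y ∈ Set.Icc c d, ‖f x‖ ^ 2 ≤ ‖f y‖ ^ 2 + 2 * K := by
    intro y hy
    rcases le_total x y with h | h
    · linarith [(abs_le.1 (key x hx y hy h)).1]
    · linarith [(abs_le.1 (key y hy x hx h)).2]
  have hKle : K ≤ √(∫ t in Set.Icc c d, ‖f t‖ ^ 2) * √(∫ t in Set.Icc c d, ‖D t‖ ^ 2) :=
    integral_norm_mul_norm_le hfL hD
  -- The oscillation bound is averaged over all base points `y` of the interval.
  have hav : (d - c) * ‖f x‖ ^ 2 ≤ (∫ t in Set.Icc c d, ‖f t‖ ^ 2) + (d - c) * (2 * K) := by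
    have hi : IntegrableOn (fun y => ‖f y‖ ^ 2 + 2 * K) (Set.Icc c d) :=
      hfL.integrable_norm_sq.add (integrable_const _)
    have h := setIntegral_mono_on (μ := volume) (s := Set.Icc c d) (f := fun _ => ‖f x‖ ^ 2)
      (g := fun y => ‖f y‖ ^ 2 + 2 * K) (integrable_const _)
      hi measurableSet_Icc key2
    rw [integral_add hfL.integrable_norm_sq (integrable_const _)] at h
    simpa [hcd.le] using h
  have hdc : 0 < d - c := sub_pos.2 hcd
  have : ‖f x‖ ^ 2 ≤ (d - c)⁻¹ * ((∫ t in Set.Icc c d, ‖f t‖ ^ 2) + (d - c) * (2 * K)) := by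
    rw [inv_mul_eq_div, le_div_iff₀ hdc]; linarith
  rw [mul_add, inv_mul_cancel_left₀ hdc.ne'] at this
  linarith

/-- Cauchy-Schwarz against the constant `1`; this is the source of the Hölder-1/2 modulus used for
compactness on the core. -/
theorem norm_sub_le_of_integral {f g : ℝ → ℂ} {c d : ℝ}
    (hf : ∀ x ∈ Set.Icc c d, ∀ y ∈ Set.Icc c d, f y - f x = ∫ t in x..y, g t)
    (hg : MemLp g 2 (volume.restrict (Set.Icc c d)))
    {x y : ℝ} (hx : x ∈ Set.Icc c d) (hy : y ∈ Set.Icc c d) :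
    ‖f y - f x‖ ≤ √|y - x| * √(∫ t in Set.Icc c d, ‖g t‖ ^ 2) := by
  wlog hxy : x ≤ y generalizing x y
  · have := this hy hx (le_of_not_ge hxy)
    rwa [norm_sub_rev, abs_sub_comm] at this
  have hss : Set.Icc x y ⊆ Set.Icc c d := Set.Icc_subset_Icc hx.1 hy.2
  have hg' : MemLp g 2 (volume.restrict (Set.Icc x y)) :=
    hg.mono_measure (Measure.restrict_mono hss le_rfl)
  have h1 : MemLp (fun _ : ℝ => (1 : ℂ)) 2 (volume.restrict (Set.Icc x y)) := memLp_const 1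
  rw [hf x hx y hy, intervalIntegral.integral_of_le hxy, ← integral_Icc_eq_integral_Ioc]
  calc _ ≤ ∫ t in Set.Icc x y, ‖(1 : ℂ)‖ * ‖g t‖ := by
        simpa using norm_integral_le_integral_norm (μ := volume.restrict (Set.Icc x y)) g
    _ ≤ _ := integral_norm_mul_norm_le h1 hg'
    _ ≤ _ := by
      gcongr ?_ * ?_
      · simp [hxy, abs_of_nonneg (sub_nonneg.2 hxy)]
      · refine Real.sqrt_le_sqrt ?_
        exact setIntegral_mono_set hg.integrable_norm_sq
          (Eventually.of_forall fun t => by positivity) hss.eventuallyLE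

/-! ### The magnetic Sobolev space: linear structure, quadratic form, sup bound -/

namespace MetricGraph

variable {N B H : Type*} (G : MetricGraph N B H) {A V : B ⊕ H → ℝ → ℝ}
  {u v : B ⊕ H → ℝ → ℂ}

theorem convex_I (e : B ⊕ H) : Convex ℝ (G.I e) := by
  cases e
  · exact convex_Icc _ _
  · exact convex_Ici _

theorem isClosed_I (e : B ⊕ H) : IsClosed (G.I e) := by
  cases e
  · exact isClosed_Icc
  · exact isClosed_Ici

theorem measurableSet_I (e : B ⊕ H) : MeasurableSet (G.I e) := (G.isClosed_I e).measurableSet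

theorem zero_mem_I (e : B ⊕ H) : (0 : ℝ) ∈ G.I e := by
  cases e with
  | inl b => exact ⟨le_rfl, (G.len_pos b).le⟩
  | inr h => exact Set.self_mem_Ici

/-- The length of a bounded edge, and `1` for a half-line. -/
noncomputable def refLen : B ⊕ H → ℝ
  | Sum.inl b => G.len b
  | Sum.inr _ => 1

theorem refLen_pos (e : B ⊕ H) : 0 < G.refLen e := by
  cases e with
  | inl b => exact G.len_pos b
  | inr h => exact one_pos

/-- Each point gets a subinterval of a length depending only on its edge, so that the interval
estimate holds uniformly, also along half-lines. -/
theorem exists_Icc_subset_I (e : B ⊕ H) {x : ℝ} (hx : x ∈ G.I e) :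
    ∃ c, x ∈ Set.Icc c (c + G.refLen e) ∧ Set.Icc c (c + G.refLen e) ⊆ G.I e := by
  cases e with
  | inl b => exact ⟨0, by simpa [refLen, I] using hx, by simp [refLen, I]⟩
  | inr h =>
    refine ⟨x, ⟨le_rfl, by simp [refLen]⟩, fun y hy => ?_⟩
    exact le_trans (show (0 : ℝ) ≤ x from hx) hy.1

theorem interior_I_nonempty (e : B ⊕ H) : (interior (G.I e)).Nonempty := by
  obtain ⟨c, -, hc⟩ := G.exists_Icc_subset_I e (G.zero_mem_I e)
  have := interior_mono hc
  rw [interior_Icc] at this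
  exact (Set.nonempty_Ioo.2 (by linarith [G.refLen_pos e])).mono this

/-- The multiplication by `√V`. -/
noncomputable def sqrtMul (V : B ⊕ H → ℝ → ℝ) (u : B ⊕ H → ℝ → ℂ) (e : B ⊕ H) (x : ℝ) : ℂ :=
  (√(V e x) : ℂ) * u e x

variable {G}

theorem MemL1Loc.aestronglyMeasurable (hV : G.MemL1Loc V) (e : B ⊕ H) :
    AEStronglyMeasurable (V e) (volume.restrict (G.I e)) := by
  have h : G.I e = ⋃ n : ℕ, G.I e ∩ Set.Icc 0 (n : ℝ) := by
    rw [← Set.inter_iUnion, eq_comm, Set.inter_eq_left]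
    intro x hx
    have h0 : 0 ≤ x := by
      cases e with
      | inl b => exact hx.1
      | inr h => exact hx
    obtain ⟨n, hn⟩ := exists_nat_ge x
    exact Set.mem_iUnion.2 ⟨n, h0, hn⟩
  rw [h, aestronglyMeasurable_iUnion_iff]
  exact fun n => (hV e n).aestronglyMeasurable

theorem IsContinuous.aestronglyMeasurable (hu : G.IsContinuous u) (e : B ⊕ H) :
    AEStronglyMeasurable (u e) (volume.restrict (G.I e)) :=
  (hu.2.1 e).aestronglyMeasurable (G.measurableSet_I e)

theorem norm_sqrtMul_sq (hV1 : ∀ e, ∀ x ∈ G.I e, 1 ≤ V e x) {e : B ⊕ H} {x : ℝ} (hx : x ∈ G.I e) :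
    ‖sqrtMul V u e x‖ ^ 2 = V e x * ‖u e x‖ ^ 2 := by
  rw [sqrtMul, norm_mul, mul_pow, Complex.norm_real, Real.norm_eq_abs, sq_abs,
    Real.sq_sqrt (zero_le_one.trans (hV1 e x hx))]

/-- The weighted condition becomes plain L² membership of `√V u`, which is linear in `u`; sums and
scalar products in the potential term are then those of L². -/
theorem memLp_sqrtMul_iff (hV : G.MemL1Loc V) (hV1 : ∀ e, ∀ x ∈ G.I e, 1 ≤ V e x)
    (hu : G.IsContinuous u) (e : B ⊕ H) :
    MemLp (sqrtMul V u e) 2 (volume.restrict (G.I e)) ↔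
      IntegrableOn (fun x => V e x * ‖u e x‖ ^ 2) (G.I e) := by
  have hm : AEStronglyMeasurable (sqrtMul V u e) (volume.restrict (G.I e)) := by
    refine AEStronglyMeasurable.mul ?_ (hu.aestronglyMeasurable e)
    exact Complex.continuous_ofReal.comp_aestronglyMeasurable
      (Real.continuous_sqrt.comp_aestronglyMeasurable (hV.aestronglyMeasurable e))
  rw [memLp_two_iff_integrable_sq_norm hm, IntegrableOn]
  refine integrable_congr ?_
  filter_upwards [ae_restrict_mem (G.measurableSet_I e)] with x hx
  exact norm_sqrtMul_sq hV1 hx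

theorem sqrtMul_add_smul (u v : B ⊕ H → ℝ → ℂ) (t : ℝ) (e : B ⊕ H) (x : ℝ) :
    sqrtMul V (u + t • v) e x = sqrtMul V u e x + (t : ℂ) * sqrtMul V v e x := by
  simp [sqrtMul]; ring

namespace H1A

theorem hasWeakDerivOn (hu : u ∈ G.H1A A V) (e : B ⊕ H) :
    HasWeakDerivOn (G.I e) (u e) (fun x => Complex.I * (G.DA A u e x + A e x * u e x)) := by
  have h := hasWeakDerivOn_weakDerivOn (hu.2.1 e)
  convert h using 1
  ext x
  simp only [DA, sub_add_cancel]
  rw [← mul_assoc, mul_one_div_cancel Complex.I_ne_zero, one_mul]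

theorem sub_eq_integral (hu : u ∈ G.H1A A V) (e : B ⊕ H) {x y : ℝ} (hx : x ∈ G.I e)
    (hy : y ∈ G.I e) :
    u e y - u e x = ∫ t in x..y, Complex.I * (G.DA A u e t + A e t * u e t) :=
  (hasWeakDerivOn hu e).sub_eq_integral (G.convex_I e) (G.isClosed_I e) (G.interior_I_nonempty e)
    (hu.1.2.1 e) hx hy

end H1A

theorem DA_ae_eq {g : ℝ → ℂ} {e : B ⊕ H} (h : HasWeakDerivOn (G.I e) (u e) g) :
    G.DA A u e =ᵐ[volume.restrict (G.I e)] fun x => -Complex.I * g x - A e x * u e x := by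
  filter_upwards [(hasWeakDerivOn_weakDerivOn ⟨g, h⟩).ae_eq (G.convex_I e) (G.isClosed_I e) h]
    with x hx
  simp [DA, hx]

theorem H1A.hasWeakDerivOn_add_smul (hu : u ∈ G.H1A A V) (hv : v ∈ G.H1A A V) (t : ℝ)
    (e : B ⊕ H) : HasWeakDerivOn (G.I e) ((u + t • v) e)
      ((fun x => Complex.I * (G.DA A u e x + A e x * u e x)) +
        (t : ℂ) • fun x => Complex.I * (G.DA A v e x + A e x * v e x)) := by
  convert (H1A.hasWeakDerivOn hu e).add (G.isClosed_I e)
    ((H1A.hasWeakDerivOn hv e).const_smul (t : ℂ)) using 1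
  ext x
  simp

/-- Only almost everywhere: the chosen weak derivative of a combination need not be the combination
of the chosen ones. -/
theorem H1A.DA_add_smul (hu : u ∈ G.H1A A V) (hv : v ∈ G.H1A A V) (t : ℝ) (e : B ⊕ H) :
    G.DA A (u + t • v) e =ᵐ[volume.restrict (G.I e)]
      fun x => G.DA A u e x + (t : ℂ) * G.DA A v e x := by
  filter_upwards [DA_ae_eq (A := A) (H1A.hasWeakDerivOn_add_smul hu hv t e)] with x hx
  rw [hx]
  simp only [Pi.add_apply, Pi.smul_apply, smul_eq_mul, Complex.real_smul]
  linear_combination (-(G.DA A u e x + A e x * u e x) - t * (G.DA A v e x + A e x * v e x)) *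
    Complex.I_mul_I

theorem H1A.add_smul_mem (hV : G.MemL1Loc V) (hV1 : ∀ e, ∀ x ∈ G.I e, 1 ≤ V e x)
    (hu : u ∈ G.H1A A V) (hv : v ∈ G.H1A A V) (t : ℝ) : u + t • v ∈ G.H1A A V := by
  have hc : G.IsContinuous (u + t • v) := by
    obtain ⟨h1, h2, val, h3, h4⟩ := hu.1
    obtain ⟨k1, k2, val', k3, k4⟩ := hv.1
    refine ⟨fun e x hx => by simp [h1 e x hx, k1 e x hx], fun e => (h2 e).add ((k2 e).const_smul t),
      val + t • val', fun e => by simp [h3, k3], fun b => by simp [h4, k4]⟩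
  refine ⟨hc, fun e => ⟨_, H1A.hasWeakDerivOn_add_smul hu hv t e⟩, fun e => ?_, fun e => ?_⟩
  · refine MemLp.ae_eq (H1A.DA_add_smul hu hv t e).symm ?_
    exact (hu.2.2.1 e).add ((hv.2.2.1 e).const_mul _)
  · rw [← memLp_sqrtMul_iff hV hV1 hc]
    have : sqrtMul V (u + t • v) e = fun x => sqrtMul V u e x + (t : ℂ) * sqrtMul V v e x :=
      funext fun x => sqrtMul_add_smul u v t e x
    rw [this]
    exact ((memLp_sqrtMul_iff hV hV1 hu.1 e).2 (hu.2.2.2 e)).add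
      (((memLp_sqrtMul_iff hV hV1 hv.1 e).2 (hv.2.2.2 e)).const_mul _)

theorem hasWeakDerivOn_zero (s : Set ℝ) : HasWeakDerivOn s 0 0 :=
  ⟨locallyIntegrableOn_zero, locallyIntegrableOn_zero, by simp⟩

theorem H1A.zero_mem : (0 : B ⊕ H → ℝ → ℂ) ∈ G.H1A A V := by
  refine ⟨⟨fun _ _ _ => rfl, fun e => continuousOn_const, 0, fun _ => rfl, fun _ => rfl⟩,
    fun e => ⟨0, hasWeakDerivOn_zero _⟩, fun e => ?_, fun e => by simp⟩
  have h : HasWeakDerivOn (G.I e) ((0 : B ⊕ H → ℝ → ℂ) e) 0 := hasWeakDerivOn_zero _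
  refine MemLp.ae_eq (DA_ae_eq (A := A) h).symm ?_
  simp

variable (G A V) in
/-- `H¹_A(G, ℂ)` as a real vector space. -/
def H1Submodule (hV : G.MemL1Loc V) (hV1 : ∀ e, ∀ x ∈ G.I e, 1 ≤ V e x) :
    Submodule ℝ (B ⊕ H → ℝ → ℂ) where
  carrier := G.H1A A V
  zero_mem' := H1A.zero_mem
  add_mem' := fun hu hv => by simpa using H1A.add_smul_mem hV hV1 hu hv 1
  smul_mem' := fun t u hu => by simpa using H1A.add_smul_mem hV hV1 H1A.zero_mem hu t

theorem H1A.memL2_sqrtMul (hV : G.MemL1Loc V) (hV1 : ∀ e, ∀ x ∈ G.I e, 1 ≤ V e x)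
    (hu : u ∈ G.H1A A V) : G.MemL2 (sqrtMul V u) := fun e =>
  (memLp_sqrtMul_iff hV hV1 hu.1 e).2 (hu.2.2.2 e)

theorem norm_le_norm_sqrtMul (hV1 : ∀ e, ∀ x ∈ G.I e, 1 ≤ V e x) {e : B ⊕ H} {x : ℝ}
    (hx : x ∈ G.I e) : ‖u e x‖ ≤ ‖sqrtMul V u e x‖ := by
  rw [sqrtMul, norm_mul]
  refine le_mul_of_one_le_left (norm_nonneg _) ?_
  rw [Complex.norm_real, Real.norm_of_nonneg (Real.sqrt_nonneg _), Real.one_le_sqrt]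
  exact hV1 e x hx

theorem H1A.memL2 (hV : G.MemL1Loc V) (hV1 : ∀ e, ∀ x ∈ G.I e, 1 ≤ V e x)
    (hu : u ∈ G.H1A A V) : G.MemL2 u := fun e => by
  refine (H1A.memL2_sqrtMul hV hV1 hu e).mono (hu.1.aestronglyMeasurable e) ?_
  filter_upwards [ae_restrict_mem (G.measurableSet_I e)] with x hx
  exact norm_le_norm_sqrtMul hV1 hx

section Fintype

variable [Fintype B] [Fintype H]

theorem mass_nonneg (u : B ⊕ H → ℝ → ℂ) : 0 ≤ G.mass u :=
  Finset.sum_nonneg fun _ _ => integral_nonneg fun _ => by positivity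

theorem normSq_eq (hV : G.MemL1Loc V) (hV1 : ∀ e, ∀ x ∈ G.I e, 1 ≤ V e x) (hu : u ∈ G.H1A A V) :
    G.normSq A V u = ∑ e, ((∫ x in G.I e, ‖G.DA A u e x‖ ^ 2) +
      ∫ x in G.I e, ‖sqrtMul V u e x‖ ^ 2) := by
  refine Finset.sum_congr rfl fun e _ => ?_
  rw [← integral_add (hu.2.2.1 e).integrable_norm_sq
    (H1A.memL2_sqrtMul hV hV1 hu e).integrable_norm_sq]
  refine setIntegral_congr_fun (G.measurableSet_I e) fun x hx => ?_
  simp only [norm_sqrtMul_sq hV1 hx]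

theorem form_eq (hV : G.MemL1Loc V) (hV1 : ∀ e, ∀ x ∈ G.I e, 1 ≤ V e x) (hu : u ∈ G.H1A A V)
    (hv : v ∈ G.H1A A V) :
    G.form A V u v = ∑ e, ((∫ x in G.I e, G.DA A u e x * star (G.DA A v e x)) +
      ∫ x in G.I e, sqrtMul V u e x * star (sqrtMul V v e x)) := by
  refine Finset.sum_congr rfl fun e _ => ?_
  rw [← integral_add ((hu.2.2.1 e).integrable_mul_star (hv.2.2.1 e))
    ((H1A.memL2_sqrtMul hV hV1 hu e).integrable_mul_star (H1A.memL2_sqrtMul hV hV1 hv e))]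
  refine setIntegral_congr_fun (G.measurableSet_I e) fun x hx => ?_
  have h : (V e x : ℂ) = (√(V e x) : ℂ) * (√(V e x) : ℂ) := by
    rw [← Complex.ofReal_mul, Real.mul_self_sqrt (zero_le_one.trans (hV1 e x hx))]
  simp only [sqrtMul, star_mul', Complex.star_def, Complex.conj_ofReal]
  rw [h]; ring

theorem mass_add_smul (hu : G.MemL2 u) (hv : G.MemL2 v) (t : ℝ) :
    G.mass (u + t • v) = G.mass u + 2 * t * (G.innerL2 u v).re + t ^ 2 * G.mass v := by
  simp only [mass, innerL2, Complex.re_sum, Finset.mul_sum, ← Finset.sum_add_distrib]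
  refine Finset.sum_congr rfl fun e _ => ?_
  rw [← integral_norm_add_real_smul_sq (hu e) (hv e) t]
  simp

/-- The quadratic expansion on which scaling, the first variation and the resolvent estimate at `λ₁`
all rest. -/
theorem normSq_add_smul (hV : G.MemL1Loc V) (hV1 : ∀ e, ∀ x ∈ G.I e, 1 ≤ V e x)
    (hu : u ∈ G.H1A A V) (hv : v ∈ G.H1A A V) (t : ℝ) :
    G.normSq A V (u + t • v) =
      G.normSq A V u + 2 * t * (G.form A V u v).re + t ^ 2 * G.normSq A V v := by
  rw [normSq_eq hV hV1 (H1A.add_smul_mem hV hV1 hu hv t), normSq_eq hV hV1 hu,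
    normSq_eq hV hV1 hv, form_eq hV hV1 hu hv]
  simp only [Complex.re_sum, Finset.mul_sum, ← Finset.sum_add_distrib]
  refine Finset.sum_congr rfl fun e _ => ?_
  have h1 := integral_norm_add_real_smul_sq (hu.2.2.1 e) (hv.2.2.1 e) t
  have h2 := integral_norm_add_real_smul_sq (H1A.memL2_sqrtMul hV hV1 hu e)
    (H1A.memL2_sqrtMul hV hV1 hv e) t
  have h3 : ∫ x in G.I e, ‖G.DA A (u + t • v) e x‖ ^ 2 =
      ∫ x in G.I e, ‖G.DA A u e x + (t : ℂ) * G.DA A v e x‖ ^ 2 := by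
    refine integral_congr_ae ?_
    filter_upwards [H1A.DA_add_smul hu hv t e] with x hx
    rw [hx]
  simp only [sqrtMul_add_smul, h3, h1, h2, Complex.add_re]
  ring

theorem normSq_zero : G.normSq A V 0 = 0 := by
  refine Finset.sum_eq_zero fun e _ => ?_
  rw [← integral_zero]
  have h : HasWeakDerivOn (G.I e) ((0 : B ⊕ H → ℝ → ℂ) e) 0 := hasWeakDerivOn_zero _
  refine integral_congr_ae ?_
  filter_upwards [DA_ae_eq (A := A) h] with x hx
  rw [hx]; simp

theorem mass_zero : G.mass 0 = 0 := by simp [mass]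

theorem mass_smul (hu : G.MemL2 u) (t : ℝ) : G.mass (t • u) = t ^ 2 * G.mass u := by
  have h0 : G.MemL2 0 := fun e => by simp
  simpa [mass_zero, innerL2] using mass_add_smul h0 hu t

theorem normSq_smul (hV : G.MemL1Loc V) (hV1 : ∀ e, ∀ x ∈ G.I e, 1 ≤ V e x)
    (hu : u ∈ G.H1A A V) (t : ℝ) : G.normSq A V (t • u) = t ^ 2 * G.normSq A V u := by
  have h := normSq_add_smul hV hV1 H1A.zero_mem hu t
  have h2 : (G.form A V 0 u).re = 0 := by
    have e : ∀ e, ∫ x in G.I e, G.DA A 0 e x * star (G.DA A u e x) = 0 := by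
      intro e
      rw [← integral_zero]
      have h : HasWeakDerivOn (G.I e) ((0 : B ⊕ H → ℝ → ℂ) e) 0 := hasWeakDerivOn_zero _
      refine integral_congr_ae ?_
      filter_upwards [DA_ae_eq (A := A) h] with x hx
      rw [hx]; simp
    rw [form_eq hV hV1 H1A.zero_mem hu]
    simp only [e]
    simp [sqrtMul]
  simpa [normSq_zero, h2] using h

theorem mass_le_normSq (hV : G.MemL1Loc V) (hV1 : ∀ e, ∀ x ∈ G.I e, 1 ≤ V e x)
    (hu : u ∈ G.H1A A V) : G.mass u ≤ G.normSq A V u := by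
  rw [normSq_eq hV hV1 hu]
  refine Finset.sum_le_sum fun e _ => ?_
  refine le_add_of_nonneg_of_le (integral_nonneg fun _ => by positivity) ?_
  refine setIntegral_mono_on (H1A.memL2 hV hV1 hu e).integrable_norm_sq
    (H1A.memL2_sqrtMul hV hV1 hu e).integrable_norm_sq (G.measurableSet_I e) fun x hx => ?_
  have := norm_le_norm_sqrtMul (u := u) hV1 hx
  gcongr

theorem setIntegral_DA_le_normSq (hV : G.MemL1Loc V) (hV1 : ∀ e, ∀ x ∈ G.I e, 1 ≤ V e x)
    (hu : u ∈ G.H1A A V) (e : B ⊕ H) :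
    ∫ x in G.I e, ‖G.DA A u e x‖ ^ 2 ≤ G.normSq A V u := by
  rw [normSq_eq hV hV1 hu]
  have h1 : ∀ e, 0 ≤ ∫ x in G.I e, ‖G.DA A u e x‖ ^ 2 :=
    fun e => integral_nonneg fun _ => by positivity
  have h2 : ∀ e, 0 ≤ ∫ x in G.I e, ‖sqrtMul V u e x‖ ^ 2 :=
    fun e => integral_nonneg fun _ => by positivity
  exact (le_add_of_nonneg_right (h2 e)).trans
    (Finset.single_le_sum (fun e _ => add_nonneg (h1 e) (h2 e)) (Finset.mem_univ e))

theorem setIntegral_le_mass (u : B ⊕ H → ℝ → ℂ) (e : B ⊕ H) :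
    ∫ x in G.I e, ‖u e x‖ ^ 2 ≤ G.mass u :=
  Finset.single_le_sum (f := fun e => ∫ x in G.I e, ‖u e x‖ ^ 2)
    (fun e _ => integral_nonneg fun _ => by positivity) (Finset.mem_univ e)

/-- The functions of `H¹_A(G, ℂ)` are bounded, with a bound of Gagliardo-Nirenberg type. -/
theorem exists_norm_sq_le (hV : G.MemL1Loc V)
    (hV1 : ∀ e, ∀ x ∈ G.I e, 1 ≤ V e x) :
    ∃ C > 0, ∀ u ∈ G.H1A A V, ∀ e, ∀ x ∈ G.I e,
      ‖u e x‖ ^ 2 ≤ C * (√(G.mass u) * √(G.normSq A V u)) := by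
  refine ⟨∑ e, (G.refLen e)⁻¹ + 2, ?_, fun u hu e x hx => ?_⟩
  · have : 0 ≤ ∑ e, (G.refLen e)⁻¹ :=
      Finset.sum_nonneg fun e _ => (inv_pos.2 (G.refLen_pos e)).le
    linarith
  obtain ⟨c, hxc, hc⟩ := G.exists_Icc_subset_I e hx
  have hl := G.refLen_pos e
  have hr := Measure.restrict_mono hc (le_refl (volume : Measure ℝ))
  have h := norm_sq_le_of_magnetic (A := A e) (show c < c + G.refLen e by linarith)
    ((hu.1.2.1 e).mono hc)
    (fun x hx y hy => H1A.sub_eq_integral hu e (hc hx) (hc hy))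
    ((H1A.hasWeakDerivOn hu e).2.1.integrableOn_compact_subset hc isCompact_Icc)
    ((hu.2.2.1 e).mono_measure hr) (Eventually.of_forall fun t => rfl) hxc
  rw [add_sub_cancel_left] at h
  have hm : ∫ t in Set.Icc c (c + G.refLen e), ‖u e t‖ ^ 2 ≤ G.mass u :=
    (setIntegral_mono_set (H1A.memL2 hV hV1 hu e).integrable_norm_sq
      (Eventually.of_forall fun t => by positivity) hc.eventuallyLE).trans
      (setIntegral_le_mass u e)
  have hd : ∫ t in Set.Icc c (c + G.refLen e), ‖G.DA A u e t‖ ^ 2 ≤ G.normSq A V u :=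
    (setIntegral_mono_set (hu.2.2.1 e).integrable_norm_sq
      (Eventually.of_forall fun t => by positivity) hc.eventuallyLE).trans
      (setIntegral_DA_le_normSq hV hV1 hu e)
  have hmn := mass_le_normSq hV hV1 hu
  have hm0 := G.mass_nonneg u
  -- Since `V ≥ 1` the mass is at most `normSq`, so the zeroth-order term of the interval bound is
  -- absorbed into the product of the square roots.
  have hmm : G.mass u ≤ √(G.mass u) * √(G.normSq A V u) := by
    calc G.mass u = √(G.mass u) * √(G.mass u) := (Real.mul_self_sqrt hm0).symm
      _ ≤ _ := by gcongr
  have hinv : (G.refLen e)⁻¹ ≤ ∑ e, (G.refLen e)⁻¹ :=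
    Finset.single_le_sum (f := fun e => (G.refLen e)⁻¹)
      (fun e _ => (inv_pos.2 (G.refLen_pos e)).le) (Finset.mem_univ e)
  calc ‖u e x‖ ^ 2 ≤ _ := h
    _ ≤ (∑ e, (G.refLen e)⁻¹) * (√(G.mass u) * √(G.normSq A V u)) +
        2 * (√(G.mass u) * √(G.normSq A V u)) := by
      refine add_le_add (mul_le_mul hinv (hm.trans hmm)
        (integral_nonneg fun _ => by positivity) ((inv_pos.2 hl).le.trans hinv)) ?_
      gcongr
    _ = _ := by ring

end Fintype

end MetricGraph

/-! ### Completeness and the Hilbert-space model -/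

namespace MetricGraph

variable {N B H : Type*} {G : MetricGraph N B H} {A V : B ⊕ H → ℝ → ℝ}

theorem MemL2Loc.locallyIntegrableOn (hA : G.MemL2Loc A) (e : B ⊕ H) :
    LocallyIntegrableOn (fun x => (A e x : ℂ)) (G.I e) := by
  rw [locallyIntegrableOn_iff (G.isClosed_I e).isLocallyClosed]
  intro k hk hkc
  obtain ⟨R, hR⟩ := hkc.bddAbove
  have hsub : k ⊆ G.I e ∩ Set.Icc 0 R := by
    refine fun x hx => ⟨hk hx, ?_, hR hx⟩
    have := hk hx
    cases e with
    | inl b => exact this.1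
    | inr h => exact this
  have hfin : IsFiniteMeasure (volume.restrict (G.I e ∩ Set.Icc 0 R)) :=
    ⟨by
      rw [Measure.restrict_apply_univ]
      exact (measure_mono Set.inter_subset_right).trans_lt measure_Icc_lt_top⟩
  have h : IntegrableOn (A e) (G.I e ∩ Set.Icc 0 R) := (hA e R).integrable one_le_two
  exact (h.mono_set hsub).ofReal

/-- Dominated convergence: uniform convergence eventually gives the majorant `|φ K| (|f₀| + 1)`,
integrable because `φ` has compact support. It serves both for `K = 1` and for `K = A`. -/
theorem tendsto_integral_smul_mul {s : Set ℝ} (hcl : IsClosed s) {K : ℝ → ℂ}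
    (hK : LocallyIntegrableOn K s) {φ : ℝ → ℝ} (hφ : Continuous φ) (hc : HasCompactSupport φ)
    {f : ℕ → ℝ → ℂ} {f₀ : ℝ → ℂ} (hf : ∀ n, ContinuousOn (f n) s)
    (hlim : TendstoUniformlyOn f f₀ atTop s) :
    Tendsto (fun n => ∫ x in s, φ x • (K x * f n x)) atTop (𝓝 (∫ x in s, φ x • (K x * f₀ x))) := by
  have hms := hcl.measurableSet
  have hf₀ : ContinuousOn f₀ s := hlim.continuousOn (Frequently.of_forall hf)
  have hb : LocallyIntegrableOn (fun x => (((‖f₀ x‖ + 1 : ℝ) : ℂ)) • K x) s :=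
    hK.continuousOn_smul hcl.isLocallyClosed
      (Complex.continuous_ofReal.comp_continuousOn (hf₀.norm.add continuousOn_const))
  have hKm : AEStronglyMeasurable K (volume.restrict s) := hK.aestronglyMeasurable
  refine tendsto_integral_filter_of_dominated_convergence
    (fun x => ‖φ x • ((((‖f₀ x‖ + 1 : ℝ) : ℂ)) • K x)‖) ?_ ?_
    (LocallyIntegrableOn.integrable_contDiff_smul hcl hb hφ hc).norm ?_
  · refine Eventually.of_forall fun n => hφ.aestronglyMeasurable.smul (hKm.mul ?_)
    exact (hf n).aestronglyMeasurable hms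
  · filter_upwards [Metric.tendstoUniformlyOn_iff.1 hlim 1 one_pos] with n hn
    filter_upwards [ae_restrict_mem hms] with x hx
    have h1 : ‖f n x‖ ≤ ‖f₀ x‖ + 1 := by
      have h2 := hn x hx
      rw [dist_eq_norm, norm_sub_rev] at h2
      have h3 := norm_add_le (f n x - f₀ x) (f₀ x)
      rw [sub_add_cancel] at h3
      linarith
    rw [norm_smul, norm_smul, norm_smul, norm_mul, Complex.norm_real,
      Real.norm_of_nonneg (by positivity : 0 ≤ ‖f₀ x‖ + 1), mul_comm ‖K x‖]
    gcongr
  · filter_upwards [ae_restrict_mem hms] with x hx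
    exact ((hlim.tendsto_at hx).const_mul _).const_smul _

theorem tendsto_integral_smul_of_L2 {s : Set ℝ} {φ : ℝ → ℝ} (hφ : Continuous φ)
    (hc : HasCompactSupport φ) {f : ℕ → ℝ → ℂ} {f₀ : ℝ → ℂ}
    (hf : ∀ n, MemLp (f n) 2 (volume.restrict s)) (hf₀ : MemLp f₀ 2 (volume.restrict s))
    (hlim : Tendsto (fun n => ∫ x in s, ‖f n x - f₀ x‖ ^ 2) atTop (𝓝 0)) :
    Tendsto (fun n => ∫ x in s, φ x • f n x) atTop (𝓝 (∫ x in s, φ x • f₀ x)) := by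
  have hφL : MemLp (fun x => (φ x : ℂ)) 2 (volume.restrict s) :=
    ((hφ.memLp_of_hasCompactSupport hc).restrict s).ofReal
  have hint : ∀ g : ℝ → ℂ, MemLp g 2 (volume.restrict s) →
      Integrable (fun x => φ x • g x) (volume.restrict s) := fun g hg => by
    have := hφL.integrable_mul hg
    refine this.congr (Eventually.of_forall fun x => ?_)
    simp
  rw [tendsto_iff_norm_sub_tendsto_zero]
  refine squeeze_zero (fun _ => norm_nonneg _) (g := fun n =>
    √(∫ x in s, ‖(φ x : ℂ)‖ ^ 2) * √(∫ x in s, ‖f n x - f₀ x‖ ^ 2)) (fun n => ?_) ?_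
  · rw [← integral_sub (hint _ (hf n)) (hint _ hf₀)]
    refine le_trans ?_ (integral_norm_mul_norm_le hφL ((hf n).sub hf₀))
    refine (norm_integral_le_integral_norm _).trans (le_of_eq ?_)
    refine integral_congr_ae (Eventually.of_forall fun x => ?_)
    simp [← mul_sub]
  · have h := (hlim.sqrt).const_mul (√(∫ x in s, ‖(φ x : ℂ)‖ ^ 2))
    rwa [Real.sqrt_zero, mul_zero] at h

/-- The magnetic Sobolev space is closed: a sequence that converges in the graph norm has its limit
in `H¹_A(G, ℂ)`. -/
theorem H1A.exists_limit (hA : G.MemL2Loc A) (hV : G.MemL1Loc V)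
    (hV1 : ∀ e, ∀ x ∈ G.I e, 1 ≤ V e x) {u : ℕ → B ⊕ H → ℝ → ℂ} (hu : ∀ n, u n ∈ G.H1A A V)
    {d w : B ⊕ H → ℝ → ℂ} (hd : G.MemL2 d) (hw : G.MemL2 w)
    (hdlim : ∀ e, Tendsto (fun n => ∫ x in G.I e, ‖G.DA A (u n) e x - d e x‖ ^ 2) atTop (𝓝 0))
    (hwlim : ∀ e, TendstoInMeasure (volume.restrict (G.I e)) (fun n => sqrtMul V (u n) e) atTop
      (w e))
    (hunif : ∀ e, UniformCauchySeqOn (fun n => u n e) atTop (G.I e)) :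
    ∃ u₀ ∈ G.H1A A V, (∀ e, G.DA A u₀ e =ᵐ[volume.restrict (G.I e)] d e) ∧
      ∀ e, sqrtMul V u₀ e =ᵐ[volume.restrict (G.I e)] w e := by
  have hex : ∀ e x, ∃ l, Tendsto (fun n => u n e x) atTop (𝓝 l) := by
    intro e x
    by_cases hx : x ∈ G.I e
    · exact cauchySeq_tendsto_of_complete ((hunif e).cauchy_map hx)
    · exact ⟨0, tendsto_const_nhds.congr fun n => ((hu n).1.1 e x hx).symm⟩
  choose u₀ hu₀ using hex
  have hlim : ∀ e, TendstoUniformlyOn (fun n => u n e) (u₀ e) atTop (G.I e) := fun e =>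
    (hunif e).tendstoUniformlyOn_of_tendsto fun x _ => hu₀ e x
  have hcont : ∀ e, ContinuousOn (u₀ e) (G.I e) := fun e =>
    (hlim e).continuousOn (Frequently.of_forall fun n => (hu n).1.2.1 e)
  choose val hval1 hval2 using fun n => (hu n).1.2.2
  have hc : G.IsContinuous u₀ := by
    -- At a vertex that is no endpoint of any edge `limUnder` may be a default value; gluing never
    -- tests it there.
    refine ⟨fun e x hx => ?_, hcont, fun v => limUnder atTop fun n => val n v, fun e => ?_,
      fun b => ?_⟩
    · exact tendsto_nhds_unique (hu₀ e x) (tendsto_const_nhds.congr fun n =>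
        ((hu n).1.1 e x hx).symm)
    · exact ((hu₀ e 0).congr fun n => hval1 n e).limUnder_eq.symm
    · exact ((hu₀ _ _).congr fun n => hval2 n b).limUnder_eq.symm
  have hAl := fun e => hA.locallyIntegrableOn e
  have hmul : ∀ (f : B ⊕ H → ℝ → ℂ), (∀ e, ContinuousOn (f e) (G.I e)) → ∀ e,
      LocallyIntegrableOn (fun x => (A e x : ℂ) * f e x) (G.I e) := fun f hf e => by
    simpa [mul_comm] using (hAl e).continuousOn_smul (G.isClosed_I e).isLocallyClosed (hf e)
  have hL2loc : ∀ (f : B ⊕ H → ℝ → ℂ), G.MemL2 f → ∀ e, LocallyIntegrableOn (f e) (G.I e) :=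
    fun f hf e => (locallyIntegrableOn_iff_locallyIntegrable_restrict (G.isClosed_I e)).2
      ((hf e).locallyIntegrable one_le_two)
  have hweak : ∀ e, HasWeakDerivOn (G.I e) (u₀ e)
      (fun x => Complex.I * (d e x + A e x * u₀ e x)) := by
    intro e
    refine ⟨(hcont e).locallyIntegrableOn (G.measurableSet_I e),
      ((hL2loc d hd e).add (hmul u₀ hcont e)).smul Complex.I, fun φ hφ hcs hsupp => ?_⟩
    have hcl := G.isClosed_I e
    have h1 : Tendsto (fun n => ∫ x in G.I e, deriv φ x • u n e x) atTop
        (𝓝 (∫ x in G.I e, deriv φ x • u₀ e x)) := by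
      have := tendsto_integral_smul_mul hcl (K := fun _ => 1)
        (continuousOn_const.locallyIntegrableOn (G.measurableSet_I e))
        (hφ.continuous_deriv (by simp)) hcs.deriv (fun n => (hu n).1.2.1 e) (hlim e)
      simpa using this
    have h2 := tendsto_integral_smul_mul hcl (hAl e) hφ.continuous hcs
      (fun n => (hu n).1.2.1 e) (hlim e)
    have h3 := tendsto_integral_smul_of_L2 hφ.continuous hcs (fun n => (hu n).2.2.1 e) (hd e)
      (hdlim e)
    have hsplit : ∀ f g : ℝ → ℂ, LocallyIntegrableOn f (G.I e) → LocallyIntegrableOn g (G.I e) →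
        ∫ x in G.I e, φ x • (Complex.I * (f x + g x)) =
          Complex.I * (∫ x in G.I e, φ x • f x) + Complex.I * ∫ x in G.I e, φ x • g x := by
      intro f g hf hg
      rw [← mul_add, ← integral_add
        (LocallyIntegrableOn.integrable_contDiff_smul hcl hf hφ.continuous hcs)
        (LocallyIntegrableOn.integrable_contDiff_smul hcl hg hφ.continuous hcs),
        ← integral_const_mul]
      refine integral_congr_ae (Eventually.of_forall fun x => ?_)
      simp only [Complex.real_smul]; ring
    have h4 := ((h3.const_mul Complex.I).add (h2.const_mul Complex.I)).neg
    have h5 : ∀ n, -(Complex.I * (∫ x in G.I e, φ x • G.DA A (u n) e x) +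
        Complex.I * ∫ x in G.I e, φ x • ((A e x : ℂ) * u n e x)) =
        ∫ x in G.I e, deriv φ x • u n e x := by
      intro n
      rw [(hasWeakDerivOn (hu n) e).2.2 φ hφ hcs hsupp,
        hsplit _ _ (hL2loc _ (hu n).2.2.1 e) (hmul _ (hu n).1.2.1 e)]
    rw [hsplit _ _ (hL2loc d hd e) (hmul u₀ hcont e)]
    exact tendsto_nhds_unique h1 (h4.congr h5)
  have hDA : ∀ e, G.DA A u₀ e =ᵐ[volume.restrict (G.I e)] d e := by
    intro e
    filter_upwards [DA_ae_eq (A := A) (hweak e)] with x hx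
    rw [hx]
    linear_combination (-(d e x + A e x * u₀ e x)) * Complex.I_mul_I
  -- Convergence in measure yields a subsequence converging almost everywhere, and the pointwise
  -- limit of `u n` then identifies `w`.
  have hsq : ∀ e, sqrtMul V u₀ e =ᵐ[volume.restrict (G.I e)] w e := by
    intro e
    obtain ⟨ns, hns, hae⟩ := (hwlim e).exists_seq_tendsto_ae
    filter_upwards [hae] with x hx
    exact tendsto_nhds_unique (((hu₀ e x).const_mul _).comp hns.tendsto_atTop) hx
  refine ⟨u₀, ⟨hc, fun e => ⟨_, hweak e⟩, fun e => (hd e).ae_eq (hDA e).symm, fun e => ?_⟩,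
    hDA, hsq⟩
  rw [← memLp_sqrtMul_iff hV hV1 hc]
  exact (hw e).ae_eq (hsq e).symm

end MetricGraph

theorem MeasureTheory.Lp.norm_sq_eq_integral {α : Type*} [MeasurableSpace α] {ν : Measure α}
    (f : Lp ℂ 2 ν) : ‖f‖ ^ 2 = ∫ x, ‖f x‖ ^ 2 ∂ν := by
  rw [← real_inner_self_eq_norm_sq, L2.inner_def]
  simp only [real_inner_self_eq_norm_sq]

namespace MetricGraph

variable {N B H : Type*} (G : MetricGraph N B H) {A V : B ⊕ H → ℝ → ℝ}

/-- The Hilbert space `L²(G, ℂ)`. -/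
abbrev L2Space : Type _ := PiLp 2 fun e : B ⊕ H => Lp ℂ 2 (volume.restrict (G.I e))

variable {G}

/-- The class in `L²(G, ℂ)` of a square integrable function. -/
noncomputable def MemL2.toL2 {f : B ⊕ H → ℝ → ℂ} (hf : G.MemL2 f) : G.L2Space :=
  WithLp.toLp 2 fun e => (hf e).toLp (f e)

/-- The combination is assumed only almost everywhere, so that the lemma applies to `D_A`. -/
theorem MemL2.toL2_eq_add_smul {f g h : B ⊕ H → ℝ → ℂ} (hf : G.MemL2 f) (hg : G.MemL2 g)
    (hh : G.MemL2 h) (t : ℝ)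
    (hae : ∀ e, h e =ᵐ[volume.restrict (G.I e)] fun x => f e x + (t : ℂ) * g e x) :
    hh.toL2 = hf.toL2 + t • hg.toL2 := by
  ext1 e
  simp only [toL2, WithLp.ofLp_add, WithLp.ofLp_smul, Pi.add_apply, Pi.smul_apply]
  rw [← MemLp.toLp_const_smul, ← MemLp.toLp_add, MemLp.toLp_eq_toLp_iff]
  filter_upwards [hae e] with x hx
  simp [hx]

variable [Fintype B] [Fintype H]

theorem MemL2.norm_toL2_sq {f : B ⊕ H → ℝ → ℂ} (hf : G.MemL2 f) :
    ‖hf.toL2‖ ^ 2 = G.mass f := by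
  rw [PiLp.norm_sq_eq_of_L2]
  refine Finset.sum_congr rfl fun e _ => ?_
  rw [Lp.norm_sq_eq_integral]
  refine integral_congr_ae ?_
  filter_upwards [(hf e).coeFn_toLp] with x hx
  simp only [toL2]
  rw [hx]

variable (hV : G.MemL1Loc V) (hV1 : ∀ e, ∀ x ∈ G.I e, 1 ≤ V e x)

/-- The embedding of `H¹_A(G, ℂ)` into `L² × L²` by `u ↦ (D_A u, √V u)`. -/
noncomputable def energyMap :
    G.H1Submodule A V hV hV1 →ₗ[ℝ] WithLp 2 (G.L2Space × G.L2Space) where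
  toFun u := WithLp.toLp 2 (MemL2.toL2 (G := G) (f := G.DA A u) u.2.2.2.1,
    (H1A.memL2_sqrtMul hV hV1 u.2).toL2)
  map_add' u v := by
    have h1 := MemL2.toL2_eq_add_smul (G := G) (f := G.DA A u) (g := G.DA A v)
      (h := G.DA A (u + v : H1Submodule G A V hV hV1)) u.2.2.2.1 v.2.2.2.1 (u + v).2.2.2.1 1
      (fun e => by simpa using H1A.DA_add_smul u.2 v.2 1 e)
    have h2 := MemL2.toL2_eq_add_smul (H1A.memL2_sqrtMul hV hV1 u.2)
      (H1A.memL2_sqrtMul hV hV1 v.2) (H1A.memL2_sqrtMul hV hV1 (u + v).2) 1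
      (fun e => Eventually.of_forall fun x => by
        simpa using sqrtMul_add_smul (V := V) u.1 v.1 1 e x)
    rw [h1, h2, one_smul, one_smul]
    rfl
  map_smul' t u := by
    have h0 : G.MemL2 0 := fun e => by simp
    have h00 : h0.toL2 = 0 := by ext1 e; simp [MemL2.toL2]
    have h1 := MemL2.toL2_eq_add_smul (G := G) (f := 0) (g := G.DA A u)
      (h := G.DA A (t • u : H1Submodule G A V hV hV1)) h0 u.2.2.2.1 (t • u).2.2.2.1 t
      (fun e => by
        have hz := DA_ae_eq (A := A)
          (show HasWeakDerivOn (G.I e) ((0 : B ⊕ H → ℝ → ℂ) e) 0 from hasWeakDerivOn_zero _)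
        filter_upwards [H1A.DA_add_smul (H1A.zero_mem (G := G) (A := A) (V := V)) u.2 t e, hz]
          with x hx hx'
        rw [hx'] at hx
        simpa using hx)
    have h2 := MemL2.toL2_eq_add_smul h0
      (H1A.memL2_sqrtMul hV hV1 u.2) (H1A.memL2_sqrtMul hV hV1 (t • u).2) t
      (fun e => Eventually.of_forall fun x => by
        simpa [sqrtMul] using sqrtMul_add_smul (V := V) 0 u.1 t e x)
    rw [h1, h2, h00, zero_add, zero_add]
    rfl

theorem norm_energyMap_sq (u : G.H1Submodule A V hV hV1) :
    ‖energyMap hV hV1 u‖ ^ 2 = G.normSq A V u := by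
  rw [WithLp.prod_norm_sq_eq_of_L2]
  change ‖MemL2.toL2 (G := G) (f := G.DA A u) u.2.2.2.1‖ ^ 2 +
    ‖(H1A.memL2_sqrtMul hV hV1 u.2).toL2‖ ^ 2 = _
  rw [MemL2.norm_toL2_sq, MemL2.norm_toL2_sq, normSq_eq hV hV1 u.2, mass, mass,
    ← Finset.sum_add_distrib]

theorem exists_norm_le_norm_energyMap :
    ∃ C > 0, ∀ u : G.H1Submodule A V hV hV1, ∀ e, ∀ x ∈ G.I e,
      ‖u.1 e x‖ ≤ C * ‖energyMap hV hV1 u‖ := by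
  obtain ⟨C, hC, h⟩ := exists_norm_sq_le (A := A) hV hV1
  refine ⟨√C, Real.sqrt_pos.2 hC, fun u e x hx => ?_⟩
  refine le_of_sq_le_sq ?_ (by positivity)
  rw [mul_pow, Real.sq_sqrt hC.le, norm_energyMap_sq]
  refine (h u.1 u.2 e x hx).trans ?_
  have hm := mass_le_normSq hV hV1 u.2
  have h0 := (G.mass_nonneg u.1).trans hm
  gcongr
  calc √(G.mass u.1) * √(G.normSq A V u.1) ≤ √(G.normSq A V u.1) * √(G.normSq A V u.1) := by gcongr
    _ = _ := Real.mul_self_sqrt h0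

/-- The sup bound carries a factor `√mass`, so zero mass annihilates every value on the edges, not
just almost every one; off the edges functions vanish by convention. -/
theorem eq_zero_of_mass_eq_zero (hV : G.MemL1Loc V)
    (hV1 : ∀ e, ∀ x ∈ G.I e, 1 ≤ V e x) {u : B ⊕ H → ℝ → ℂ} (hu : u ∈ G.H1A A V) (h : G.mass u = 0) :
    u = 0 := by
  obtain ⟨C, hC, hb⟩ := exists_norm_sq_le (A := A) hV hV1
  funext e x
  by_cases hx : x ∈ G.I e
  · have := hb u hu e x hx
    rw [h, Real.sqrt_zero, zero_mul, mul_zero] at this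
    simpa using le_antisymm this (sq_nonneg _)
  · exact hu.1.1 e x hx

theorem energyMap_injective : Function.Injective (energyMap (A := A) hV hV1) := by
  rw [← LinearMap.ker_eq_bot, LinearMap.ker_eq_bot']
  intro u hu
  have h := norm_energyMap_sq hV hV1 u
  rw [hu, norm_zero, zero_pow two_ne_zero] at h
  have hm := mass_le_normSq hV hV1 u.2
  exact Subtype.ext (eq_zero_of_mass_eq_zero hV hV1 u.2
    (le_antisymm (hm.trans h.symm.le) (G.mass_nonneg _)))

/-- Convergence in `L² × L²` makes the functions uniformly Cauchy on every edge through the sup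
bound, so `H1A.exists_limit` supplies a preimage. Completeness of the energy space follows. -/
theorem isClosed_range_energyMap (hA : G.MemL2Loc A) :
    IsClosed (LinearMap.range (energyMap (A := A) hV hV1) :
      Set (WithLp 2 (G.L2Space × G.L2Space))) := by
  refine IsSeqClosed.isClosed fun ξ ξ₀ hξ hlim => ?_
  choose u hu using hξ
  have hfst : ∀ e, Tendsto (fun n => (ξ n).fst e) atTop (𝓝 (ξ₀.fst e)) := fun e =>
    ((by fun_prop : Continuous fun ζ : WithLp 2 (G.L2Space × G.L2Space) => ζ.fst e).tendsto _).comp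
      hlim
  have hsnd : ∀ e, Tendsto (fun n => (ξ n).snd e) atTop (𝓝 (ξ₀.snd e)) := fun e =>
    ((by fun_prop : Continuous fun ζ : WithLp 2 (G.L2Space × G.L2Space) => ζ.snd e).tendsto _).comp
      hlim
  have hufst : ∀ n e, (ξ n).fst e =ᵐ[volume.restrict (G.I e)] G.DA A (u n).1 e := fun n e => by
    rw [← hu n]; exact ((u n).2.2.2.1 e).coeFn_toLp
  have husnd : ∀ n e, (ξ n).snd e =ᵐ[volume.restrict (G.I e)] sqrtMul V (u n).1 e := fun n e => by
    rw [← hu n]; exact (H1A.memL2_sqrtMul hV hV1 (u n).2 e).coeFn_toLp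
  obtain ⟨C, hC, hb⟩ := exists_norm_le_norm_energyMap (A := A) hV hV1
  have hdlim : ∀ e, Tendsto (fun n => ∫ x in G.I e, ‖G.DA A (u n).1 e x - ξ₀.fst e x‖ ^ 2) atTop
      (𝓝 0) := by
    intro e
    have h := (tendsto_iff_norm_sub_tendsto_zero.1 (hfst e)).pow 2
    rw [zero_pow two_ne_zero] at h
    refine h.congr fun n => ?_
    rw [Lp.norm_sq_eq_integral]
    refine integral_congr_ae ?_
    filter_upwards [hufst n e, Lp.coeFn_sub ((ξ n).fst e) (ξ₀.fst e)] with x hx hx'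
    rw [hx', Pi.sub_apply, hx]
  have hwlim : ∀ e, TendstoInMeasure (volume.restrict (G.I e)) (fun n => sqrtMul V (u n).1 e) atTop
      (ξ₀.snd e) := fun e =>
    (tendstoInMeasure_of_tendsto_Lp (hsnd e)).congr_left fun n => husnd n e
  have hunif : ∀ e, UniformCauchySeqOn (fun n => (u n).1 e) atTop (G.I e) := by
    intro e
    rw [Metric.uniformCauchySeqOn_iff]
    intro ε hε
    obtain ⟨n₀, hn₀⟩ := Metric.cauchySeq_iff.1 hlim.cauchySeq (ε / C) (by positivity)
    refine ⟨n₀, fun m hm n hn x hx => ?_⟩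
    have h := hb (u m - u n) e x hx
    rw [map_sub, hu, hu, ← dist_eq_norm] at h
    rw [dist_eq_norm]
    refine lt_of_le_of_lt h ?_
    have := hn₀ m hm n hn
    rwa [lt_div_iff₀ hC, mul_comm] at this
  obtain ⟨u₀, hu₀, h1, h2⟩ := H1A.exists_limit hA hV hV1 (u := fun n => (u n).1)
    (fun n => (u n).2) (d := fun e => ξ₀.fst e) (w := fun e => ξ₀.snd e)
    (fun e => Lp.memLp _) (fun e => Lp.memLp _) hdlim hwlim hunif
  refine ⟨⟨u₀, hu₀⟩, ?_⟩
  apply WithLp.ofLp_injective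
  refine Prod.ext ?_ ?_
  · ext1 e
    exact Lp.ext ((hu₀.2.2.1 e).coeFn_toLp.trans (h1 e))
  · ext1 e
    exact Lp.ext ((H1A.memL2_sqrtMul hV hV1 hu₀ e).coeFn_toLp.trans (h2 e))

end MetricGraph

/-! ### The nonlinear term and its differential -/

/-- Differentiability of `z ↦ |z|^p`, uniformly on bounded sets. -/
theorem exists_uniform_norm_rpow_sub_le {p : ℝ} (hp : 2 < p) (R : ℝ) {ε : ℝ} (hε : 0 < ε) :
    ∃ δ > 0, ∀ z w : ℂ, ‖z‖ ≤ R → ‖w‖ ≤ δ →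
      |‖z + w‖ ^ p - ‖z‖ ^ p - p * (‖z‖ ^ (p - 2) * (z * star w).re)| ≤ ε * ‖w‖ := by
  have hp1 : 1 < p := by linarith
  have hcd : ContDiff ℝ 1 fun x : ℂ => ‖x‖ ^ p := contDiff_norm_rpow hp1
  have hfd : Continuous (fderiv ℝ fun x : ℂ => ‖x‖ ^ p) := hcd.continuous_fderiv (by simp)
  have huc := (isCompact_closedBall (0 : ℂ) (R + 1)).uniformContinuousOn_of_continuous
    hfd.continuousOn
  obtain ⟨δ, hδ, hδε⟩ := Metric.uniformContinuousOn_iff.1 huc ε hε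
  refine ⟨min 1 (δ / 2), by positivity, fun z w hz hw => ?_⟩
  have hw1 : ‖w‖ ≤ 1 := hw.trans (min_le_left _ _)
  have hw2 : ‖w‖ < δ := (hw.trans (min_le_right _ _)).trans_lt (by linarith)
  have hz' : z ∈ Metric.closedBall (0 : ℂ) (R + 1) := by
    rw [mem_closedBall_zero_iff]; linarith
  -- The mean value inequality relative to the differential at `z`; uniform continuity of the
  -- differential on a ball larger by one makes the error small uniformly in `z`.
  have h := (convex_closedBall z ‖w‖).norm_image_sub_le_of_norm_fderiv_le'
    (𝕜 := ℝ) (f := fun x : ℂ => ‖x‖ ^ p) (φ := fderiv ℝ (fun x : ℂ => ‖x‖ ^ p) z) (C := ε)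
    (x := z) (y := z + w) (fun x _ => (hcd.differentiable (by simp)) x) (fun x hx => ?_)
    (Metric.mem_closedBall_self (norm_nonneg _)) (by simp)
  · rw [add_sub_cancel_left, (hasFDerivAt_norm_rpow z hp1).fderiv, Real.norm_eq_abs] at h
    convert h using 2
    simp only [smul_apply, innerSL_apply_apply, smul_eq_mul, Complex.inner,
      Complex.star_def]
    have : (z * (starRingEnd ℂ) w).re = ((starRingEnd ℂ) z * w).re := by simp
    rw [this]
    ring_nf
  · rw [Metric.mem_closedBall, dist_eq_norm] at hx
    have hx' : x ∈ Metric.closedBall (0 : ℂ) (R + 1) := by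
      rw [mem_closedBall_zero_iff]
      have := norm_add_le (x - z) z
      rw [sub_add_cancel] at this
      linarith
    have := hδε x hx' z hz' (by rw [dist_eq_norm]; linarith)
    rw [dist_eq_norm] at this
    exact this.le

/-- Pointwise convergence to zero of functions with a common modulus of continuity is uniform. -/
theorem eventually_forall_norm_le_of_pointwise {X : Type*} {F : Filter X} {f : X → ℝ → ℂ}
    {a b K : ℝ} (hmod : ∀ᶠ x in F, ∀ s ∈ Set.Icc a b, ∀ t ∈ Set.Icc a b,
      ‖f x s - f x t‖ ≤ K * √|s - t|)
    (hpt : ∀ t ∈ Set.Icc a b, Tendsto (fun x => f x t) F (𝓝 0)) {η : ℝ} (hη : 0 < η) :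
    ∀ᶠ x in F, ∀ t ∈ Set.Icc a b, ‖f x t‖ ≤ η := by
  have hr : ∃ r > 0, ∀ d : ℝ, |d| < r → K * √|d| ≤ η / 2 := by
    have hc : Tendsto (fun d : ℝ => K * √|d|) (𝓝 0) (𝓝 0) := by
      have : Continuous fun d : ℝ => K * √|d| := by fun_prop
      simpa using this.tendsto 0
    obtain ⟨r, hr, h⟩ := Metric.eventually_nhds_iff.1 (hc.eventually_lt_const (half_pos hη))
    exact ⟨r, hr, fun d hd => (h (by simpa [Real.dist_eq] using hd)).le⟩
  obtain ⟨r, hr, hrK⟩ := hr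
  -- A finite net suffices: smallness on the net spreads through the common modulus. The argument
  -- works for an arbitrary filter.
  obtain ⟨T, hT, hTf, hcov⟩ := (isCompact_Icc (a := a) (b := b)).finite_cover_balls hr
  have hev : ∀ᶠ x in F, ∀ t ∈ T, ‖f x t‖ < η / 2 := by
    rw [eventually_all_finite hTf]
    intro t ht
    have := (hpt t (hT ht)).norm
    rw [norm_zero] at this
    exact this.eventually_lt_const (half_pos hη)
  filter_upwards [hev, hmod] with x h1 h2 t ht
  obtain ⟨s, hs, hts⟩ := Set.mem_iUnion₂.1 (hcov ht)
  rw [Metric.mem_ball, Real.dist_eq] at hts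
  have h3 := (h2 t ht s (hT hs)).trans (hrK _ hts)
  have h4 := norm_add_le (f x t - f x s) (f x s)
  rw [sub_add_cancel] at h4
  linarith [h1 s hs]

namespace MetricGraph

variable {N B H : Type*} {G : MetricGraph N B H} {p : ℝ} {u v w : B ⊕ H → ℝ → ℂ}

variable (G) in
/-- Continuity on the compact core, edge by edge. -/
def CoreContinuous (u : B ⊕ H → ℝ → ℂ) : Prop :=
  ∀ b : B, ContinuousOn (u (Sum.inl b)) (G.I (Sum.inl b))

theorem integrableOn_core {E : Type*} [NormedAddCommGroup E] {f : ℝ → E} {b : B}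
    (hf : ContinuousOn f (G.I (Sum.inl b))) : IntegrableOn f (G.I (Sum.inl b)) :=
  ContinuousOn.integrableOn_compact isCompact_Icc hf

theorem CoreContinuous.integrable_norm_rpow (hp : 2 < p) (hu : G.CoreContinuous u) (b : B) :
    IntegrableOn (fun x => ‖u (Sum.inl b) x‖ ^ p) (G.I (Sum.inl b)) :=
  integrableOn_core ((hu b).norm.rpow_const fun _ _ => Or.inr (by linarith))

theorem CoreContinuous.integrable_dPsi (hp : 2 < p) (hu : G.CoreContinuous u)
    (hv : G.CoreContinuous v) (b : B) :
    IntegrableOn (fun x => ‖u (Sum.inl b) x‖ ^ (p - 2) *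
      (u (Sum.inl b) x * star (v (Sum.inl b) x)).re) (G.I (Sum.inl b)) :=
  integrableOn_core (((hu b).norm.rpow_const fun _ _ => Or.inr (by linarith)).mul
    (Complex.continuous_re.comp_continuousOn ((hu b).mul (hv b).star)))

variable [Fintype B]

variable (G) in
/-- The differential of `Psi p` at `u`. -/
noncomputable def dPsi (p : ℝ) (u v : B ⊕ H → ℝ → ℂ) : ℝ :=
  ∑ b : B, ∫ x in G.I (Sum.inl b),
    ‖u (Sum.inl b) x‖ ^ (p - 2) * (u (Sum.inl b) x * star (v (Sum.inl b) x)).re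

theorem Psi_nonneg (hp : 2 < p) (u : B ⊕ H → ℝ → ℂ) : 0 ≤ G.Psi p u :=
  mul_nonneg (by rw [one_div, inv_nonneg]; linarith)
    (Finset.sum_nonneg fun _ _ => integral_nonneg fun _ => by positivity)

theorem Psi_smul (u : B ⊕ H → ℝ → ℂ) {t : ℝ} (ht : 0 ≤ t) :
    G.Psi p (t • u) = t ^ p * G.Psi p u := by
  simp only [Psi, Pi.smul_apply, norm_smul, Real.norm_of_nonneg ht,
    Real.mul_rpow ht (norm_nonneg _), integral_const_mul, ← Finset.mul_sum]
  ring

/-- Euler's identity for a `p`-homogeneous functional; it evaluates the Lagrange multiplier. -/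
theorem dPsi_self (hp : 2 < p) (u : B ⊕ H → ℝ → ℂ) : G.dPsi p u u = p * G.Psi p u := by
  rw [Psi, one_div, mul_inv_cancel_left₀ (by linarith), dPsi]
  refine Finset.sum_congr rfl fun b _ => integral_congr_ae (Eventually.of_forall fun x => ?_)
  have h : (u (Sum.inl b) x * star (u (Sum.inl b) x)).re = ‖u (Sum.inl b) x‖ ^ (2 : ℝ) := by
    rw [Complex.star_def, Complex.mul_conj, Complex.ofReal_re, Complex.normSq_eq_norm_sq]
    norm_cast
  simp only [h]
  rw [← Real.rpow_add' (norm_nonneg _) (by linarith)]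
  ring_nf

theorem dPsi_add_smul (hp : 2 < p) (hu : G.CoreContinuous u) (hv : G.CoreContinuous v)
    (hw : G.CoreContinuous w) (t : ℝ) :
    G.dPsi p u (v + t • w) = G.dPsi p u v + t * G.dPsi p u w := by
  simp only [dPsi, Finset.mul_sum, ← Finset.sum_add_distrib]
  refine Finset.sum_congr rfl fun b _ => ?_
  rw [← integral_const_mul, ← integral_add (hu.integrable_dPsi hp hv b)
    ((hu.integrable_dPsi hp hw b).const_mul t)]
  refine integral_congr_ae (Eventually.of_forall fun x => ?_)
  simp; ring

theorem exists_abs_dPsi_le (hp : 2 < p) (hu : G.CoreContinuous u) :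
    ∃ C, 0 ≤ C ∧ ∀ v, ∀ η, (∀ b, ∀ x ∈ G.I (Sum.inl b), ‖v (Sum.inl b) x‖ ≤ η) →
      |G.dPsi p u v| ≤ C * η := by
  refine ⟨∑ b : B, ∫ x in G.I (Sum.inl b), ‖u (Sum.inl b) x‖ ^ (p - 1),
    Finset.sum_nonneg fun _ _ => integral_nonneg fun _ => by positivity, fun v η hv => ?_⟩
  rw [Finset.sum_mul]
  refine (Finset.abs_sum_le_sum_abs _ _).trans (Finset.sum_le_sum fun b _ => ?_)
  rw [← integral_mul_const, ← Real.norm_eq_abs]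
  refine norm_integral_le_of_norm_le ((integrableOn_core
    ((hu b).norm.rpow_const fun _ _ => Or.inr (by linarith))).mul_const η) ?_
  filter_upwards [ae_restrict_mem (G.measurableSet_I _)] with x hx
  have h1 : ‖u (Sum.inl b) x‖ ^ (p - 1) = ‖u (Sum.inl b) x‖ ^ (p - 2) * ‖u (Sum.inl b) x‖ := by
    rw [← Real.rpow_add_one' (norm_nonneg _) (by linarith)]
    ring_nf
  rw [h1, norm_mul, Real.norm_of_nonneg (by positivity), mul_assoc, Real.norm_eq_abs]
  gcongr
  refine (Complex.abs_re_le_norm _).trans ?_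
  rw [norm_mul, norm_star]
  gcongr
  exact hv b x hx

/-- `Psi p` is differentiable with respect to the uniform norm on the compact core. -/
theorem exists_abs_Psi_sub_le (hp : 2 < p) (hu : G.CoreContinuous u) {ε : ℝ} (hε : 0 < ε) :
    ∃ δ > 0, ∀ v, G.CoreContinuous v → ∀ η, 0 ≤ η → η ≤ δ →
      (∀ b, ∀ x ∈ G.I (Sum.inl b), ‖v (Sum.inl b) x‖ ≤ η) →
      |G.Psi p (u + v) - G.Psi p u - G.dPsi p u v| ≤ ε * η := by
  have hp0 : 0 < p := by linarith
  have hbd : ∀ b, ∃ M, ∀ x ∈ G.I (Sum.inl b), ‖u (Sum.inl b) x‖ ≤ M := fun b =>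
    isCompact_Icc.exists_bound_of_continuousOn (hu b)
  choose M hM using hbd
  set R := ∑ b, |M b|
  have hR : ∀ b, ∀ x ∈ G.I (Sum.inl b), ‖u (Sum.inl b) x‖ ≤ R := fun b x hx =>
    (hM b x hx).trans ((le_abs_self _).trans
      (Finset.single_le_sum (f := fun b => |M b|) (fun _ _ => abs_nonneg _) (Finset.mem_univ b)))
  set L := ∑ b, G.len b with hL
  have hL0 : 0 ≤ L := Finset.sum_nonneg fun b _ => (G.len_pos b).le
  -- The pointwise error is integrated over total length `L` and divided by `p`; the `+ 1` avoids
  -- dividing by zero.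
  obtain ⟨δ, hδ, h⟩ := exists_uniform_norm_rpow_sub_le hp R (ε := ε * p / (L + 1))
    (by positivity)
  refine ⟨δ, hδ, fun v hv η hη0 hη hvη => ?_⟩
  have huv : G.CoreContinuous (u + v) := fun b => (hu b).add (hv b)
  have e : G.Psi p (u + v) - G.Psi p u - G.dPsi p u v = (1 / p) * ∑ b : B,
      ∫ x in G.I (Sum.inl b), (‖(u + v) (Sum.inl b) x‖ ^ p - ‖u (Sum.inl b) x‖ ^ p -
        p * (‖u (Sum.inl b) x‖ ^ (p - 2) *
          (u (Sum.inl b) x * star (v (Sum.inl b) x)).re)) := by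
    have : ∀ b : B, ∫ x in G.I (Sum.inl b), (‖(u + v) (Sum.inl b) x‖ ^ p - ‖u (Sum.inl b) x‖ ^ p -
        p * (‖u (Sum.inl b) x‖ ^ (p - 2) *
          (u (Sum.inl b) x * star (v (Sum.inl b) x)).re)) =
        (∫ x in G.I (Sum.inl b), ‖(u + v) (Sum.inl b) x‖ ^ p) -
        (∫ x in G.I (Sum.inl b), ‖u (Sum.inl b) x‖ ^ p) -
        p * ∫ x in G.I (Sum.inl b), ‖u (Sum.inl b) x‖ ^ (p - 2) *
          (u (Sum.inl b) x * star (v (Sum.inl b) x)).re := by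
      intro b
      rw [integral_sub _ ((hu.integrable_dPsi hp hv b).const_mul p),
        integral_sub (huv.integrable_norm_rpow hp b) (hu.integrable_norm_rpow hp b),
        integral_const_mul]
      exact (huv.integrable_norm_rpow hp b).sub (hu.integrable_norm_rpow hp b)
    simp only [this, Finset.sum_sub_distrib, ← Finset.mul_sum, Psi, dPsi]
    field_simp
  rw [e, abs_mul, abs_of_pos (by positivity : 0 < 1 / p)]
  have hb : ∀ b : B, |∫ x in G.I (Sum.inl b), (‖(u + v) (Sum.inl b) x‖ ^ p -
      ‖u (Sum.inl b) x‖ ^ p - p * (‖u (Sum.inl b) x‖ ^ (p - 2) *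
          (u (Sum.inl b) x * star (v (Sum.inl b) x)).re))| ≤ G.len b * (ε * p / (L + 1) * η) := by
    intro b
    rw [← Real.norm_eq_abs]
    have h2 := norm_setIntegral_le_of_norm_le_const (μ := volume) (s := G.I (Sum.inl b))
      (f := fun x => ‖(u + v) (Sum.inl b) x‖ ^ p -
      ‖u (Sum.inl b) x‖ ^ p - p * (‖u (Sum.inl b) x‖ ^ (p - 2) *
          (u (Sum.inl b) x * star (v (Sum.inl b) x)).re)) (C := ε * p / (L + 1) * η)
      measure_Icc_lt_top (fun x hx => by
        refine (h _ _ (hR b x hx) ((hvη b x hx).trans hη)).trans ?_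
        gcongr
        exact hvη b x hx)
    refine h2.trans (le_of_eq ?_)
    simp [I, (G.len_pos b).le, mul_comm]
  calc _ ≤ 1 / p * ∑ b, G.len b * (ε * p / (L + 1) * η) := by
        gcongr
        exact (Finset.abs_sum_le_sum_abs _ _).trans (Finset.sum_le_sum fun b _ => hb b)
    _ = ε * ((L * η) / (L + 1)) := by
        rw [← Finset.sum_mul, ← hL]
        field_simp
    _ ≤ ε * η := by
        gcongr
        rw [div_le_iff₀ (by positivity)]
        linarith

/-- Write `|u|^p = |u|^(p-2) |u|²` on the core; the half-lines only increase the mass on the right.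
-/
theorem Psi_le [Fintype H] (hp : 2 < p) (hu : G.MemL2 u) (hc : G.CoreContinuous u) {S : ℝ}
    (hS0 : 0 ≤ S) (hS : ∀ b, ∀ x ∈ G.I (Sum.inl b), ‖u (Sum.inl b) x‖ ≤ S) :
    p * G.Psi p u ≤ S ^ (p - 2) * G.mass u := by
  rw [Psi, one_div, mul_inv_cancel_left₀ (by linarith), mass, Fintype.sum_sum_type, mul_add]
  have hH : 0 ≤ ∑ h : H, ∫ x in G.I (Sum.inr h), ‖u (Sum.inr h) x‖ ^ 2 :=
    Finset.sum_nonneg fun _ _ => integral_nonneg fun _ => by positivity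
  have key : ∑ b : B, ∫ x in G.I (Sum.inl b), ‖u (Sum.inl b) x‖ ^ p ≤
      S ^ (p - 2) * ∑ b : B, ∫ x in G.I (Sum.inl b), ‖u (Sum.inl b) x‖ ^ 2 := by
    rw [Finset.mul_sum]
    refine Finset.sum_le_sum fun b _ => ?_
    rw [← integral_const_mul]
    refine setIntegral_mono_on (hc.integrable_norm_rpow hp b)
      ((hu (Sum.inl b)).integrable_norm_sq.const_mul _) (G.measurableSet_I _) fun x hx => ?_
    have h1 : ‖u (Sum.inl b) x‖ ^ p = ‖u (Sum.inl b) x‖ ^ (p - 2) * ‖u (Sum.inl b) x‖ ^ 2 := by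
      rw [← Real.rpow_natCast, ← Real.rpow_add' (norm_nonneg _) (by push_cast; linarith)]
      push_cast; ring_nf
    rw [h1]
    have := hS b x hx
    gcongr
  have := mul_nonneg (Real.rpow_nonneg hS0 (p - 2)) hH
  linarith

end MetricGraph

/-! ### Gagliardo-Nirenberg and Hölder estimates; the energy space -/

namespace MetricGraph

variable {N B H : Type*} {G : MetricGraph N B H} {A V : B ⊕ H → ℝ → ℝ}
  {p : ℝ}

theorem H1A.coreContinuous {u : B ⊕ H → ℝ → ℂ} (hu : u ∈ G.H1A A V) : G.CoreContinuous u :=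
  fun b => hu.1.2.1 (Sum.inl b)

variable [Fintype B] [Fintype H]

theorem normSq_nonneg (hV1 : ∀ e, ∀ x ∈ G.I e, 1 ≤ V e x) (u : B ⊕ H → ℝ → ℂ) :
    0 ≤ G.normSq A V u := by
  refine Finset.sum_nonneg fun e _ => setIntegral_nonneg (G.measurableSet_I e) fun x hx => ?_
  have := hV1 e x hx
  positivity

theorem lambda1_nonneg (hV1 : ∀ e, ∀ x ∈ G.I e, 1 ≤ V e x) : 0 ≤ G.lambda1 A V := by
  refine Real.sInf_nonneg ?_
  rintro _ ⟨u, -, -, rfl⟩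
  exact div_nonneg (normSq_nonneg hV1 u) (G.mass_nonneg u)

theorem mass_pos (hV : G.MemL1Loc V) (hV1 : ∀ e, ∀ x ∈ G.I e, 1 ≤ V e x) {u : B ⊕ H → ℝ → ℂ}
    (hu : u ∈ G.H1A A V) (h0 : u ≠ 0) : 0 < G.mass u :=
  lt_of_le_of_ne (G.mass_nonneg u) fun h => h0 (eq_zero_of_mass_eq_zero hV hV1 hu h.symm)

theorem lambda1_mul_mass_le (hV : G.MemL1Loc V) (hV1 : ∀ e, ∀ x ∈ G.I e, 1 ≤ V e x)
    {u : B ⊕ H → ℝ → ℂ} (hu : u ∈ G.H1A A V) :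
    G.lambda1 A V * G.mass u ≤ G.normSq A V u := by
  by_cases h0 : u = 0
  · rw [h0, mass_zero, normSq_zero, mul_zero]
  rw [← le_div_iff₀ (mass_pos hV hV1 hu h0)]
  refine csInf_le ⟨0, ?_⟩ ⟨u, hu, h0, rfl⟩
  rintro _ ⟨u, -, -, rfl⟩
  exact div_nonneg (normSq_nonneg hV1 u) (G.mass_nonneg u)

/-- Inserting the sup bound in `Psi_le`. The squared norm `normSq` appears with exponent `(p - 2) /
4`, which is below `1` exactly when `p < 6`. -/
theorem exists_Psi_le (hV : G.MemL1Loc V) (hV1 : ∀ e, ∀ x ∈ G.I e, 1 ≤ V e x) (hp : 2 < p) :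
    ∃ C > 0, ∀ u ∈ G.H1A A V,
      p * G.Psi p u ≤ (C * (√(G.mass u) * √(G.normSq A V u))) ^ ((p - 2) / 2) * G.mass u := by
  obtain ⟨C, hC, h⟩ := exists_norm_sq_le (A := A) hV hV1
  refine ⟨C, hC, fun u hu => ?_⟩
  have h2 := Psi_le hp (H1A.memL2 hV hV1 hu) (H1A.coreContinuous hu)
    (S := √(C * (√(G.mass u) * √(G.normSq A V u)))) (Real.sqrt_nonneg _)
    (fun b x hx => Real.le_sqrt_of_sq_le (h u hu _ x hx))
  refine h2.trans (le_of_eq ?_)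
  rw [Real.sqrt_eq_rpow, ← Real.rpow_mul (by positivity)]
  congr 2
  ring

/-- The functions of `H¹_A(G, ℂ)` are Hölder continuous on the bounded edges. -/
theorem exists_norm_sub_le (hA : G.MemL2Loc A) (hV : G.MemL1Loc V)
    (hV1 : ∀ e, ∀ x ∈ G.I e, 1 ≤ V e x) (b : B) :
    ∃ K ≥ 0, ∀ u ∈ G.H1A A V, ∀ x ∈ G.I (Sum.inl b), ∀ y ∈ G.I (Sum.inl b),
      ‖u (Sum.inl b) x - u (Sum.inl b) y‖ ≤ √(G.normSq A V u) * K * √|x - y| := by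
  obtain ⟨C, hC, h⟩ := exists_norm_le_norm_energyMap (A := A) hV hV1
  set e : B ⊕ H := Sum.inl b with he
  have hAL : MemLp (fun x => (A e x : ℂ)) 2 (volume.restrict (G.I e)) := by
    have := (hA e (G.len b)).ofReal (K := ℂ)
    rwa [show G.I e ∩ Set.Icc 0 (G.len b) = G.I e from Set.inter_self _] at this
  set a := ∫ x in G.I e, ‖(A e x : ℂ)‖ ^ 2 with ha
  have ha0 : 0 ≤ a := integral_nonneg fun _ => by positivity
  -- From `u' = i (D_A u + A u)`, the inequality `|a + b|² ≤ 2|a|² + 2|b|²` and the sup bound on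
  -- `u`; here `a` is the squared L² norm of the potential on the edge.
  refine ⟨√(2 + 2 * (C ^ 2 * a)), Real.sqrt_nonneg _, fun u hu x hx y hy => ?_⟩
  have hn0 := normSq_nonneg (A := A) hV1 u
  have hbd : ∀ x ∈ G.I e, ‖u e x‖ ^ 2 ≤ C ^ 2 * G.normSq A V u := by
    intro x hx
    have := h ⟨u, hu⟩ e x hx
    rw [← norm_energyMap_sq hV hV1 ⟨u, hu⟩, ← mul_pow]
    exact pow_le_pow_left₀ (norm_nonneg _) this 2
  have hAu : MemLp (fun x => (A e x : ℂ) * u e x) 2 (volume.restrict (G.I e)) := by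
    refine (hAL.const_mul ((√(C ^ 2 * G.normSq A V u) : ℝ) : ℂ)).mono
      (hAL.aestronglyMeasurable.mul (hu.1.aestronglyMeasurable e)) ?_
    filter_upwards [ae_restrict_mem (G.measurableSet_I e)] with t ht
    rw [norm_mul, norm_mul, mul_comm, Complex.norm_real (√_),
      Real.norm_of_nonneg (Real.sqrt_nonneg _)]
    gcongr
    exact Real.le_sqrt_of_sq_le (hbd t ht)
  have hg : MemLp (fun t => Complex.I * (G.DA A u e t + A e t * u e t)) 2
      (volume.restrict (G.I e)) := ((hu.2.2.1 e).add hAu).const_mul _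
  have h1 := norm_sub_le_of_integral (fun x hx y hy => H1A.sub_eq_integral hu e hx hy)
    (show MemLp _ 2 (volume.restrict (Set.Icc 0 (G.len b))) from hg) hy hx
  have h2 : ∫ t in G.I e, ‖Complex.I * (G.DA A u e t + A e t * u e t)‖ ^ 2 ≤
      G.normSq A V u * (2 + 2 * (C ^ 2 * a)) := by
    have h3 : ∫ t in G.I e, ‖Complex.I * (G.DA A u e t + A e t * u e t)‖ ^ 2 ≤
        ∫ t in G.I e, (2 * ‖G.DA A u e t‖ ^ 2 +
          2 * (C ^ 2 * G.normSq A V u) * ‖(A e t : ℂ)‖ ^ 2) := by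
      refine setIntegral_mono_on hg.integrable_norm_sq
        (((hu.2.2.1 e).integrable_norm_sq.const_mul 2).add
          (hAL.integrable_norm_sq.const_mul _)) (G.measurableSet_I e) fun t ht => ?_
      rw [norm_mul, Complex.norm_I, one_mul]
      have h4 := norm_add_le (G.DA A u e t) (A e t * u e t)
      have h5 : ‖(A e t : ℂ) * u e t‖ ^ 2 ≤ C ^ 2 * G.normSq A V u * ‖(A e t : ℂ)‖ ^ 2 := by
        rw [norm_mul, mul_pow, mul_comm]
        gcongr
        exact hbd t ht
      nlinarith [sq_nonneg (‖G.DA A u e t‖ - ‖(A e t : ℂ) * u e t‖),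
        norm_nonneg (G.DA A u e t + A e t * u e t)]
    refine h3.trans ?_
    rw [integral_add ((hu.2.2.1 e).integrable_norm_sq.const_mul 2)
      (hAL.integrable_norm_sq.const_mul _), integral_const_mul, integral_const_mul, ← ha]
    have := setIntegral_DA_le_normSq hV hV1 hu e
    nlinarith
  refine h1.trans ?_
  rw [← Real.sqrt_mul hn0, mul_comm]
  exact mul_le_mul_of_nonneg_right (Real.sqrt_le_sqrt h2) (Real.sqrt_nonneg _)

variable (A) in
/-- The Hilbert space `H¹_A(G, ℂ)`, realised in `L² × L²`. -/
def EnergySpace (hV : G.MemL1Loc V) (hV1 : ∀ e, ∀ x ∈ G.I e, 1 ≤ V e x) : Type _ :=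
  LinearMap.range (energyMap (A := A) hV hV1)

section EnergySpace

variable (hV : G.MemL1Loc V) (hV1 : ∀ e, ∀ x ∈ G.I e, 1 ≤ V e x)

noncomputable instance : NormedAddCommGroup (EnergySpace A hV hV1) :=
  inferInstanceAs (NormedAddCommGroup (LinearMap.range (energyMap (A := A) hV hV1)))

noncomputable instance : InnerProductSpace ℝ (EnergySpace A hV hV1) :=
  inferInstanceAs (InnerProductSpace ℝ (LinearMap.range (energyMap (A := A) hV hV1)))

theorem completeSpace_energySpace (hA : G.MemL2Loc A) : CompleteSpace (EnergySpace A hV hV1) :=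
  (isClosed_range_energyMap hV hV1 hA).completeSpace_coe

variable (A) in
/-- The identification of the functions of `H¹_A(G, ℂ)` with the points of the Hilbert space. -/
noncomputable def energyEquiv : G.H1Submodule A V hV hV1 ≃ₗ[ℝ] EnergySpace A hV hV1 :=
  LinearEquiv.ofInjective _ (energyMap_injective hV hV1)

theorem norm_energyEquiv_sq (u : G.H1Submodule A V hV hV1) :
    ‖energyEquiv A hV hV1 u‖ ^ 2 = G.normSq A V u := norm_energyMap_sq hV hV1 u

theorem norm_energyEquiv (u : G.H1Submodule A V hV hV1) :
    ‖energyEquiv A hV hV1 u‖ = √(G.normSq A V u) := by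
  rw [← norm_energyEquiv_sq, Real.sqrt_sq (norm_nonneg _)]

variable (A) in
/-- The embedding of `H¹_A(G, ℂ)` into `L²(G, ℂ)`. -/
noncomputable def massMap : EnergySpace A hV hV1 →L[ℝ] G.L2Space :=
  LinearMap.mkContinuous
    ({ toFun := fun u => (H1A.memL2 hV hV1 u.2).toL2
       map_add' := fun u v => by
        have h := MemL2.toL2_eq_add_smul (H1A.memL2 hV hV1 u.2) (H1A.memL2 hV hV1 v.2)
          (H1A.memL2 hV hV1 (u + v).2) 1 fun e => Eventually.of_forall fun x => by simp
        rwa [one_smul] at h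
       map_smul' := fun t u => by
        have h0 : G.MemL2 0 := fun e => by simp
        have h00 : h0.toL2 = 0 := by ext1 e; simp [MemL2.toL2]
        have h := MemL2.toL2_eq_add_smul h0 (H1A.memL2 hV hV1 u.2)
          (H1A.memL2 hV hV1 (t • u).2) t fun e => Eventually.of_forall fun x => by simp
        rwa [h00, zero_add] at h } ∘ₗ (energyEquiv A hV hV1).symm.toLinearMap) 1
    (fun ξ => by
      obtain ⟨u, rfl⟩ := (energyEquiv A hV hV1).surjective ξ
      refine le_of_sq_le_sq ?_ (by positivity)
      rw [one_mul, norm_energyEquiv_sq]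
      simp only [LinearMap.comp_apply, LinearEquiv.coe_coe, LinearEquiv.symm_apply_apply]
      exact (MemL2.norm_toL2_sq _).trans_le (mass_le_normSq hV hV1 u.2))

theorem norm_massMap_sq (u : G.H1Submodule A V hV hV1) :
    ‖massMap A hV hV1 (energyEquiv A hV hV1 u)‖ ^ 2 = G.mass u := by
  have : massMap A hV hV1 (energyEquiv A hV hV1 u) = (H1A.memL2 hV hV1 u.2).toL2 := by
    change (H1A.memL2 hV hV1 ((energyEquiv A hV hV1).symm (energyEquiv A hV hV1 u)).2).toL2 = _
    simp only [LinearEquiv.symm_apply_apply]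
  rw [this, MemL2.norm_toL2_sq]

theorem inner_massMap (u v : G.H1Submodule A V hV hV1) :
    inner ℝ (massMap A hV hV1 (energyEquiv A hV hV1 u))
      (massMap A hV hV1 (energyEquiv A hV hV1 v)) = (G.innerL2 u v).re := by
  have h1 := norm_add_sq_real (massMap A hV hV1 (energyEquiv A hV hV1 u))
      (massMap A hV hV1 (energyEquiv A hV hV1 v))
  rw [← map_add, ← map_add, norm_massMap_sq, norm_massMap_sq, norm_massMap_sq] at h1
  have h2 := mass_add_smul (H1A.memL2 hV hV1 u.2) (H1A.memL2 hV hV1 v.2) 1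
  rw [one_smul] at h2
  have h3 : G.mass (u + v : G.H1Submodule A V hV hV1) = G.mass (u.1 + v.1) := rfl
  linarith

end EnergySpace

end MetricGraph

/-! ### Weak continuity, minimisers and constrained critical points -/

namespace MetricGraph

variable {N B H : Type*} {G : MetricGraph N B H} {A V : B ⊕ H → ℝ → ℝ} [Fintype B] [Fintype H]
  {p : ℝ}

section EnergySpace

variable (hV : G.MemL1Loc V) (hV1 : ∀ e, ∀ x ∈ G.I e, 1 ≤ V e x)

/-- `Psi p` as a function on the Hilbert space `H¹_A(G, ℂ)`. -/
noncomputable def energyPsi (p : ℝ) (ξ : EnergySpace A hV hV1) : ℝ :=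
  G.Psi p ((energyEquiv A hV hV1).symm ξ).1

theorem energyPsi_energyEquiv (u : G.H1Submodule A V hV hV1) :
    energyPsi hV hV1 p (energyEquiv A hV hV1 u) = G.Psi p u := by
  rw [energyPsi, LinearEquiv.symm_apply_apply]

theorem exists_norm_symm_le : ∃ C > 0, ∀ ξ : EnergySpace A hV hV1, ∀ e, ∀ x ∈ G.I e,
    ‖((energyEquiv A hV hV1).symm ξ).1 e x‖ ≤ C * ‖ξ‖ := by
  obtain ⟨C, hC, h⟩ := exists_norm_le_norm_energyMap (A := A) hV hV1
  refine ⟨C, hC, fun ξ e x hx => ?_⟩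
  obtain ⟨u, rfl⟩ := (energyEquiv A hV hV1).surjective ξ
  rw [LinearEquiv.symm_apply_apply]
  exact h u e x hx

/-- The differential of `energyPsi`. -/
theorem exists_hasFDerivAt_energyPsi (hp : 2 < p) (u : G.H1Submodule A V hV hV1) :
    ∃ L : EnergySpace A hV hV1 →L[ℝ] ℝ,
      (∀ v, L (energyEquiv A hV hV1 v) = G.dPsi p u v) ∧
      HasFDerivAt (energyPsi hV hV1 p) L (energyEquiv A hV hV1 u) := by
  obtain ⟨C, hC, hb⟩ := exists_norm_symm_le (A := A) hV hV1
  have hcc : ∀ v : G.H1Submodule A V hV hV1, G.CoreContinuous v.1 := fun v =>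
    H1A.coreContinuous v.2
  obtain ⟨K, hK, hdb⟩ := exists_abs_dPsi_le hp (hcc u)
  let l : G.H1Submodule A V hV hV1 →ₗ[ℝ] ℝ :=
    { toFun := fun v => G.dPsi p u v
      map_add' := fun v w => by
        have := dPsi_add_smul hp (hcc u) (hcc v) (hcc w) 1
        rwa [one_smul, one_mul] at this
      map_smul' := fun t v => by
        have h0 : G.dPsi p u.1 0 = 0 := by simp [dPsi]
        have h := dPsi_add_smul hp (hcc u) (hcc 0) (hcc v) t
        have e : (0 : G.H1Submodule A V hV hV1).1 = 0 := rfl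
        rw [e, zero_add, h0, zero_add] at h
        exact h }
  have hl : ∀ ξ, ‖(l ∘ₗ (energyEquiv A hV hV1).symm.toLinearMap) ξ‖ ≤ K * C * ‖ξ‖ := by
    intro ξ
    rw [mul_assoc]
    exact hdb _ _ fun b x hx => hb ξ _ x hx
  refine ⟨LinearMap.mkContinuous _ (K * C) hl, fun v => ?_, ?_⟩
  · change l ((energyEquiv A hV hV1).symm _) = _
    rw [LinearEquiv.symm_apply_apply]
    rfl
  · rw [hasFDerivAt_iff_isLittleO_nhds_zero, Asymptotics.isLittleO_iff]
    intro ε hε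
    obtain ⟨δ, hδ, h⟩ := exists_abs_Psi_sub_le hp (hcc u) (ε := ε / C) (by positivity)
    filter_upwards [Metric.ball_mem_nhds 0 (show 0 < δ / C by positivity)] with ξ hξ
    rw [mem_ball_zero_iff, lt_div_iff₀ hC, mul_comm] at hξ
    have h1 := h _ (hcc ((energyEquiv A hV hV1).symm ξ)) (C * ‖ξ‖) (by positivity) hξ.le
      (fun b x hx => hb ξ _ x hx)
    rw [div_mul_eq_mul_div, mul_left_comm, mul_div_cancel_left₀ _ hC.ne'] at h1
    rw [energyPsi_energyEquiv, energyPsi, map_add, LinearEquiv.symm_apply_apply]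
    exact h1

/-- Point evaluation is a bounded functional by the sup bound; its real and imaginary parts are
inner products with fixed vectors. -/
theorem tendsto_symm_of_weak {F : Filter (EnergySpace A hV hV1)}
    [CompleteSpace (EnergySpace A hV hV1)]
    {ξ₀ : EnergySpace A hV hV1}
    (hF : ∀ η : EnergySpace A hV hV1, Tendsto (fun ξ => inner ℝ ξ η) F (𝓝 (inner ℝ ξ₀ η)))
    {e : B ⊕ H} {x : ℝ} (hx : x ∈ G.I e) :
    Tendsto (fun ξ => ((energyEquiv A hV hV1).symm (ξ - ξ₀)).1 e x) F (𝓝 0) := by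
  obtain ⟨C, hC, hb⟩ := exists_norm_symm_le (A := A) hV hV1
  let ev : EnergySpace A hV hV1 →L[ℝ] ℂ := LinearMap.mkContinuous
    { toFun := fun ξ => ((energyEquiv A hV hV1).symm ξ).1 e x
      map_add' := fun ξ η => by rw [map_add]; rfl
      map_smul' := fun t ξ => by rw [map_smul]; rfl } C fun ξ => hb ξ e x hx
  have hfun : ∀ l : EnergySpace A hV hV1 →L[ℝ] ℝ, Tendsto (fun ξ => l (ξ - ξ₀)) F (𝓝 0) := by
    intro l
    have h := (hF ((InnerProductSpace.toDual ℝ _).symm l)).sub_const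
      (inner ℝ ξ₀ ((InnerProductSpace.toDual ℝ _).symm l))
    rw [sub_self] at h
    refine h.congr fun ξ => ?_
    rw [← inner_sub_left, real_inner_comm, InnerProductSpace.toDual_symm_apply]
  have hre := hfun (Complex.reCLM.comp ev)
  have him := hfun (Complex.imCLM.comp ev)
  have h : Tendsto (fun ξ => (((ev (ξ - ξ₀)).re : ℂ) + ((ev (ξ - ξ₀)).im : ℂ) * Complex.I)) F
      (𝓝 (((0 : ℝ) : ℂ) + ((0 : ℝ) : ℂ) * Complex.I)) :=
    ((Complex.continuous_ofReal.tendsto _).comp hre).add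
      (((Complex.continuous_ofReal.tendsto _).comp him).mul_const _)
  simp only [Complex.re_add_im, Complex.ofReal_zero, zero_mul, add_zero] at h
  exact h

/-- `Psi p` is weakly continuous on bounded sets. -/
theorem tendsto_energyPsi_of_weak (hA : G.MemL2Loc A) (hp : 2 < p)
    [CompleteSpace (EnergySpace A hV hV1)]
    {F : Filter (EnergySpace A hV hV1)} {ξ₀ : EnergySpace A hV hV1} {R : ℝ}
    (hR : ∀ᶠ ξ in F, ‖ξ‖ ≤ R)
    (hF : ∀ η : EnergySpace A hV hV1, Tendsto (fun ξ => inner ℝ ξ η) F (𝓝 (inner ℝ ξ₀ η))) :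
    Tendsto (energyPsi hV hV1 p) F (𝓝 (energyPsi hV hV1 p ξ₀)) := by
  set E := energyEquiv A hV hV1 with hE
  -- Compactness of the bounded edges enters here: pointwise convergence plus a common Hölder
  -- modulus is uniform convergence on the core.
  have hunif : ∀ η > 0, ∀ᶠ ξ in F, ∀ b, ∀ x ∈ G.I (Sum.inl b),
      ‖(E.symm (ξ - ξ₀)).1 (Sum.inl b) x‖ ≤ η := by
    intro η hη
    rw [eventually_all]
    intro b
    obtain ⟨K, hK, hmod⟩ := exists_norm_sub_le hA hV hV1 b
    refine eventually_forall_norm_le_of_pointwise (K := (R + ‖ξ₀‖) * K) ?_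
      (fun t ht => tendsto_symm_of_weak hV hV1 hF (e := Sum.inl b) ht) hη
    filter_upwards [hR] with ξ hξ s hs t ht
    refine (hmod _ (E.symm (ξ - ξ₀)).2 s hs t ht).trans ?_
    rw [← norm_energyEquiv hV hV1, ← hE, LinearEquiv.apply_symm_apply]
    have := (norm_sub_le ξ ξ₀).trans (add_le_add_left hξ ‖ξ₀‖)
    gcongr
  have hcc : ∀ v : G.H1Submodule A V hV hV1, G.CoreContinuous v.1 := fun v =>
    H1A.coreContinuous v.2
  obtain ⟨K, hK, hdb⟩ := exists_abs_dPsi_le hp (hcc (E.symm ξ₀))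
  obtain ⟨δ, hδ, h⟩ := exists_abs_Psi_sub_le hp (hcc (E.symm ξ₀)) one_pos
  rw [Metric.tendsto_nhds]
  intro ε hε
  have hη : 0 < min δ (ε / (2 * (K + 1))) := by positivity
  filter_upwards [hunif _ hη] with ξ hξ
  have h1 := h _ (hcc (E.symm (ξ - ξ₀))) _ hη.le (min_le_left _ _) hξ
  have h2 := hdb _ _ hξ
  have e : (E.symm ξ₀).1 + (E.symm (ξ - ξ₀)).1 = (E.symm ξ).1 := by
    rw [map_sub]; exact add_sub_cancel _ _
  rw [e] at h1
  rw [Real.dist_eq]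
  change |G.Psi p (E.symm ξ).1 - G.Psi p (E.symm ξ₀).1| < ε
  have h3 : (K + 1) * min δ (ε / (2 * (K + 1))) ≤ ε / 2 := by
    calc _ ≤ (K + 1) * (ε / (2 * (K + 1))) := by gcongr; exact min_le_right _ _
      _ = _ := by field_simp
  rw [abs_le] at h1 h2
  rw [abs_lt]
  constructor <;> linarith [h1.1, h1.2, h2.1, h2.2]

end EnergySpace

theorem _root_.HasFDerivAt.half_norm_sq_sub {X : Type*} [NormedAddCommGroup X]
    [InnerProductSpace ℝ X] {f : X → ℝ} {L : X →L[ℝ] ℝ} {x : X} (h : HasFDerivAt f L x) :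
    HasFDerivAt (fun y => 1 / 2 * ‖y‖ ^ 2 - f y) (innerSL ℝ x - L) x := by
  refine HasFDerivAt.congr_fderiv
    (((hasStrictFDerivAt_norm_sq x).hasFDerivAt.const_mul (1 / 2 : ℝ)).sub h) ?_
  rw [two_smul, ← two_smul ℝ, smul_smul]
  norm_num

/-- The energy has a minimizer among the functions of mass `μ` with norm at most `R`, and its norm
is less than `R`. -/
theorem exists_energy_minimizer (hA : G.MemL2Loc A) (hV : G.MemL1Loc V)
    (hV1 : ∀ e, ∀ x ∈ G.I e, 1 ≤ V e x) (hp : 2 < p) {μ R : ℝ} (hμ : 0 < μ) (hR0 : 0 ≤ R)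
    (hR : ∀ u ∈ G.H1A A V, 0 < G.mass u → G.mass u ≤ μ → G.normSq A V u ≤ R ^ 2 →
      G.energy A V p u ≤ G.lambda1 A V / 2 * G.mass u →
      G.normSq A V u * μ < R ^ 2 * G.mass u)
    (hw : ∃ w ∈ G.H1A A V, G.mass w = μ ∧ G.normSq A V w ≤ R ^ 2 ∧
      G.energy A V p w < G.lambda1 A V / 2 * μ) :
    ∃ u ∈ G.H1A A V, G.mass u = μ ∧ G.normSq A V u < R ^ 2 ∧
      G.energy A V p u < G.lambda1 A V / 2 * μ ∧
      ∀ v ∈ G.H1A A V, G.mass v = μ → G.normSq A V v ≤ R ^ 2 →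
        G.energy A V p u ≤ G.energy A V p v := by
  have hcomp : CompleteSpace (EnergySpace A hV hV1) := completeSpace_energySpace hV hV1 hA
  set E := energyEquiv A hV hV1 with hE
  set J := massMap A hV hV1 with hJdef
  obtain ⟨C, hC, hPsi⟩ := exists_Psi_le (A := A) hV hV1 hp
  have hEn : ∀ u : G.H1Submodule A V hV hV1,
      1 / 2 * ‖E u‖ ^ 2 - energyPsi hV hV1 p (E u) = G.energy A V p u := fun u => by
    rw [hE, norm_energyEquiv_sq, energyPsi_energyEquiv, energy]
  have hle : ∀ u : G.H1Submodule A V hV hV1, ‖E u‖ ≤ R ↔ G.normSq A V u ≤ R ^ 2 := fun u => by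
    rw [← norm_energyEquiv_sq hV hV1, ← hE, sq_le_sq₀ (norm_nonneg _) hR0]
  obtain ⟨ξ, hξμ, hξR, hξE, hmin⟩ := exists_minimizer_on_sphere J (energyPsi hV hV1 p)
    (p := p) (lam := G.lambda1 A V) (R := R) (μ := μ)
    (M := p⁻¹ * ((C * (R * R)) ^ ((p - 2) / 2) * R ^ 2))
    (fun ξ hξ => by
      obtain ⟨u, rfl⟩ := E.surjective ξ
      have h := norm_massMap_sq hV hV1 u
      rw [← hE, ← hJdef, hξ, norm_zero, zero_pow two_ne_zero] at h
      have : u = 0 := Subtype.ext (eq_zero_of_mass_eq_zero hV hV1 u.2 h.symm)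
      rw [this, map_zero])
    (fun ξ => by
      obtain ⟨u, rfl⟩ := E.surjective ξ
      rw [norm_massMap_sq, norm_energyEquiv_sq]
      exact lambda1_mul_mass_le hV hV1 u.2)
    (fun ξ => Psi_nonneg hp _) hp.le
    (fun t ht ξ => by
      rw [energyPsi, map_smul]
      exact Psi_smul _ ht)
    (fun ξ hξ => by
      obtain ⟨u, rfl⟩ := E.surjective ξ
      have h1 := hPsi u.1 u.2
      have h2 := (hle u).1 hξ
      have h3 := (mass_le_normSq hV hV1 u.2).trans h2
      have h4 : √(G.normSq A V u.1) ≤ R := Real.sqrt_le_iff.2 ⟨hR0, h2⟩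
      have h5 : √(G.mass u.1) ≤ R := Real.sqrt_le_iff.2 ⟨hR0, h3⟩
      rw [hE, energyPsi_energyEquiv, le_inv_mul_iff₀ (by linarith)]
      refine h1.trans ?_
      have := G.mass_nonneg u.1
      have : 0 ≤ (p - 2) / 2 := by linarith
      gcongr)
    (fun F ξ hF hweak => tendsto_energyPsi_of_weak hV hV1 hA hp hF hweak) hμ hR0
    (fun ξ h1 h2 h3 h4 => by
      obtain ⟨u, rfl⟩ := E.surjective ξ
      rw [hEn] at h4
      rw [norm_massMap_sq] at h1 h2 h4 ⊢
      rw [norm_energyEquiv_sq]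
      exact hR u.1 u.2 h1 h2 ((hle u).1 h3) h4)
    (by
      obtain ⟨w, hw, h1, h2, h3⟩ := hw
      refine ⟨E ⟨w, hw⟩, by rwa [norm_massMap_sq], (hle _).2 h2, ?_⟩
      rwa [hEn])
  obtain ⟨u, rfl⟩ := E.surjective ξ
  rw [norm_massMap_sq] at hξμ
  rw [hEn] at hξE
  refine ⟨u.1, u.2, hξμ, ?_, hξE, fun v hv h1 h2 => ?_⟩
  · rw [← norm_energyEquiv_sq hV hV1, ← hE]
    exact pow_lt_pow_left₀ hξR (norm_nonneg _) two_ne_zero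
  · have h := hmin (E ⟨v, hv⟩) (by rwa [norm_massMap_sq]) ((hle _).2 h2)
    rwa [hEn, hEn] at h

/-- A minimizer of the energy among the functions of mass `μ` with norm at most `R`, whose norm is
less than `R`, is a constrained critical point. -/
theorem isConstrainedCriticalPoint_of_min (hV : G.MemL1Loc V)
    (hV1 : ∀ e, ∀ x ∈ G.I e, 1 ≤ V e x) (hp : 2 < p) {μ R : ℝ} (hμ : 0 < μ) (hR0 : 0 ≤ R)
    {u : B ⊕ H → ℝ → ℂ} (hu : u ∈ G.H1A A V) (huμ : G.mass u = μ) (huR : G.normSq A V u < R ^ 2)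
    (hmin : ∀ v ∈ G.H1A A V, G.mass v = μ → G.normSq A V v ≤ R ^ 2 →
      G.energy A V p u ≤ G.energy A V p v) :
    G.IsConstrainedCriticalPoint A V p μ u ((G.normSq A V u - p * G.Psi p u) / μ) := by
  lift u to G.H1Submodule A V hV hV1 using hu
  set E := energyEquiv A hV hV1 with hE
  set J := massMap A hV hV1 with hJdef
  have hEn : ∀ u : G.H1Submodule A V hV hV1,
      1 / 2 * ‖E u‖ ^ 2 - energyPsi hV hV1 p (E u) = G.energy A V p u := fun u => by
    rw [hE, norm_energyEquiv_sq, energyPsi_energyEquiv, energy]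
  have hξμ : ‖J (E u)‖ ^ 2 = μ := by rwa [norm_massMap_sq]
  have hξR : ‖E u‖ < R := by
    rw [← sq_lt_sq₀ (norm_nonneg _) hR0, hE, norm_energyEquiv_sq]
    exact huR
  obtain ⟨L, hL, hLd⟩ := exists_hasFDerivAt_energyPsi hV hV1 hp u
  have hder : HasFDerivAt (fun ξ => 1 / 2 * ‖ξ‖ ^ 2 - energyPsi hV hV1 p ξ)
      (innerSL ℝ (E u) - L) (E u) :=
    hLd.half_norm_sq_sub
  have hmin' : ∀ η, ‖J η‖ ^ 2 = μ → ‖η‖ ≤ R → 1 / 2 * ‖E u‖ ^ 2 - energyPsi hV hV1 p (E u) ≤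
      1 / 2 * ‖η‖ ^ 2 - energyPsi hV hV1 p η := by
    intro η h1 h2
    obtain ⟨v, rfl⟩ := E.surjective η
    rw [norm_massMap_sq] at h1
    rw [← sq_le_sq₀ (norm_nonneg _) hR0, hE, norm_energyEquiv_sq] at h2
    rw [hEn, hEn]
    exact hmin v.1 v.2 h1 h2
  have hEL : ∀ η, (innerSL ℝ (E u) - L) η =
      (innerSL ℝ (E u) - L) (E u) / μ * inner ℝ (J (E u)) (J η) := by
    intro η
    exact fderiv_eq_of_min_on_sphere J hμ hξμ hξR hder hmin' η
  have hself : (innerSL ℝ (E u) - L) (E u) = G.normSq A V u - p * G.Psi p u := by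
    rw [sub_apply, innerSL_apply_apply, real_inner_self_eq_norm_sq, hL, hE,
      norm_energyEquiv_sq, dPsi_self hp]
  rw [hself] at hEL
  have hmem : u.1 ∈ G.H1A A V := u.2
  refine ⟨⟨hmem, huμ⟩, ?_⟩
  intro ε hε
  rw [hasFDerivAt_iff_isLittleO_nhds_zero] at hder
  obtain ⟨δ, hδ, hball⟩ := Metric.eventually_nhds_iff.1 (Asymptotics.isLittleO_iff.1 hder hε)
  refine ⟨δ, hδ, fun v hv hvδ => ?_⟩
  have hnv : ‖E ⟨v, hv⟩‖ = G.norm A V v := norm_energyEquiv hV hV1 ⟨v, hv⟩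
  have h := hball (y := E ⟨v, hv⟩) (by rw [dist_zero_right, hnv]; exact hvδ)
  rw [← map_add, hEn, hEn, hEL, inner_massMap, hnv, Real.norm_eq_abs] at h
  exact h

end MetricGraph

/-! ### The bottom of the spectrum and the ingredients of the mass regimes -/

namespace MetricGraph

variable {N B H : Type*} {G : MetricGraph N B H} {A V : B ⊕ H → ℝ → ℝ} [Fintype B] [Fintype H]
  {p : ℝ} {u v f g h : B ⊕ H → ℝ → ℂ}

theorem innerL2_self_re (hu : G.MemL2 u) : (G.innerL2 u u).re = G.mass u := by
  have h1 := mass_add_smul hu hu 1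
  have h2 := mass_smul hu 2
  rw [two_smul] at h2
  rw [one_smul, h2] at h1
  linarith

theorem form_self_re (hV : G.MemL1Loc V) (hV1 : ∀ e, ∀ x ∈ G.I e, 1 ≤ V e x)
    (hu : u ∈ G.H1A A V) : (G.form A V u u).re = G.normSq A V u := by
  have h1 := normSq_add_smul hV hV1 hu hu 1
  have h2 := normSq_smul hV hV1 hu 2
  rw [two_smul] at h2
  rw [one_smul, h2] at h1
  linarith

theorem innerL2_add_smul_re (hf : G.MemL2 f) (hg : G.MemL2 g) (hh : G.MemL2 h) (c : ℝ) :
    (G.innerL2 (f + (c : ℂ) • g) h).re = (G.innerL2 f h).re + c * (G.innerL2 g h).re := by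
  have key : G.innerL2 (f + (c : ℂ) • g) h = G.innerL2 f h + c * G.innerL2 g h := by
    simp only [innerL2, Finset.mul_sum, ← Finset.sum_add_distrib]
    refine Finset.sum_congr rfl fun e _ => ?_
    rw [← integral_const_mul, ← integral_add ((hf e).integrable_mul_star (hh e))
      (((hg e).integrable_mul_star (hh e)).const_mul _)]
    refine integral_congr_ae (Eventually.of_forall fun x => ?_)
    simp only [Pi.add_apply, Pi.smul_apply, smul_eq_mul]
    ring
  rw [key, Complex.add_re, Complex.re_ofReal_mul]

theorem innerL2_smul_re (hg : G.MemL2 g) (hh : G.MemL2 h) (c : ℝ) :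
    (G.innerL2 ((c : ℂ) • g) h).re = c * (G.innerL2 g h).re := by
  have h0 : G.MemL2 0 := fun e => by simp
  simpa [innerL2] using innerL2_add_smul_re h0 hg hh c

/-- The bottom of the quadratic form belongs to the spectrum. -/
theorem lambda1_mem_spec (hV : G.MemL1Loc V) (hV1 : ∀ e, ∀ x ∈ G.I e, 1 ≤ V e x)
    (hne : ∃ u ∈ G.H1A A V, u ≠ 0) : G.lambda1 A V ∈ G.spec A V := by
  rintro ⟨-, C, hC⟩
  set l := G.lambda1 A V with hl
  -- If `(T - l) w = v` with `mass w ≤ C mass v`, then `Re (v, w) ≤ K mass v`. Nonnegativity of the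
  -- shifted form at `w - K v` then forces a Rayleigh quotient of at least `l + 1/K` for every `v`,
  -- contradicting that `l` is the infimum.
  set K := (1 + |C|) / 2 with hK
  have hK0 : 0 < K := by positivity
  have key : ∀ v ∈ G.H1A A V, v ≠ 0 → l + 1 / K ≤ G.normSq A V v / G.mass v := by
    intro v hv hv0
    have hm := mass_pos hV hV1 hv hv0
    have hvL := H1A.memL2 hV hV1 hv
    obtain ⟨w, ⟨hw, -, hform⟩, hmw⟩ := hC v hvL
    have hwL := H1A.memL2 hV hV1 hw
    have h1 : (G.form A V w v).re = G.mass v + l * (G.innerL2 w v).re := by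
      rw [hform v hv, innerL2_add_smul_re hvL hwL hvL, innerL2_self_re hvL]
    have h2 : G.normSq A V w = (G.innerL2 v w).re + l * G.mass w := by
      rw [← form_self_re hV hV1 hw, hform w hw, innerL2_add_smul_re hvL hwL hwL,
        innerL2_self_re hwL]
    have h3 := mass_add_smul hvL hwL (-1)
    have h4 := G.mass_nonneg (v + (-1 : ℝ) • w)
    have h5 : G.mass w ≤ |C| * G.mass v :=
      hmw.trans (mul_le_mul_of_nonneg_right (le_abs_self C) hm.le)
    have h6 := normSq_add_smul hV hV1 hw hv (-K)
    have h7 := mass_add_smul hwL hvL (-K)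
    have h8 := lambda1_mul_mass_le hV hV1 (H1A.add_smul_mem hV hV1 hw hv (-K))
    rw [← hl, h6, h7, h1, h2] at h8
    have h9 : (G.innerL2 v w).re ≤ K * G.mass v := by
      rw [hK]; linarith
    have h10 : K * (K * (G.normSq A V v - l * G.mass v) - G.mass v) ≥ 0 := by nlinarith
    have h11 := nonneg_of_mul_nonneg_right h10 hK0
    rw [le_div_iff₀ hm, add_mul, one_div, inv_mul_eq_div]
    have : G.mass v / K ≤ G.normSq A V v - l * G.mass v := by
      rw [div_le_iff₀ hK0]; linarith
    linarith
  obtain ⟨u, hu, hu0⟩ := hne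
  have : l + 1 / K ≤ l := by
    refine le_csInf ⟨_, u, hu, hu0, rfl⟩ ?_
    rintro _ ⟨v, hv, hv0, rfl⟩
    exact key v hv hv0
  have : 0 < 1 / K := by positivity
  linarith

theorem OpEq.normSq_eq (hV : G.MemL1Loc V) (hV1 : ∀ e, ∀ x ∈ G.I e, 1 ≤ V e x) {l : ℝ}
    (hu : G.OpEq A V u ((l : ℂ) • u)) : G.normSq A V u = l * G.mass u := by
  have huL := H1A.memL2 hV hV1 hu.1
  rw [← form_self_re hV hV1 hu.1, hu.2.2 u hu.1, innerL2_smul_re huL huL, innerL2_self_re huL]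

/-- An eigenvalue below the essential spectrum forces `λ₁` to be an eigenvalue. -/
theorem CondGm.isEigenvalue_lambda1 (hV : G.MemL1Loc V) (hV1 : ∀ e, ∀ x ∈ G.I e, 1 ≤ V e x)
    {m : ℕ∞} (hm : G.CondGm A V m) : G.IsEigenvalue A V (G.lambda1 A V) := by
  obtain ⟨hm1, ev, -, hev⟩ := hm
  obtain ⟨⟨u, hu, hu0⟩, hess⟩ := hev 0 (by
    rw [Nat.cast_zero]; exact lt_of_lt_of_le zero_lt_one hm1)
  have hu1 : u ∈ G.H1A A V := hu.1
  have hmass := mass_pos hV hV1 hu1 hu0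
  have hle : G.lambda1 A V ≤ ev 0 := by
    have h1 := lambda1_mul_mass_le hV hV1 hu1
    rw [OpEq.normSq_eq hV hV1 hu] at h1
    exact le_of_mul_le_mul_right h1 hmass
  have hlt : (G.lambda1 A V : EReal) < G.infEssSpec A V :=
    lt_of_le_of_lt (EReal.coe_le_coe_iff.2 hle) hess
  by_contra hne
  -- Points of the discrete spectrum are eigenvalues by definition, so a spectral point that is not
  -- an eigenvalue is essential.
  have hmem : G.lambda1 A V ∈ G.essSpec A V :=
    ⟨lambda1_mem_spec hV hV1 ⟨u, hu1, hu0⟩, fun hd => hne hd.2.2.1⟩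
  exact absurd hlt (not_lt.2 (sInf_le ⟨_, hmem, rfl⟩))

theorem exists_Psi_le_of_small (hV : G.MemL1Loc V) (hV1 : ∀ e, ∀ x ∈ G.I e, 1 ≤ V e x)
    (hp : 2 < p) : ∃ R > 0, ∀ u ∈ G.H1A A V, G.normSq A V u ≤ R ^ 2 →
      p * G.Psi p u ≤ G.normSq A V u / 2 := by
  obtain ⟨C, hC, h⟩ := exists_Psi_le (A := A) hV hV1 hp
  have hp2 : 0 < (p - 2) / 2 := by linarith
  -- Chosen so that `r ^ ((p - 2) / 2) = 1 / 2`.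
  set r : ℝ := (1 / 2 : ℝ) ^ ((p - 2) / 2)⁻¹ with hr
  have hr0 : 0 < r := by positivity
  refine ⟨√(r / C), by positivity, fun u hu hn => ?_⟩
  rw [Real.sq_sqrt (by positivity), le_div_iff₀ hC] at hn
  have hmn := mass_le_normSq hV hV1 hu
  have hm0 := G.mass_nonneg u
  have h1 : C * (√(G.mass u) * √(G.normSq A V u)) ≤ r := by
    refine le_trans ?_ hn
    rw [mul_comm _ C]
    gcongr
    calc √(G.mass u) * √(G.normSq A V u) ≤ √(G.normSq A V u) * √(G.normSq A V u) := by gcongr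
      _ = _ := Real.mul_self_sqrt (hm0.trans hmn)
  calc p * G.Psi p u ≤ _ := h u hu
    _ ≤ r ^ ((p - 2) / 2) * G.normSq A V u := by gcongr
    _ = G.normSq A V u / 2 := by
      rw [hr, ← Real.rpow_mul (by norm_num), inv_mul_cancel₀ hp2.ne', Real.rpow_one]
      ring

theorem Psi_pos (hp : 2 < p) (hu : G.CoreContinuous u) {b : B} {x : ℝ}
    (hx : x ∈ G.I (Sum.inl b)) (h : u (Sum.inl b) x ≠ 0) : 0 < G.Psi p u := by
  refine mul_pos (by rw [one_div, inv_pos]; linarith) ?_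
  refine lt_of_lt_of_le ?_ (Finset.single_le_sum
    (f := fun b => ∫ x in G.I (Sum.inl b), ‖u (Sum.inl b) x‖ ^ p)
    (fun b _ => integral_nonneg fun _ => by positivity) (Finset.mem_univ b))
  have h1 := intervalIntegral.integral_pos (G.len_pos b)
    (f := fun x => ‖u (Sum.inl b) x‖ ^ p)
    ((hu b).norm.rpow_const fun _ _ => Or.inr (by linarith)) (fun y _ => by positivity)
    ⟨x, hx, Real.rpow_pos_of_pos (norm_pos_iff.2 h) p⟩
  rw [intervalIntegral.integral_of_le (G.len_pos b).le, ← integral_Icc_eq_integral_Ioc] at h1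
  exact h1

/-- Sublinear growth; the exponent will be `(p - 2) / 4`, and this is the only use of `p < 6`. -/
theorem exists_forall_add_mul_rpow_lt (a b : ℝ) {θ : ℝ} (hθ : θ < 1) :
    ∃ S > 0, ∀ s ≥ S, a + b * s ^ θ < s := by
  have h1 : Tendsto (fun s : ℝ => a * s⁻¹ + b * s ^ (-(1 - θ))) atTop (𝓝 0) := by
    have h := (tendsto_inv_atTop_zero.const_mul a).add
      ((tendsto_rpow_neg_atTop (sub_pos.2 hθ)).const_mul b)
    simpa using h
  obtain ⟨S, hS⟩ := eventually_atTop.1 (h1.eventually_lt_const one_pos)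
  refine ⟨max S 1, by positivity, fun s hs => ?_⟩
  have hs0 : 0 < s := one_pos.trans_le ((le_max_right _ _).trans hs)
  have h2 := mul_lt_mul_of_pos_right (hS s ((le_max_left _ _).trans hs)) hs0
  rw [add_mul, inv_mul_cancel_right₀ hs0.ne', one_mul, mul_assoc, ← Real.rpow_add_one hs0.ne'] at h2
  rwa [show -(1 - θ) + 1 = θ by ring] at h2

theorem exists_smul_mass_eq (hV : G.MemL1Loc V) (hV1 : ∀ e, ∀ x ∈ G.I e, 1 ≤ V e x)
    (hu : u ∈ G.H1A A V) (hu0 : u ≠ 0) {μ : ℝ} (hμ : 0 < μ) :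
    ∃ t : ℝ, 0 < t ∧ t • u ∈ G.H1A A V ∧ G.mass (t • u) = μ ∧
      G.normSq A V (t • u) = G.normSq A V u / G.mass u * μ := by
  have hm := mass_pos hV hV1 hu hu0
  have ht : √(μ / G.mass u) ^ 2 = μ / G.mass u := Real.sq_sqrt (by positivity)
  refine ⟨√(μ / G.mass u), by positivity,
    (G.H1Submodule A V hV hV1).smul_mem _ hu, ?_, ?_⟩
  · rw [mass_smul (H1A.memL2 hV hV1 hu), ht, div_mul_cancel₀ _ hm.ne']
  · rw [normSq_smul hV hV1 hu, ht]; ring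

/-- Under condition (G) there is a test function of mass `μ` with energy below `λ₁ μ / 2`. -/
theorem CondG.exists_energy_lt (hV : G.MemL1Loc V) (hV1 : ∀ e, ∀ x ∈ G.I e, 1 ≤ V e x)
    (hp : 2 < p) (hG : G.CondG A V) {μ : ℝ} (hμ : 0 < μ) :
    ∃ w ∈ G.H1A A V, G.mass w = μ ∧ G.normSq A V w = G.lambda1 A V * μ ∧
      G.energy A V p w < G.lambda1 A V / 2 * μ := by
  obtain ⟨φ, hφ, hφ0, hl, b, x, hx, hφx⟩ := hG
  obtain ⟨t, ht, h1, h2, h3⟩ := exists_smul_mass_eq hV hV1 hφ hφ0 hμ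
  rw [hl] at h3
  refine ⟨t • φ, h1, h2, h3, ?_⟩
  have := Psi_pos hp (H1A.coreContinuous h1) hx (smul_ne_zero ht.ne' hφx)
  rw [energy, h3]
  linarith

/-- Eigenfunctions that vanish on the compact core are constrained critical points. -/
theorem OpEq.isConstrainedCriticalPoint (hV : G.MemL1Loc V)
    (hV1 : ∀ e, ∀ x ∈ G.I e, 1 ≤ V e x) (hp : 2 < p) {l t : ℝ} (ht : 0 < t)
    (hu : G.OpEq A V u ((l : ℂ) • u)) (hK : ∀ b, ∀ x ∈ G.I (Sum.inl b), u (Sum.inl b) x = 0) :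
    G.IsConstrainedCriticalPoint A V p (G.mass (t • u)) (t • u) l := by
  have huL := H1A.memL2 hV hV1 hu.1
  refine ⟨⟨(G.H1Submodule A V hV hV1).smul_mem t hu.1, rfl⟩, fun ε hε => ?_⟩
  obtain ⟨R, hR, hsmall⟩ := exists_Psi_le_of_small (A := A) hV hV1 hp
  -- The remainder turns out to be exactly `‖v‖² / 2 - Ψ v`: `R` makes it nonnegative, and `ε`
  -- bounds `‖v‖²` by `ε ‖v‖`.
  refine ⟨min R ε, by positivity, fun v hv hvδ => ?_⟩
  have hvL := H1A.memL2 hV hV1 hv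
  have hn0 := normSq_nonneg (A := A) hV1 v
  have hnorm : G.norm A V v ^ 2 = G.normSq A V v := Real.sq_sqrt hn0
  have hnn : 0 ≤ G.norm A V v := Real.sqrt_nonneg _
  have h1 : G.Psi p (t • u + v) = G.Psi p v := by
    unfold Psi
    congr 1
    refine Finset.sum_congr rfl fun b _ => setIntegral_congr_fun (G.measurableSet_I _) fun x hx => ?_
    simp [hK b x hx]
  have h2 : G.Psi p (t • u) = 0 := by
    unfold Psi
    rw [Finset.sum_eq_zero, mul_zero]
    intro b _
    rw [← integral_zero]
    refine setIntegral_congr_fun (G.measurableSet_I _) fun x hx => ?_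
    simp [hK b x hx, Real.zero_rpow (by linarith : p ≠ 0)]
  have h3 : G.normSq A V (t • u + v) = t ^ 2 * G.normSq A V u +
      2 * t * (l * (G.innerL2 u v).re) + G.normSq A V v := by
    have e : t • u + v = t • (u + t⁻¹ • v) := by
      rw [smul_add, smul_inv_smul₀ ht.ne']
    rw [e, normSq_smul hV hV1 (H1A.add_smul_mem hV hV1 hu.1 hv _),
      normSq_add_smul hV hV1 hu.1 hv, hu.2.2 v hv, innerL2_smul_re huL hvL]
    field_simp
  have h4 : (G.innerL2 (t • u) v).re = t * (G.innerL2 u v).re := by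
    rw [← innerL2_smul_re huL hvL]
    congr 2
  have h5 : G.energy A V p (t • u + v) - G.energy A V p (t • u) - l * (G.innerL2 (t • u) v).re =
      1 / 2 * G.normSq A V v - G.Psi p v := by
    rw [energy, energy, h1, h2, h3, h4, normSq_smul hV hV1 hu.1]
    ring
  have h6 := hsmall v hv (by
    rw [← hnorm]
    exact pow_le_pow_left₀ hnn (hvδ.le.trans (min_le_left _ _)) 2)
  have h7 : 0 ≤ G.Psi p v := Psi_nonneg hp v
  have h8 : G.norm A V v ^ 2 ≤ ε * G.norm A V v := by
    rw [sq]
    exact mul_le_mul_of_nonneg_right (hvδ.le.trans (min_le_right _ _)) hnn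
  have h9 : 2 * G.Psi p v ≤ p * G.Psi p v := by gcongr
  simp only [h5]
  rw [abs_of_nonneg (by linarith)]
  linarith

/-- The common core of both mass regimes, with the ball condition left as a hypothesis. The strict
bound on the multiplier is `lam μ = ‖u‖² - pΨ ≤ 2E < λ₁ μ`, by `p > 2`. -/
theorem exists_critical_point_of_condG (hA : G.MemL2Loc A) (hV : G.MemL1Loc V)
    (hV1 : ∀ e, ∀ x ∈ G.I e, 1 ≤ V e x) (hp : 2 < p) (hG : G.CondG A V) {μ R : ℝ} (hμ : 0 < μ)
    (hR0 : 0 ≤ R) (hRμ : G.lambda1 A V * μ ≤ R ^ 2)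
    (hR : ∀ u ∈ G.H1A A V, 0 < G.mass u → G.mass u ≤ μ → G.normSq A V u ≤ R ^ 2 →
      G.energy A V p u ≤ G.lambda1 A V / 2 * G.mass u →
      G.normSq A V u * μ < R ^ 2 * G.mass u) :
    ∃ u lam, G.IsConstrainedCriticalPoint A V p μ u lam ∧ lam < G.lambda1 A V ∧
      lam * μ = G.normSq A V u - p * G.Psi p u ∧ G.normSq A V u < R ^ 2 := by
  obtain ⟨w, hw, hwμ, hwn, hwE⟩ := hG.exists_energy_lt hV hV1 hp hμ
  obtain ⟨u, hu, huμ, huR, huE, hmin⟩ := exists_energy_minimizer hA hV hV1 hp hμ hR0 hR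
    ⟨w, hw, hwμ, hwn.trans_le hRμ, hwE⟩
  refine ⟨u, _, isConstrainedCriticalPoint_of_min hV hV1 hp hμ hR0 hu huμ huR hmin, ?_,
    div_mul_cancel₀ _ hμ.ne', huR⟩
  rw [div_lt_iff₀ hμ]
  have h7 : 0 ≤ G.Psi p u := Psi_nonneg hp u
  have h9 : 2 * G.Psi p u ≤ p * G.Psi p u := by gcongr
  rw [energy] at huE
  linarith

end MetricGraph

/-! ### The two mass regimes and the conclusion -/

namespace MetricGraph

variable {N B H : Type*} {G : MetricGraph N B H} {A V : B ⊕ H → ℝ → ℝ} [Fintype B] [Fintype H]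
  {p : ℝ}

theorem CondG.exists_critical_point_of_small_mass (hA : G.MemL2Loc A) (hV : G.MemL1Loc V)
    (hV1 : ∀ e, ∀ x ∈ G.I e, 1 ≤ V e x) (hp : 2 < p) (hG : G.CondG A V) :
    ∃ μ₀ > 0, ∀ μ : ℝ, 0 < μ → μ ≤ μ₀ →
      ∃ u lam, G.IsConstrainedCriticalPoint A V p μ u lam ∧ 0 ≤ lam ∧ lam < G.lambda1 A V := by
  obtain ⟨R, hR, hsmall⟩ := exists_Psi_le_of_small (A := A) hV hV1 hp
  have hl0 : 0 ≤ G.lambda1 A V := lambda1_nonneg hV1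
  -- In the ball the energy bound gives `‖u‖² ≤ 2 λ₁ mass u`, so the ball condition needs `2 λ₁ μ <
  -- R²`; the `+ 2` gives strictness and a nonzero denominator.
  refine ⟨R ^ 2 / (2 * G.lambda1 A V + 2), by positivity, fun μ hμ hμ₀ => ?_⟩
  rw [le_div_iff₀ (by positivity)] at hμ₀
  have hlμ : 0 ≤ G.lambda1 A V * μ := by positivity
  obtain ⟨u, lam, hu, hlt, heq, hn⟩ := exists_critical_point_of_condG hA hV hV1 hp hG hμ hR.le
    (by linarith) fun u hu hm hmμ hn hE => by
      have h1 := hsmall u hu hn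
      have h2 : 2 * G.Psi p u ≤ p * G.Psi p u :=
        mul_le_mul_of_nonneg_right hp.le (Psi_nonneg hp u)
      rw [energy] at hE
      calc G.normSq A V u * μ ≤ 2 * G.lambda1 A V * G.mass u * μ := by gcongr; linarith
        _ = 2 * (G.lambda1 A V * μ) * G.mass u := by ring
        _ < R ^ 2 * G.mass u := by gcongr; linarith
  refine ⟨u, lam, hu, ?_, hlt⟩
  have h1 := hsmall u hu.1.1 hn.le
  have h2 := normSq_nonneg (A := A) hV1 u
  exact nonneg_of_mul_nonneg_left (by linarith : 0 ≤ lam * μ) hμ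

theorem CondG.exists_critical_point_of_subcritical (hA : G.MemL2Loc A) (hV : G.MemL1Loc V)
    (hV1 : ∀ e, ∀ x ∈ G.I e, 1 ≤ V e x) (hp : 2 < p) (hp6 : p < 6) (hG : G.CondG A V)
    {μ : ℝ} (hμ : 0 < μ) :
    ∃ u lam, G.IsConstrainedCriticalPoint A V p μ u lam ∧ lam < G.lambda1 A V := by
  obtain ⟨C, hC, hPsi⟩ := exists_Psi_le (A := A) hV hV1 hp
  have hl0 : 0 ≤ G.lambda1 A V := lambda1_nonneg hV1
  obtain ⟨S, hS0, hS⟩ := exists_forall_add_mul_rpow_lt (G.lambda1 A V * μ)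
    ((C * √μ) ^ ((p - 2) / 2) * μ) (by linarith : (p - 2) / 4 < 1)
  have hmax : 0 ≤ max S (G.lambda1 A V * μ) := hS0.le.trans (le_max_left _ _)
  obtain ⟨u, lam, hu, hlt, -⟩ := exists_critical_point_of_condG hA hV hV1 hp hG hμ
    (Real.sqrt_nonneg (max S (G.lambda1 A V * μ)))
    (by rw [Real.sq_sqrt hmax]; exact le_max_right _ _) fun u hu hm hmμ _ hE => by
      rw [Real.sq_sqrt hmax]
      by_contra! hcon
      have hn0 := normSq_nonneg (A := A) hV1 u
      -- The squared norm of `u` rescaled to mass `μ`. If it reached the squared radius, the energy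
      -- bound would give `s ≤ λ₁ μ + const · s ^ ((p - 2) / 4)`, impossible beyond `S`.
      set s := G.normSq A V u * μ / G.mass u with hs
      have hs0 : 0 ≤ s := by positivity
      have hsS : S ≤ s := (le_max_left _ _).trans ((le_div_iff₀ hm).2 hcon)
      have hns : G.normSq A V u ≤ s := by
        rw [hs, le_div_iff₀ hm]; gcongr
      have hpow : (C * (√(G.mass u) * √(G.normSq A V u))) ^ ((p - 2) / 2) ≤
          (C * √μ) ^ ((p - 2) / 2) * s ^ ((p - 2) / 4) := by
        have hp2 : 0 ≤ (p - 2) / 2 := by linarith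
        calc _ ≤ (C * √μ * √s) ^ ((p - 2) / 2) := by
              rw [mul_assoc]; gcongr
          _ = _ := by
              rw [Real.mul_rpow (by positivity) (by positivity), Real.sqrt_eq_rpow s,
                ← Real.rpow_mul hs0]
              congr 2; ring
      have h2 : 2 * G.Psi p u ≤ p * G.Psi p u :=
        mul_le_mul_of_nonneg_right hp.le (Psi_nonneg hp u)
      have h3 := hPsi u hu
      rw [energy] at hE
      have h4 : G.normSq A V u ≤
          (G.lambda1 A V + (C * √μ) ^ ((p - 2) / 2) * s ^ ((p - 2) / 4)) * G.mass u := by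
        have := mul_le_mul_of_nonneg_right hpow hm.le
        linarith
      have h5 : s ≤ G.lambda1 A V * μ + (C * √μ) ^ ((p - 2) / 2) * μ * s ^ ((p - 2) / 4) := by
        rw [hs, div_le_iff₀ hm, ← hs]
        calc _ ≤ _ := mul_le_mul_of_nonneg_right h4 hμ.le
          _ = _ := by ring
      exact absurd (hS s hsS) (not_lt.2 h5)
  exact ⟨u, lam, hu, hlt⟩

/-- A ground state exists but must vanish on the core, since otherwise it would witness (G). There
the equation is linear, so any mass is attained by scaling. -/
theorem CondGm.exists_critical_point_of_not_condG (hV : G.MemL1Loc V)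
    (hV1 : ∀ e, ∀ x ∈ G.I e, 1 ≤ V e x) (hp : 2 < p) {m : ℕ∞} (hGm : G.CondGm A V m)
    (hG : ¬ G.CondG A V) {μ : ℝ} (hμ : 0 < μ) :
    ∃ u, G.IsConstrainedCriticalPoint A V p μ u (G.lambda1 A V) := by
  obtain ⟨φ, hφ, hφ0⟩ := hGm.isEigenvalue_lambda1 hV hV1
  have hφ' : G.OpEq A V φ ((G.lambda1 A V : ℂ) • φ) := hφ
  obtain ⟨t, ht, -, htμ, -⟩ := exists_smul_mass_eq hV hV1 hφ'.1 hφ0 hμ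
  refine ⟨t • φ, ?_⟩
  rw [← htμ]
  refine hφ'.isConstrainedCriticalPoint hV hV1 hp ht fun b x hx => ?_
  by_contra hne
  refine hG ⟨φ, hφ'.1, hφ0, ?_, b, x, hx, hne⟩
  rw [hφ'.normSq_eq hV hV1, mul_div_cancel_right₀ _ (mass_pos hV hV1 hφ'.1 hφ0).ne']

end MetricGraph

theorem theorem1p3 {N B H : Type*} [Fintype B] [Fintype H] [Nonempty B]
    (G : MetricGraph N B H) (hG : G.IsConnected)
    (A V : B ⊕ H → ℝ → ℝ) (hA : G.MemL2Loc A) (hV : G.MemL1Loc V)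
    (hV1 : ∀ e, ∀ x ∈ G.I e, 1 ≤ V e x)
    (p : ℝ) (hp : 2 < p)
    (hGm : G.CondG A V ∨ ∃ m : ℕ∞, G.CondGm A V m) :
    (∃ μ₀ > 0, ∀ μ : ℝ, 0 < μ → μ ≤ μ₀ →
      ∃ (u : B ⊕ H → ℝ → ℂ) (lam : ℝ), G.IsConstrainedCriticalPoint A V p μ u lam ∧
        0 ≤ lam ∧ lam ≤ G.lambda1 A V ∧ (G.CondG A V → lam < G.lambda1 A V)) ∧
    (p < 6 → ∀ μ : ℝ, 0 < μ →
      ∃ (u : B ⊕ H → ℝ → ℂ) (lam : ℝ), G.IsConstrainedCriticalPoint A V p μ u lam ∧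
        lam ≤ G.lambda1 A V ∧ (G.CondG A V → lam < G.lambda1 A V)) := by
  -- The split is on (G) itself rather than on the given alternative, since the strict inequality is
  -- due whenever (G) holds, even if (G_m) was the hypothesis supplied.
  by_cases hcG : G.CondG A V
  · refine ⟨?_, fun hp6 μ hμ => ?_⟩
    · obtain ⟨μ₀, hμ₀, h⟩ := hcG.exists_critical_point_of_small_mass hA hV hV1 hp
      refine ⟨μ₀, hμ₀, fun μ hμ hle => ?_⟩
      obtain ⟨u, lam, hu, h0, hlt⟩ := h μ hμ hle
      exact ⟨u, lam, hu, h0, hlt.le, fun _ => hlt⟩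
    · obtain ⟨u, lam, hu, hlt⟩ := hcG.exists_critical_point_of_subcritical hA hV hV1 hp hp6 hμ
      exact ⟨u, lam, hu, hlt.le, fun _ => hlt⟩
  · obtain ⟨m, hm⟩ := hGm.resolve_left hcG
    -- The threshold `1` is arbitrary: without (G) every mass works.
    refine ⟨⟨1, one_pos, fun μ hμ _ => ?_⟩, fun _ μ hμ => ?_⟩ <;>
      obtain ⟨u, hu⟩ := hm.exists_critical_point_of_not_condG hV hV1 hp hcG hμ
    · exact ⟨u, _, hu, MetricGraph.lambda1_nonneg hV1, le_rfl, fun h => absurd h hcG⟩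
    · exact ⟨u, _, hu, le_rfl, fun h => absurd h hcG⟩
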